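/- **Setting.** Let $d\in\{2,3\}$, $T>0$, and let $\Omega\subset\mathbb R^d$ be a bounded domain with smooth boundary and outward unit normal $\mathbf n$. Let $p,e,s$ be continuously differentiable functions of $(\varrho,\vartheta)\in(0,\infty)^2$ satisfying Gibbs' equation $\vartheta Ds=De+pD(1/\varrho)$ and the thermodynamic stability hypothesis $\partial p(\varrho,\vartheta)/\partial\varrho>0$, $\partial e(\varrho,\vartheta)/\partial\vartheta>0$. On the vacuum $\varrho=0$ the quantities $p$, $\varrho e$, $\varrho s$ are understood as limits for $\varrho\to0+$. Let $\mathcal E$ be the image of $(0,\infty)^2$ under $(\varrho,\vartheta)\mapsto(\varrho,\varrho s(\varrho,\vartheta))$. Let $E_{\rm int}(\varrho,S)=\varrho e(\varrho,S)$ be the internal energy as a function of $(\varrho,S)\in\mathcal E$, $S=\varrho s$. It is extended to $\mathbb R^2$ by $\liminf_{\mathcal E\ni(\varrho',S')\to(\varrho,S)}\varrho'e(\varrho',S')$ at the points of $\overline{\mathcal E}\setminus\mathcal E$ and by $\infty$ outside $\overline{\mathcal E}$. Put $\mathbb S(\nabla\mathbf u)=\mu(\nabla\mathbf u+\nabla^t\mathbf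 u-\frac2d\,{\rm div}\,\mathbf u\,\mathbb I)+\eta\,{\rm div}\,\mathbf u\,\mathbb I$ and $\mathbf q=-\kappa\nabla\vartheta$, where $\mu>0$, $\eta\ge0$, $\kappa$ are functions of $(\varrho,\vartheta)$. Let $\mathbf u_b\in C^2(\overline\Omega;\mathbb R^d)$, $\varrho_b\in C^1(\overline\Omega)$, $F_{i,b}\in C(\overline\Omega)$, $\mathbf g\in C(\overline\Omega;\mathbb R^d)$, and $\Gamma_{\rm in}=\{x\in\partial\Omega:\mathbf u_b\cdot\mathbf n<0\}$, $\Gamma_{\rm out}=\{x\in\partial\Omega:\mathbf u_b\cdot\mathbf n>0\}$. **Weak solutions.** A weak solution consists of $(\varrho,\mathbf u,\vartheta)$ on $[0,T]\times\Omega$ (representatives defined at every time, the value at $t=0$ being the initial state, with $\varrho(0,\cdot)\geq 0$, $\vartheta(0,\cdot)>0$ a.e.), together with functions $\varrho,S$ on $(0,T)\times\Gamma_{\rm out}$, such that the following holds. Inside $\Omega$ we write $S=\varrho s(\varrho,\vartheta)$. *Class.* For some $\gamma,q>1$: $\varrho\in L^\infty(0,T;L^\gamma(\Omega))$, $\varrho\ge0$,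 $\varrho\mathbf u\in L^\infty(0,T;L^{2\gamma/(\gamma+1)}(\Omega))$, $\mathbf u\in L^q(0,T;W^{1,q}(\Omega))$, $\mathbf u-\mathbf u_b\in L^q(0,T;W^{1,q}_0(\Omega))$; $\vartheta,\log\vartheta\in L^2(0,T;W^{1,2}(\Omega))$, $\vartheta>0$ a.e. in $(0,T)\times\Omega$, the trace of $\vartheta$ is positive a.e. on $(0,T)\times\Gamma_{\rm in}$ and $1/\vartheta\in L^1((0,T)\times\Gamma_{\rm in})$; $S\in L^\infty(0,T;L^1(\Omega))$; $\varrho,S,E_{\rm int}(\varrho,S)\in L^1((0,T)\times\Gamma_{\rm out};|\mathbf u_b\cdot\mathbf n|\,d\sigma dt)$; and the integrals in (1)–(4) converge absolutely: $\varrho(\tau)$, $\varrho\mathbf u(\tau)$ are integrable on $\Omega$ for all $\tau\in[0,T]$; $\frac12\varrho|\mathbf u-\mathbf u_b|^2+\varrho e$ and $\varrho s$ are integrable on $\Omega$ at $t=0$; $\varrho|\mathbf u|^2$, $p$, $\mathbb S$, $\frac12\varrho|\mathbf u-\mathbf u_b|^2+\varrho e$, $\varrho s\mathbf u$, $\mathbf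 q/\vartheta$ and $\frac1\vartheta(\mathbb S:\nabla\mathbf u-\frac{\mathbf q\cdot\nabla\vartheta}{\vartheta})$ are integrable on $(0,T)\times\Omega$; and $\frac{F_{i,b}}\vartheta+[s(\varrho_b,\vartheta)-\frac{e(\varrho_b,\vartheta)}\vartheta]\varrho_b\mathbf u_b\cdot\mathbf n$ is integrable on $(0,T)\times\Gamma_{\rm in}$. (1) For all $\tau\in[0,T]$, $\varphi\in C^1([0,T]\times\overline\Omega)$: $$\Big[\int_\Omega\varrho\varphi\Big]_0^\tau+\int_0^\tau\!\!\int_{\Gamma_{\rm in}}\varphi\varrho_b\mathbf u_b\cdot\mathbf n+\int_0^\tau\!\!\int_{\Gamma_{\rm out}}\varphi\varrho\,\mathbf u_b\cdot\mathbf n=\int_0^\tau\!\!\int_\Omega[\varrho\partial_t\varphi+\varrho\mathbf u\cdot\nabla\varphi].$$ (2) For all $\tau\in[0,T]$, $\boldsymbol\varphi\in C^1_c([0,T]\times\Omega;\mathbb R^d)$: $$\Big[\int_\Omega\varrho\mathbf u\cdot\boldsymbol\varphi\Big]_0^\tau=\int_0^\tau\!\!\int_\Omega[\varrho\mathbf u\cdot\partial_t\boldsymbol\varphi+\varrho\mathbf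 u\otimes\mathbf u:\nabla\boldsymbol\varphi+p\,{\rm div}\boldsymbol\varphi-\mathbb S:\nabla\boldsymbol\varphi+\varrho\mathbf g\cdot\boldsymbol\varphi].$$ (3) For all $\psi\in C^1[0,T]$, $\psi\ge0$, and a.a. $\tau\in[0,T]$: $$\begin{aligned}&\Big[\psi\int_\Omega\big(\tfrac12\varrho|\mathbf u-\mathbf u_b|^2+\varrho e\big)\Big]_0^\tau-\int_0^\tau\partial_t\psi\int_\Omega\big(\tfrac12\varrho|\mathbf u-\mathbf u_b|^2+\varrho e\big)+\int_0^\tau\psi\int_{\Gamma_{\rm out}}E_{\rm int}(\varrho,S)\mathbf u_b\cdot\mathbf n\\&\le\int_0^\tau\psi\int_\Omega\Big[\mathbb S:\nabla\mathbf u_b+\varrho\mathbf g\cdot(\mathbf u-\mathbf u_b)+\tfrac12\varrho\mathbf u\cdot\nabla|\mathbf u_b|^2-(\varrho\mathbf u\otimes\mathbf u+p\mathbb I):\nabla\mathbf u_b\Big]-\int_0^\tau\psi\int_{\Gamma_{\rm in}}F_{i,b}.\end{aligned}$$ (4) For all $\varphi\in C^1([0,T]\times\overline\Omega)$, $\varphi\ge0$,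 and a.a. $\tau\in[0,T]$: $$\begin{aligned}&\Big[\int_\Omega\varrho s\varphi\Big]_0^\tau-\int_0^\tau\!\!\int_\Omega\Big[\varrho s\,\partial_t\varphi+\varrho s\mathbf u\cdot\nabla\varphi+\frac{\mathbf q}\vartheta\cdot\nabla\varphi\Big]+\int_0^\tau\!\!\int_{\Gamma_{\rm out}}\varphi S\,\mathbf u_b\cdot\mathbf n\\&\ge\int_0^\tau\!\!\int_\Omega\frac\varphi\vartheta\Big(\mathbb S:\nabla\mathbf u-\frac{\mathbf q\cdot\nabla\vartheta}\vartheta\Big)-\int_0^\tau\!\!\int_{\Gamma_{\rm in}}\varphi\Big(\frac{F_{i,b}}\vartheta+\Big[s(\varrho_b,\vartheta)-\frac{e(\varrho_b,\vartheta)}\vartheta\Big]\varrho_b\mathbf u_b\cdot\mathbf n\Big).\end{aligned}$$ **Proposition 3.1 (Relative energy inequality).** (a) Let $\tilde\varrho,\tilde{\mathbf u},\tilde\vartheta\in C^1([0,T]\times\overline\Omega)$ with $\tilde{\mathbf u}=\mathbf u_b$ on $\partial\Omega$ and with $\tilde\varrho$, $\tilde\vartheta$ bounded above and below by positive constants. Write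 $\tilde b=b(\tilde\varrho,\tilde\vartheta)$ for $b=p,e,s$, $\tilde S=\tilde\varrho\tilde s$, and let $$E(\varrho,\mathbf u,\vartheta\,|\,\tilde\varrho,\tilde{\mathbf u},\tilde\vartheta)=\tfrac12\varrho|\mathbf u-\tilde{\mathbf u}|^2+\varrho e-\frac{\partial(\varrho e)|_\varrho(\tilde\varrho,\tilde S)}{\partial S}(S-\tilde S)-\frac{\partial(\varrho e)|_S(\tilde\varrho,\tilde S)}{\partial\varrho}(\varrho-\tilde\varrho)-\tilde\varrho e(\tilde\varrho,\tilde S)$$ (derivatives of $\varrho e$ in the variables $(\varrho,S)$). Then for every weak solution all integrals below converge absolutely for a.a. $\tau\in[0,T]$, and for a.a. $\tau\in[0,T]$ $$\begin{aligned}&\Big[\int_\Omega E(\varrho,\mathbf u,\vartheta\,|\,\tilde\varrho,\tilde{\mathbf u},\tilde\vartheta)\Big]_{t=0}^{t=\tau}+\int_0^\tau\!\!\int_{\Gamma_{\rm out}}\Big(E_{\rm int}(\varrho,S)-\frac{\partial(\varrho e)|_\varrho(\tilde\varrho,\tilde S)}{\partial S}S-\frac{\partial(\varrho e)|_S(\tilde\varrho,\tilde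 S)}{\partial\varrho}\varrho\Big)\mathbf u_b\cdot\mathbf n\\&+\int_0^\tau\!\!\int_\Omega\frac{\tilde\vartheta}\vartheta\Big(\mathbb S:\nabla\mathbf u-\frac{\mathbf q\cdot\nabla\vartheta}\vartheta\Big)\\&\le-\int_0^\tau\!\!\int_\Omega\varrho(\tilde{\mathbf u}-\mathbf u)\otimes(\tilde{\mathbf u}-\mathbf u):\nabla\tilde{\mathbf u}+\int_0^\tau\!\!\int_\Omega\varrho(\tilde{\mathbf u}-\mathbf u)\cdot\Big(\partial_t\tilde{\mathbf u}+\tilde{\mathbf u}\cdot\nabla\tilde{\mathbf u}+\frac1{\tilde\varrho}\nabla\tilde p-\mathbf g\Big)\\&-\int_0^\tau\!\!\int_\Omega p\,{\rm div}\tilde{\mathbf u}+\int_0^\tau\!\!\int_\Omega\frac\varrho{\tilde\varrho}(\mathbf u-\tilde{\mathbf u})\cdot\nabla\tilde p+\int_0^\tau\!\!\int_\Omega\mathbb S:\nabla\tilde{\mathbf u}\\&-\int_0^\tau\!\!\int_\Omega\Big[\varrho(s-\tilde s)\partial_t\tilde\vartheta+\varrho(s-\tilde s)\mathbf u\cdot\nabla\tilde\vartheta+\frac{\mathbf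 q}\vartheta\cdot\nabla\tilde\vartheta\Big]\\&+\int_0^\tau\!\!\int_{\Gamma_{\rm in}}\Big(F_{i,b}\Big(\frac{\tilde\vartheta}\vartheta-1\Big)+\tilde\vartheta\Big[s(\varrho_b,\vartheta)-\tilde s+\frac{\tilde e}{\tilde\vartheta}-\frac{e(\varrho_b,\vartheta)}\vartheta\Big]\varrho_b\mathbf u_b\cdot\mathbf n\Big)\\&+\int_0^\tau\!\!\int_{\Gamma_{\rm in}}\frac{\varrho_b}{\tilde\varrho}\tilde p\,\mathbf u_b\cdot\mathbf n+\int_0^\tau\!\!\int_\Omega\Big(\Big(1-\frac\varrho{\tilde\varrho}\Big)\partial_t\tilde p-\frac\varrho{\tilde\varrho}\mathbf u\cdot\nabla\tilde p\Big).\end{aligned}$$ (b) The relative energy is the Bregman distance of the total energy $E(\varrho,\mathbf m,S)=\frac12\frac{|\mathbf m|^2}\varrho+\varrho e(\varrho,S)$: for $\varrho,\vartheta,\tilde\varrho,\tilde\vartheta>0$, $\mathbf u,\tilde{\mathbf u}\in\mathbb R^d$, and $\mathbf m=\varrho\mathbf u$, $S=\varrho s(\varrho,\vartheta)$, $\tilde{\mathbf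 m}=\tilde\varrho\tilde{\mathbf u}$, $\tilde S=\tilde\varrho s(\tilde\varrho,\tilde\vartheta)$, $$E(\varrho,\mathbf u,\vartheta\,|\,\tilde\varrho,\tilde{\mathbf u},\tilde\vartheta)=E(\varrho,\mathbf m,S)-DE(\tilde\varrho,\tilde{\mathbf m},\tilde S)\cdot(\varrho-\tilde\varrho,\mathbf m-\tilde{\mathbf m},S-\tilde S)-E(\tilde\varrho,\tilde{\mathbf m},\tilde S),$$ and with $H_{\tilde\vartheta}(\varrho,\vartheta)=\varrho(e(\varrho,\vartheta)-\tilde\vartheta s(\varrho,\vartheta))$ it also equals $$\tfrac12\varrho|\mathbf u-\tilde{\mathbf u}|^2+H_{\tilde\vartheta}(\varrho,\vartheta)-\frac{\partial H_{\tilde\vartheta}(\tilde\varrho,\tilde\vartheta)}{\partial\varrho}(\varrho-\tilde\varrho)-H_{\tilde\vartheta}(\tilde\varrho,\tilde\vartheta).$$ (c) If $\mathcal E$ is convex, then $E(\varrho,\mathbf m,S)$ is a convex function on $\{(\varrho,\mathbf m,S):(\varrho,S)\in\mathcal E\}$. -/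

import Mathlib

open MeasureTheory Filter Topology
open scoped ContDiff RealInnerProductSpace ENNReal NNReal

namespace NSF

noncomputable section

/-- The physical space `ℝᵈ` with its Euclidean norm. -/
abbrev Sp (d : ℕ) : Type := EuclideanSpace ℝ (Fin d)

/-! ### Smooth bounded domains, outward normal, surface measure -/

/-- `Φ` is a smooth function that describes `Ω` near `x` as the sublevel set `{Φ < 0}`. -/
structure IsDefiningFunction {d : ℕ} (Ω : Set (Sp d)) (x : Sp d) (Φ : Sp d → ℝ) : Prop where
  smooth : ContDiff ℝ ∞ Φ
  zero : Φ x = 0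
  gradient_ne_zero : gradient Φ x ≠ 0
  mem_iff : ∀ᶠ y in 𝓝 x, (y ∈ Ω ↔ Φ y < 0)

/-- Bounded domains (open connected sets) with smooth boundary. -/
structure IsSmoothBoundedDomain {d : ℕ} (Ω : Set (Sp d)) : Prop where
  isOpen : IsOpen Ω
  isConnected : IsConnected Ω
  isBounded : Bornology.IsBounded Ω
  smooth : ∀ x ∈ frontier Ω, ∃ Φ : Sp d → ℝ, IsDefiningFunction Ω x Φ

open Classical in
/-- The outward unit normal `∇Φ / |∇Φ|` at a boundary point, `Φ` a local defining function
(the value does not depend on the choice of `Φ`). -/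
def outwardNormal {d : ℕ} (Ω : Set (Sp d)) (x : Sp d) : Sp d :=
  if h : ∃ Φ : Sp d → ℝ, IsDefiningFunction Ω x Φ then
    ‖gradient h.choose x‖⁻¹ • gradient h.choose x
  else 0

/-- The surface measure `dσ` of `∂Ω`: the `(d-1)`-dimensional Hausdorff measure, normalized so
as to agree with the Lebesgue measure on hyperplanes. -/
def surfaceMeasure {d : ℕ} (Ω : Set (Sp d)) : Measure (Sp d) :=
  (Measure.euclideanHausdorffMeasure (d - 1)).restrict (frontier Ω)

/-! ### Space-time integrals -/

/-- `∫_0^τ ∫_Ω f dx dt`. -/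
def volInt {d : ℕ} (Ω : Set (Sp d)) (τ : ℝ) (f : ℝ → Sp d → ℝ) : ℝ :=
  ∫ z in Set.Ioc 0 τ ×ˢ Ω, f z.1 z.2

/-- `f ∈ L¹((0,T) × Ω)`. -/
def VolIntegrable {d : ℕ} {F : Type} [NormedAddCommGroup F] (Ω : Set (Sp d)) (T : ℝ)
    (f : ℝ → Sp d → F) : Prop :=
  IntegrableOn (fun z : ℝ × Sp d => f z.1 z.2) (Set.Ioc 0 T ×ˢ Ω)

/-- `∫_0^τ ∫_Γ f dσ dt` for a part `Γ` of `∂Ω`. -/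
def surfInt {d : ℕ} (Ω Γ : Set (Sp d)) (τ : ℝ) (f : ℝ → Sp d → ℝ) : ℝ :=
  ∫ z in Set.Ioc 0 τ ×ˢ Γ, f z.1 z.2 ∂((volume : Measure ℝ).prod (surfaceMeasure Ω))

/-- `f ∈ L¹((0,T) × Γ; dt × dσ)` for a part `Γ` of `∂Ω`. -/
def SurfIntegrable {d : ℕ} (Ω Γ : Set (Sp d)) (T : ℝ) (f : ℝ → Sp d → ℝ) : Prop :=
  IntegrableOn (fun z : ℝ × Sp d => f z.1 z.2) (Set.Ioc 0 T ×ˢ Γ)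
    ((volume : Measure ℝ).prod (surfaceMeasure Ω))

/-! ### Function spaces -/

/-- `f ∈ C¹([0,T] × Ω̄)`. -/
def C1Closed {d : ℕ} {F : Type} [NormedAddCommGroup F] [NormedSpace ℝ F]
    (Ω : Set (Sp d)) (T : ℝ) (f : ℝ → Sp d → F) : Prop :=
  ContDiffOn ℝ 1 (fun z : ℝ × Sp d => f z.1 z.2) (Set.Icc 0 T ×ˢ closure Ω)

/-- `∂ₜ f (t, x)`. -/
def dt {d : ℕ} {F : Type} [NormedAddCommGroup F] [NormedSpace ℝ F]
    (f : ℝ → Sp d → F) (t : ℝ) (x : Sp d) : F :=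
  deriv (fun r => f r x) t

/-- `f ∈ L^∞(0,T; L^p(Ω))`. -/
def MemLinftyLp {d : ℕ} {F : Type} [NormedAddCommGroup F] (Ω : Set (Sp d)) (T : ℝ) (p : ℝ≥0∞)
    (f : ℝ → Sp d → F) : Prop :=
  AEStronglyMeasurable (fun z : ℝ × Sp d => f z.1 z.2) (volume.restrict (Set.Ioc 0 T ×ˢ Ω)) ∧
    ∃ C : ℝ≥0, ∀ᵐ t ∂(volume.restrict (Set.Ioc 0 T)),
      eLpNorm (f t) p (volume.restrict Ω) ≤ C

/-- `Df` is the weak derivative of `f` on the open set `Ω`. -/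
def IsWeakDeriv {d : ℕ} {F : Type} [NormedAddCommGroup F] [NormedSpace ℝ F]
    (Ω : Set (Sp d)) (f : Sp d → F) (Df : Sp d → Sp d →L[ℝ] F) : Prop :=
  ∀ φ : Sp d → ℝ, ContDiff ℝ ∞ φ → HasCompactSupport φ → tsupport φ ⊆ Ω → ∀ v : Sp d,
    ∫ x in Ω, (fderiv ℝ φ x v) • f x = - ∫ x in Ω, φ x • Df x v

/-- `f ∈ L^q(0,T; W^{1,q}(Ω))`, with weak spatial derivative `Df`. -/
def MemLqW1q {d : ℕ} {F : Type} [NormedAddCommGroup F] [NormedSpace ℝ F]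
    (Ω : Set (Sp d)) (T : ℝ) (q : ℝ≥0∞) (f : ℝ → Sp d → F) (Df : ℝ → Sp d → Sp d →L[ℝ] F) :
    Prop :=
  MemLp (fun z : ℝ × Sp d => f z.1 z.2) q (volume.restrict (Set.Ioc 0 T ×ˢ Ω)) ∧
  MemLp (fun z : ℝ × Sp d => Df z.1 z.2) q (volume.restrict (Set.Ioc 0 T ×ˢ Ω)) ∧
  ∀ᵐ t ∂(volume.restrict (Set.Ioc 0 T)), IsWeakDeriv Ω (f t) (Df t)

/-- `f ∈ W^{1,q}_0(Ω)`, with weak derivative `Df`: the pair is a limit in `W^{1,q}` of smooth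
functions compactly supported in `Ω`. -/
def MemW1qZero {d : ℕ} {F : Type} [NormedAddCommGroup F] [NormedSpace ℝ F]
    (Ω : Set (Sp d)) (q : ℝ≥0∞) (f : Sp d → F) (Df : Sp d → Sp d →L[ℝ] F) : Prop :=
  ∃ φ : ℕ → Sp d → F,
    (∀ k, ContDiff ℝ ∞ (φ k) ∧ HasCompactSupport (φ k) ∧ tsupport (φ k) ⊆ Ω) ∧
    Tendsto (fun k => eLpNorm (fun x => φ k x - f x) q (volume.restrict Ω)) atTop (𝓝 0) ∧
    Tendsto (fun k => eLpNorm (fun x => fderiv ℝ (φ k) x - Df x) q (volume.restrict Ω))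
      atTop (𝓝 0)

/-- `g` is the trace on `∂Ω` of the function `f ∈ W^{1,2}(Ω)` with weak gradient `G`: the limit
in `L²(∂Ω)` of the boundary values of smooth functions converging to `f` in `W^{1,2}(Ω)`. -/
def IsTrace {d : ℕ} (Ω : Set (Sp d)) (f : Sp d → ℝ) (G : Sp d → Sp d) (g : Sp d → ℝ) : Prop :=
  ∃ φ : ℕ → Sp d → ℝ,
    (∀ k, ContDiff ℝ ∞ (φ k)) ∧
    Tendsto (fun k => eLpNorm (fun x => φ k x - f x) 2 (volume.restrict Ω)) atTop (𝓝 0) ∧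
    Tendsto (fun k => eLpNorm (fun x => gradient (φ k) x - G x) 2 (volume.restrict Ω))
      atTop (𝓝 0) ∧
    Tendsto (fun k => eLpNorm (fun x => φ k x - g x) 2 (surfaceMeasure Ω)) atTop (𝓝 0)

/-! ### Matrix notation -/

/-- `div u = tr A` for `A = ∇u`. -/
def tr {d : ℕ} (A : Sp d →L[ℝ] Sp d) : ℝ :=
  ∑ i : Fin d, A (EuclideanSpace.single i 1) i

/-- `A : B = ∑ᵢⱼ Aᵢⱼ Bᵢⱼ`. -/
def contract {d : ℕ} (A B : Sp d →L[ℝ] Sp d) : ℝ :=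
  ∑ j : Fin d, ∑ i : Fin d,
    A (EuclideanSpace.single j 1) i * B (EuclideanSpace.single j 1) i

/-! ### Thermodynamics -/

/-- Pressure `p`, specific internal energy `e` and specific entropy `s` as functions of the
density `ρ` and the temperature `θ`, continuously differentiable on `(0,∞)²`, subject to Gibbs'
equation `θ Ds = De + p D(1/ρ)` and the hypothesis of thermodynamic stability. -/
structure ThermoLaw where
  p : ℝ → ℝ → ℝ
  e : ℝ → ℝ → ℝ
  s : ℝ → ℝ → ℝ
  p_contDiff : ContDiffOn ℝ 1 (fun z : ℝ × ℝ => p z.1 z.2) (Set.Ioi 0 ×ˢ Set.Ioi 0)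
  e_contDiff : ContDiffOn ℝ 1 (fun z : ℝ × ℝ => e z.1 z.2) (Set.Ioi 0 ×ˢ Set.Ioi 0)
  s_contDiff : ContDiffOn ℝ 1 (fun z : ℝ × ℝ => s z.1 z.2) (Set.Ioi 0 ×ˢ Set.Ioi 0)
  gibbs_theta : ∀ ρ θ : ℝ, 0 < ρ → 0 < θ →
    θ * deriv (fun y => s ρ y) θ = deriv (fun y => e ρ y) θ
  gibbs_rho : ∀ ρ θ : ℝ, 0 < ρ → 0 < θ →
    θ * deriv (fun r => s r θ) ρ = deriv (fun r => e r θ) ρ + p ρ θ * deriv (fun r => 1 / r) ρ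
  stable_p : ∀ ρ θ : ℝ, 0 < ρ → 0 < θ → 0 < deriv (fun r => p r θ) ρ
  stable_e : ∀ ρ θ : ℝ, 0 < ρ → 0 < θ → 0 < deriv (fun y => e ρ y) θ

/-- Value at the density `ρ ≥ 0` of a function of `(ρ, θ)` given for `ρ > 0`: on the vacuum
`ρ = 0` it is the limit for `ρ → 0+`. -/
def vacuumExt (f : ℝ → ℝ → ℝ) (ρ θ : ℝ) : ℝ :=
  if 0 < ρ then f ρ θ else limUnder (𝓝[>] (0 : ℝ)) (fun r => f r θ)

namespace ThermoLaw

variable (L : ThermoLaw)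

/-- The pressure, including the vacuum. -/
def pressure (ρ θ : ℝ) : ℝ := vacuumExt L.p ρ θ

/-- The internal energy density `ρ e(ρ, θ)`, including the vacuum. -/
def rhoE (ρ θ : ℝ) : ℝ := vacuumExt (fun r y => r * L.e r y) ρ θ

/-- The total entropy `S = ρ s(ρ, θ)`, including the vacuum. -/
def rhoS (ρ θ : ℝ) : ℝ := vacuumExt (fun r y => r * L.s r y) ρ θ

/-- The set `𝓔` of the states `(ρ, S)`, the image of `(0,∞)²` under `(ρ, θ) ↦ (ρ, ρ s(ρ, θ))`. -/
def states : Set (ℝ × ℝ) :=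
  {z | 0 < z.1 ∧ ∃ θ : ℝ, 0 < θ ∧ z.1 * L.s z.1 θ = z.2}

/-- The temperature in terms of the conservative-entropy variables `(ρ, S) ∈ 𝓔`. -/
def temperature (ρ S : ℝ) : ℝ :=
  Function.invFunOn (fun θ => ρ * L.s ρ θ) (Set.Ioi 0) S

/-- The internal energy `ρ e(ρ, S)` in terms of the conservative-entropy variables
`(ρ, S) ∈ 𝓔`. -/
def intEnergy (ρ S : ℝ) : ℝ := ρ * L.e ρ (L.temperature ρ S)

/-- `∂(ρe)|_ρ / ∂S`. -/
def dIntEnergyS (ρ S : ℝ) : ℝ := deriv (fun y => L.intEnergy ρ y) S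

/-- `∂(ρe)|_S / ∂ρ`. -/
def dIntEnergyRho (ρ S : ℝ) : ℝ := deriv (fun r => L.intEnergy r S) ρ

open Classical in
/-- The extension of the internal energy `E_int(ρ, S)` to `ℝ²`: the lower semicontinuous
extension to the boundary of `𝓔`, and `∞` outside the closure of `𝓔`. -/
def extIntEnergy (ρ S : ℝ) : EReal :=
  if (ρ, S) ∈ L.states then ((L.intEnergy ρ S : ℝ) : EReal)
  else if (ρ, S) ∈ closure L.states then
    liminf (fun w : ℝ × ℝ => ((L.intEnergy w.1 w.2 : ℝ) : EReal)) (𝓝[L.states] (ρ, S))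
  else ⊤

/-- The total energy `E(ρ, m, S) = |m|²/(2ρ) + ρ e(ρ, S)`. -/
def totalEnergy {d : ℕ} (z : ℝ × Sp d × ℝ) : ℝ :=
  1 / 2 * (‖z.2.1‖ ^ 2 / z.1) + L.intEnergy z.1 z.2.2

/-- The Bregman distance of the total energy. -/
def bregman {d : ℕ} (z z' : ℝ × Sp d × ℝ) : ℝ :=
  L.totalEnergy z - fderiv ℝ L.totalEnergy z' (z - z') - L.totalEnergy z'

/-- The Helmholtz function `H_Θ(ρ, θ) = ρ (e(ρ, θ) - Θ s(ρ, θ))`. -/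
def helmholtz (Θ ρ θ : ℝ) : ℝ := ρ * (L.e ρ θ - Θ * L.s ρ θ)

/-- The relative energy of `(ρ, u, θ)` (with `ρ ≥ 0`) with respect to `(r, U, Θ)`, where
`r, Θ > 0`. -/
def relEnergy {d : ℕ} (ρ : ℝ) (u : Sp d) (θ : ℝ) (r : ℝ) (U : Sp d) (Θ : ℝ) : ℝ :=
  1 / 2 * ρ * ‖u - U‖ ^ 2 + L.rhoE ρ θ
    - L.dIntEnergyS r (r * L.s r Θ) * (L.rhoS ρ θ - r * L.s r Θ)
    - L.dIntEnergyRho r (r * L.s r Θ) * (ρ - r)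
    - L.intEnergy r (r * L.s r Θ)

end ThermoLaw

/-! ### The initial-boundary value problem -/

/-- The data of the problem: domain, time, constitutive laws, boundary data, volume force. -/
structure FluidProblem (d : ℕ) where
  /-- the fluid domain -/
  Ω : Set (Sp d)
  /-- the final time -/
  T : ℝ
  /-- the equations of state -/
  law : ThermoLaw
  /-- the shear viscosity, a function of `(ρ, θ)` -/
  μ : ℝ → ℝ → ℝ
  /-- the bulk viscosity -/
  η : ℝ → ℝ → ℝ
  /-- the heat conductivity -/
  κ : ℝ → ℝ → ℝ
  /-- the boundary velocity, extended to the closure of the domain -/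
  uB : Sp d → Sp d
  /-- the density on the inflow boundary -/
  rhoB : Sp d → ℝ
  /-- the energy flux on the inflow boundary -/
  Fib : Sp d → ℝ
  /-- the volume force -/
  g : Sp d → Sp d
  domain : IsSmoothBoundedDomain Ω
  T_pos : 0 < T
  μ_pos : ∀ ρ θ : ℝ, 0 ≤ ρ → 0 < θ → 0 < μ ρ θ
  η_nonneg : ∀ ρ θ : ℝ, 0 ≤ ρ → 0 < θ → 0 ≤ η ρ θ
  uB_contDiff : ContDiffOn ℝ 2 uB (closure Ω)
  rhoB_contDiff : ContDiffOn ℝ 1 rhoB (closure Ω)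
  Fib_continuous : ContinuousOn Fib (closure Ω)
  g_continuous : ContinuousOn g (closure Ω)

namespace FluidProblem

variable {d : ℕ} (P : FluidProblem d)

/-- `u_b · n`. -/
def uBn (x : Sp d) : ℝ := ⟪P.uB x, outwardNormal P.Ω x⟫

/-- The inflow boundary. -/
def Γin : Set (Sp d) := {x | x ∈ frontier P.Ω ∧ P.uBn x < 0}

/-- The outflow boundary. -/
def Γout : Set (Sp d) := {x | x ∈ frontier P.Ω ∧ 0 < P.uBn x}

/-- Newton's law: the viscous stress for the density `ρ`, the temperature `θ` and the velocity
gradient `A`. -/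
def stress (ρ θ : ℝ) (A : Sp d →L[ℝ] Sp d) : Sp d →L[ℝ] Sp d :=
  P.μ ρ θ • (A + ContinuousLinearMap.adjoint A
      - (2 / (d : ℝ) * tr A) • ContinuousLinearMap.id ℝ (Sp d))
    + (P.η ρ θ * tr A) • ContinuousLinearMap.id ℝ (Sp d)

/-- Fourier's law: the heat flux for the temperature gradient `G`. -/
def heatFlux (ρ θ : ℝ) (G : Sp d) : Sp d := -(P.κ ρ θ) • G

end FluidProblem

/-- The fields of a candidate solution. They are given by representatives with a value at every
time `t ∈ [0,T]`, the value at `t = 0` being the initial state. -/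
structure Fields (d : ℕ) where
  /-- the density in the domain -/
  ρ : ℝ → Sp d → ℝ
  /-- the velocity -/
  u : ℝ → Sp d → Sp d
  /-- the temperature -/
  θ : ℝ → Sp d → ℝ
  /-- the weak velocity gradient -/
  Du : ℝ → Sp d → Sp d →L[ℝ] Sp d
  /-- the weak temperature gradient -/
  Dθ : ℝ → Sp d → Sp d
  /-- the trace of the temperature on the boundary -/
  θB : ℝ → Sp d → ℝ
  /-- the density on the outflow boundary -/
  ρOut : ℝ → Sp d → ℝ
  /-- the total entropy on the outflow boundary -/
  SOut : ℝ → Sp d → ℝ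

namespace Fields

variable {d : ℕ} (P : FluidProblem d) (w : Fields d)

/-- The pressure `p(ρ, θ)`. -/
def pr (t : ℝ) (x : Sp d) : ℝ := P.law.pressure (w.ρ t x) (w.θ t x)

/-- The total entropy `S = ρ s(ρ, θ)`. -/
def S (t : ℝ) (x : Sp d) : ℝ := P.law.rhoS (w.ρ t x) (w.θ t x)

/-- The viscous stress. -/
def stress (t : ℝ) (x : Sp d) : Sp d →L[ℝ] Sp d := P.stress (w.ρ t x) (w.θ t x) (w.Du t x)

/-- The heat flux. -/
def q (t : ℝ) (x : Sp d) : Sp d := P.heatFlux (w.ρ t x) (w.θ t x) (w.Dθ t x)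

/-- The energy density `ρ |u - u_b|² / 2 + ρ e`. -/
def energy (t : ℝ) (x : Sp d) : ℝ :=
  1 / 2 * w.ρ t x * ‖w.u t x - P.uB x‖ ^ 2 + P.law.rhoE (w.ρ t x) (w.θ t x)

/-- The value of `E_int(ρ, S)` on the outflow boundary, where it is finite. -/
def EOut (t : ℝ) (x : Sp d) : ℝ := (P.law.extIntEnergy (w.ρOut t x) (w.SOut t x)).toReal

/-- The entropy production rate `(𝕊 : ∇u - q · ∇θ / θ) / θ`. -/
def production (t : ℝ) (x : Sp d) : ℝ :=
  1 / w.θ t x * (contract (w.stress P t x) (w.Du t x) - ⟪w.q P t x, w.Dθ t x⟫ / w.θ t x)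

/-- The entropy flux prescribed on the inflow boundary. -/
def inflowEntropy (t : ℝ) (x : Sp d) : ℝ :=
  P.Fib x / w.θB t x
    + (P.law.s (P.rhoB x) (w.θB t x) - P.law.e (P.rhoB x) (w.θB t x) / w.θB t x)
      * P.rhoB x * P.uBn x

end Fields

/-- Weak solutions of the Navier--Stokes--Fourier system in `(0,T) × Ω`. -/
structure IsWeakSolution {d : ℕ} (P : FluidProblem d) (w : Fields d) : Prop where
  /-- regularity class of the density and the momentum -/
  class_rho : ∃ γ : ℝ, 1 < γ ∧ MemLinftyLp P.Ω P.T (ENNReal.ofReal γ) w.ρ ∧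
    MemLinftyLp P.Ω P.T (ENNReal.ofReal (2 * γ / (γ + 1))) (fun t x => w.ρ t x • w.u t x)
  rho_nonneg : ∀ᵐ z ∂((volume : Measure (ℝ × Sp d)).restrict (Set.Ioc 0 P.T ×ˢ P.Ω)),
    0 ≤ w.ρ z.1 z.2
  rho_nonneg_zero : ∀ᵐ x ∂(volume.restrict P.Ω), 0 ≤ w.ρ 0 x
  /-- regularity class and boundary values of the velocity -/
  class_u : ∃ q : ℝ, 1 < q ∧ MemLqW1q P.Ω P.T (ENNReal.ofReal q) w.u w.Du ∧
    ∀ᵐ t ∂(volume.restrict (Set.Ioc 0 P.T)),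
      MemW1qZero P.Ω (ENNReal.ofReal q) (fun x => w.u t x - P.uB x)
        (fun x => w.Du t x - fderiv ℝ P.uB x)
  /-- regularity class of the temperature -/
  class_theta : MemLqW1q P.Ω P.T 2 w.θ (fun t x => innerSL ℝ (w.Dθ t x))
  class_log_theta : ∃ G : ℝ → Sp d → Sp d →L[ℝ] ℝ,
    MemLqW1q P.Ω P.T 2 (fun t x => Real.log (w.θ t x)) G
  theta_pos : ∀ᵐ z ∂((volume : Measure (ℝ × Sp d)).restrict (Set.Ioc 0 P.T ×ˢ P.Ω)),
    0 < w.θ z.1 z.2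
  theta_pos_zero : ∀ᵐ x ∂(volume.restrict P.Ω), 0 < w.θ 0 x
  /-- the boundary values of the temperature -/
  trace_theta : ∀ᵐ t ∂(volume.restrict (Set.Ioc 0 P.T)),
    IsTrace P.Ω (w.θ t) (w.Dθ t) (w.θB t)
  theta_bdry_pos : ∀ᵐ z ∂(((volume : Measure ℝ).prod (surfaceMeasure P.Ω)).restrict
    (Set.Ioc 0 P.T ×ˢ P.Γin)), 0 < w.θB z.1 z.2
  theta_bdry_inv : SurfIntegrable P.Ω P.Γin P.T (fun t x => 1 / w.θB t x)
  /-- regularity class of the entropy, and the outflow boundary -/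
  class_S : MemLinftyLp P.Ω P.T 1 (w.S P)
  rho_out : SurfIntegrable P.Ω P.Γout P.T (fun t x => w.ρOut t x * P.uBn x)
  S_out : SurfIntegrable P.Ω P.Γout P.T (fun t x => w.SOut t x * P.uBn x)
  E_out_finite : ∀ᵐ z ∂(((volume : Measure ℝ).prod (surfaceMeasure P.Ω)).restrict
    (Set.Ioc 0 P.T ×ˢ P.Γout)),
      P.law.extIntEnergy (w.ρOut z.1 z.2) (w.SOut z.1 z.2) ≠ ⊤ ∧
      P.law.extIntEnergy (w.ρOut z.1 z.2) (w.SOut z.1 z.2) ≠ ⊥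
  E_out : SurfIntegrable P.Ω P.Γout P.T (fun t x => w.EOut P t x * P.uBn x)
  /-- the integrals in the weak formulation converge -/
  rho_integrable : ∀ τ ∈ Set.Icc 0 P.T, IntegrableOn (w.ρ τ) P.Ω
  momentum_integrable : ∀ τ ∈ Set.Icc 0 P.T, IntegrableOn (fun x => w.ρ τ x • w.u τ x) P.Ω
  kinetic_integrable : VolIntegrable P.Ω P.T (fun t x => w.ρ t x * ‖w.u t x‖ ^ 2)
  pressure_integrable : VolIntegrable P.Ω P.T (w.pr P)
  stress_integrable : VolIntegrable P.Ω P.T (w.stress P)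
  energy_integrable_zero : IntegrableOn (w.energy P 0) P.Ω
  energy_integrable : VolIntegrable P.Ω P.T (w.energy P)
  S_integrable_zero : IntegrableOn (w.S P 0) P.Ω
  S_flux_integrable : VolIntegrable P.Ω P.T (fun t x => w.S P t x • w.u t x)
  heat_flux_integrable : VolIntegrable P.Ω P.T (fun t x => (w.θ t x)⁻¹ • w.q P t x)
  production_integrable : VolIntegrable P.Ω P.T (w.production P)
  inflow_integrable : SurfIntegrable P.Ω P.Γin P.T (w.inflowEntropy P)
  /-- equation of continuity -/
  continuity : ∀ φ : ℝ → Sp d → ℝ, C1Closed P.Ω P.T φ → ∀ τ ∈ Set.Icc 0 P.T,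
    ((∫ x in P.Ω, w.ρ τ x * φ τ x) - ∫ x in P.Ω, w.ρ 0 x * φ 0 x)
      + surfInt P.Ω P.Γin τ (fun t x => φ t x * P.rhoB x * P.uBn x)
      + surfInt P.Ω P.Γout τ (fun t x => φ t x * w.ρOut t x * P.uBn x)
    = volInt P.Ω τ (fun t x => w.ρ t x * dt φ t x
        + w.ρ t x * fderiv ℝ (φ t) x (w.u t x))
  /-- momentum equation -/
  momentum : ∀ φ : ℝ → Sp d → Sp d, C1Closed P.Ω P.T φ →
    (∃ K : Set (Sp d), IsCompact K ∧ K ⊆ P.Ω ∧ ∀ t ∈ Set.Icc 0 P.T, ∀ x ∉ K, φ t x = 0) →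
    ∀ τ ∈ Set.Icc 0 P.T,
    (∫ x in P.Ω, ⟪w.ρ τ x • w.u τ x, φ τ x⟫) - (∫ x in P.Ω, ⟪w.ρ 0 x • w.u 0 x, φ 0 x⟫)
    = volInt P.Ω τ (fun t x => w.ρ t x * ⟪w.u t x, dt φ t x⟫
        + w.ρ t x * ⟪w.u t x, fderiv ℝ (φ t) x (w.u t x)⟫
        + w.pr P t x * tr (fderiv ℝ (φ t) x))
      - volInt P.Ω τ (fun t x => contract (w.stress P t x) (fderiv ℝ (φ t) x))
      + volInt P.Ω τ (fun t x => w.ρ t x * ⟪P.g x, φ t x⟫)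
  /-- total energy balance -/
  energy_balance : ∀ ψ : ℝ → ℝ, ContDiffOn ℝ 1 ψ (Set.Icc 0 P.T) →
    (∀ t ∈ Set.Icc 0 P.T, 0 ≤ ψ t) → ∀ᵐ τ ∂(volume.restrict (Set.Icc 0 P.T)),
    ((∫ x in P.Ω, w.energy P τ x * ψ τ) - ∫ x in P.Ω, w.energy P 0 x * ψ 0)
      - volInt P.Ω τ (fun t x => deriv ψ t * w.energy P t x)
      + surfInt P.Ω P.Γout τ (fun t x => ψ t * w.EOut P t x * P.uBn x)
    ≤ volInt P.Ω τ (fun t x => ψ t * contract (w.stress P t x) (fderiv ℝ P.uB x))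
      + volInt P.Ω τ (fun t x => ψ t * (w.ρ t x * ⟪P.g x, w.u t x - P.uB x⟫))
      + 1 / 2 * volInt P.Ω τ (fun t x =>
          ψ t * (w.ρ t x * fderiv ℝ (fun y => ‖P.uB y‖ ^ 2) x (w.u t x)))
      - volInt P.Ω τ (fun t x => ψ t * (w.ρ t x * ⟪w.u t x, fderiv ℝ P.uB x (w.u t x)⟫
          + w.pr P t x * tr (fderiv ℝ P.uB x)))
      - surfInt P.Ω P.Γin τ (fun t x => ψ t * P.Fib x)
  /-- entropy inequality -/
  entropy_inequality : ∀ φ : ℝ → Sp d → ℝ, C1Closed P.Ω P.T φ →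
    (∀ t ∈ Set.Icc 0 P.T, ∀ x ∈ closure P.Ω, 0 ≤ φ t x) →
    ∀ᵐ τ ∂(volume.restrict (Set.Icc 0 P.T)),
    ((∫ x in P.Ω, w.S P τ x * φ τ x) - ∫ x in P.Ω, w.S P 0 x * φ 0 x)
      - volInt P.Ω τ (fun t x => w.S P t x * dt φ t x
          + w.S P t x * fderiv ℝ (φ t) x (w.u t x)
          + fderiv ℝ (φ t) x ((w.θ t x)⁻¹ • w.q P t x))
      + surfInt P.Ω P.Γout τ (fun t x => φ t x * w.SOut t x * P.uBn x)
    ≥ volInt P.Ω τ (fun t x => φ t x * w.production P t x)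
      - surfInt P.Ω P.Γin τ (fun t x => φ t x * w.inflowEntropy P t x)

/-! ### The relative energy inequality -/

/-- A trio `(r, U, Θ)` of comparison functions: continuously differentiable on `[0,T] × Ω̄`, with
`U = u_b` on the boundary, and `r`, `Θ` between positive constants. -/
structure IsTestTrio {d : ℕ} (P : FluidProblem d) (r : ℝ → Sp d → ℝ) (U : ℝ → Sp d → Sp d)
    (Θ : ℝ → Sp d → ℝ) : Prop where
  r_C1 : C1Closed P.Ω P.T r
  U_C1 : C1Closed P.Ω P.T U
  Θ_C1 : C1Closed P.Ω P.T Θ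
  U_boundary : ∀ t ∈ Set.Icc 0 P.T, ∀ x ∈ frontier P.Ω, U t x = P.uB x
  r_bounds : ∃ a b : ℝ, 0 < a ∧ ∀ t ∈ Set.Icc 0 P.T, ∀ x ∈ closure P.Ω, a ≤ r t x ∧ r t x ≤ b
  Θ_bounds : ∃ a b : ℝ, 0 < a ∧ ∀ t ∈ Set.Icc 0 P.T, ∀ x ∈ closure P.Ω, a ≤ Θ t x ∧ Θ t x ≤ b

section RelativeEnergy

variable {d : ℕ} (P : FluidProblem d) (w : Fields d) (r : ℝ → Sp d → ℝ) (U : ℝ → Sp d → Sp d)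
  (Θ : ℝ → Sp d → ℝ)

/-- `p̃ = p(r, Θ)`. -/
def pTilde (t : ℝ) (x : Sp d) : ℝ := P.law.p (r t x) (Θ t x)

/-- `ẽ = e(r, Θ)`. -/
def eTilde (t : ℝ) (x : Sp d) : ℝ := P.law.e (r t x) (Θ t x)

/-- `s̃ = s(r, Θ)`. -/
def sTilde (t : ℝ) (x : Sp d) : ℝ := P.law.s (r t x) (Θ t x)

/-- The relative energy of `(ρ, u, θ)` with respect to `(r, U, Θ)` at `(t, x)`. -/
def relE (t : ℝ) (x : Sp d) : ℝ :=
  P.law.relEnergy (w.ρ t x) (w.u t x) (w.θ t x) (r t x) (U t x) (Θ t x)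

/-- The integrand on the outflow boundary. -/
def outflowTerm (t : ℝ) (x : Sp d) : ℝ :=
  (w.EOut P t x
    - P.law.dIntEnergyS (r t x) (r t x * sTilde P r Θ t x) * w.SOut t x
    - P.law.dIntEnergyRho (r t x) (r t x * sTilde P r Θ t x) * w.ρOut t x) * P.uBn x

/-- `(Θ/θ) (𝕊 : ∇u - q · ∇θ / θ)`. -/
def dissipationTerm (t : ℝ) (x : Sp d) : ℝ :=
  Θ t x / w.θ t x *
    (contract (w.stress P t x) (w.Du t x) - ⟪w.q P t x, w.Dθ t x⟫ / w.θ t x)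

/-- `ρ (U - u) ⊗ (U - u) : ∇U`. -/
def convectiveTerm (t : ℝ) (x : Sp d) : ℝ :=
  w.ρ t x * ⟪U t x - w.u t x, fderiv ℝ (U t) x (U t x - w.u t x)⟫

/-- `ρ (U - u) · (∂ₜU + U · ∇U + ∇p̃ / r - g)`. -/
def forceTerm (t : ℝ) (x : Sp d) : ℝ :=
  w.ρ t x * ⟪U t x - w.u t x,
    dt U t x + fderiv ℝ (U t) x (U t x) + (1 / r t x) • gradient (pTilde P r Θ t) x - P.g x⟫

/-- `p div U`. -/
def pressureDivTerm (t : ℝ) (x : Sp d) : ℝ := w.pr P t x * tr (fderiv ℝ (U t) x)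

/-- `(ρ/r) (u - U) · ∇p̃`. -/
def pressureGradTerm (t : ℝ) (x : Sp d) : ℝ :=
  w.ρ t x / r t x * ⟪w.u t x - U t x, gradient (pTilde P r Θ t) x⟫

/-- `𝕊 : ∇U`. -/
def stressTerm (t : ℝ) (x : Sp d) : ℝ := contract (w.stress P t x) (fderiv ℝ (U t) x)

/-- `ρ (s - s̃) ∂ₜΘ + ρ (s - s̃) u · ∇Θ + (q/θ) · ∇Θ`. -/
def entropyTerm (t : ℝ) (x : Sp d) : ℝ :=
  (w.S P t x - w.ρ t x * sTilde P r Θ t x) * dt Θ t x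
    + (w.S P t x - w.ρ t x * sTilde P r Θ t x) * ⟪w.u t x, gradient (Θ t) x⟫
    + ⟪(w.θ t x)⁻¹ • w.q P t x, gradient (Θ t) x⟫

/-- The integrand on the inflow boundary that contains the energy flux `F_{i,b}`. -/
def inflowTerm (t : ℝ) (x : Sp d) : ℝ :=
  P.Fib x * (Θ t x / w.θB t x - 1)
    + Θ t x * (P.law.s (P.rhoB x) (w.θB t x) - sTilde P r Θ t x + eTilde P r Θ t x / Θ t x
        - P.law.e (P.rhoB x) (w.θB t x) / w.θB t x) * P.rhoB x * P.uBn x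

/-- `(ρ_b / r) p̃ u_b · n`. -/
def inflowPressureTerm (t : ℝ) (x : Sp d) : ℝ :=
  P.rhoB x / r t x * pTilde P r Θ t x * P.uBn x

/-- `(1 - ρ/r) ∂ₜp̃ - (ρ/r) u · ∇p̃`. -/
def pressureTerm (t : ℝ) (x : Sp d) : ℝ :=
  (1 - w.ρ t x / r t x) * dt (pTilde P r Θ) t x
    - w.ρ t x / r t x * ⟪w.u t x, gradient (pTilde P r Θ t) x⟫

/-- The relative energy inequality at the time `τ`. -/
def RelativeEnergyInequality (τ : ℝ) : Prop :=
  ((∫ x in P.Ω, relE P w r U Θ τ x) - ∫ x in P.Ω, relE P w r U Θ 0 x)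
    + surfInt P.Ω P.Γout τ (outflowTerm P w r Θ)
    + volInt P.Ω τ (dissipationTerm P w Θ)
  ≤ - volInt P.Ω τ (convectiveTerm w U)
    + volInt P.Ω τ (forceTerm P w r U Θ)
    - volInt P.Ω τ (pressureDivTerm P w U)
    + volInt P.Ω τ (pressureGradTerm P w r U Θ)
    + volInt P.Ω τ (stressTerm P w U)
    - volInt P.Ω τ (entropyTerm P w r Θ)
    + surfInt P.Ω P.Γin τ (inflowTerm P w r Θ)
    + surfInt P.Ω P.Γin τ (inflowPressureTerm P r Θ)
    + volInt P.Ω τ (pressureTerm P w r Θ)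

/-- All the integrals in the relative energy inequality converge (for a.a. times `τ`). -/
structure RelativeEnergyTermsIntegrable : Prop where
  relE_zero : IntegrableOn (relE P w r U Θ 0) P.Ω
  relE_ae : ∀ᵐ τ ∂(volume.restrict (Set.Icc 0 P.T)), IntegrableOn (relE P w r U Θ τ) P.Ω
  outflow : SurfIntegrable P.Ω P.Γout P.T (outflowTerm P w r Θ)
  dissipation : VolIntegrable P.Ω P.T (dissipationTerm P w Θ)
  convective : VolIntegrable P.Ω P.T (convectiveTerm w U)
  force : VolIntegrable P.Ω P.T (forceTerm P w r U Θ)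
  pressureDiv : VolIntegrable P.Ω P.T (pressureDivTerm P w U)
  pressureGrad : VolIntegrable P.Ω P.T (pressureGradTerm P w r U Θ)
  stress : VolIntegrable P.Ω P.T (stressTerm P w U)
  entropy : VolIntegrable P.Ω P.T (entropyTerm P w r Θ)
  inflow : SurfIntegrable P.Ω P.Γin P.T (inflowTerm P w r Θ)
  inflowPressure : SurfIntegrable P.Ω P.Γin P.T (inflowPressureTerm P r Θ)
  pressure : VolIntegrable P.Ω P.T (pressureTerm P w r Θ)

end RelativeEnergy

end

end NSF

namespace NSF

/-! ### Thermodynamics -/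

/-! The relative energy inequality is a signed sum of the balance laws, each tested with a suitable
function. In the variables (ρ, S), Gibbs' equation makes (μ, θ), with the chemical potential μ = e -
θs + p/ρ, the differential of ρe (`ThermoLaw.hasFDerivAt_intEnergy`). Hence the relative energy
collapses to ½ρ|u - U|² + ρe - ΘS - μ̃ρ + p̃ (`ThermoLaw.relEnergy_eq`), where a tilde means
evaluation at (r, Θ). Expanding the square around u_b turns it into the energy density of the weak
formulation plus ρu·(u_b - U), plus ρ(½(|U|² - |u_b|²) - μ̃), minus SΘ, plus p̃
(`IsTestTrio.relE_eq`). Each summand is governed by one law: the energy balance with ψ = 1, the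
momentum equation tested with u_b - U, the continuity equation tested with `continuityTest`, the
entropy inequality tested with Θ, and the fundamental theorem of calculus for p̃. The entropy enters
with a minus sign, so its lower bound has the right direction and produces the dissipation. The
identity Dμ̃ = Dp̃/r - s̃ DΘ (`IsTestTrio.fderiv_chem`) makes the volume integrands agree pointwise
(`volume_terms_eq`). On the boundary U = u_b, so the continuity test function reduces to -μ̃ there.

Two points need analysis. The field u_b - U vanishes on ∂Ω but need not have compact support in Ω.
Its values are truncated below a level tending to zero; the truncations have uniformly bounded
derivatives, which converge almost everywhere because the differential of a C¹ function vanishes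
a.e. on its zero set (`ae_fderiv_eq_zero_of_eq_zero`). Moreover, bounded inflow data must be
integrable, so the boundary must have finite surface measure (`isFiniteMeasure_surfaceMeasure`). The
other integrals pair an integrable field with a bounded coefficient.

The Bregman and Helmholtz forms follow from the explicit differential. For convexity, H_Θ(ρ, ·) is
minimal at Θ and ρ ↦ H_Θ(ρ, Θ) is convex, so the relative energy is nonnegative
(`ThermoLaw.relEnergy_nonneg`). The total energy therefore lies above all its tangent planes, which
gives convexity on a convex set of states. -/

/-- A `C¹` function on the open quadrant is strictly differentiable, with the differential given
by the partial derivatives. -/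
theorem hasStrictFDerivAt_of_contDiffOn_quadrant {f : ℝ → ℝ → ℝ}
    (hf : ContDiffOn ℝ 1 (fun z : ℝ × ℝ => f z.1 z.2) (Set.Ioi 0 ×ˢ Set.Ioi 0)) {ρ θ : ℝ}
    (hρ : 0 < ρ) (hθ : 0 < θ) :
    HasStrictFDerivAt (fun z : ℝ × ℝ => f z.1 z.2)
      (deriv (fun r => f r θ) ρ • ContinuousLinearMap.fst ℝ ℝ ℝ
        + deriv (fun y => f ρ y) θ • ContinuousLinearMap.snd ℝ ℝ ℝ) (ρ, θ) := by
  have hmem : (Set.Ioi (0 : ℝ) ×ˢ Set.Ioi (0 : ℝ)) ∈ 𝓝 (ρ, θ) :=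
    prod_mem_nhds (Ioi_mem_nhds hρ) (Ioi_mem_nhds hθ)
  have h := (hf.contDiffAt hmem).hasStrictFDerivAt one_ne_zero
  have h1 : HasDerivAt (fun r => f r θ)
      (fderiv ℝ (fun z : ℝ × ℝ => f z.1 z.2) (ρ, θ) (1, 0)) ρ :=
    HasFDerivAt.comp_hasDerivAt (l := fun z : ℝ × ℝ => f z.1 z.2) (f := fun r => (r, θ)) ρ
      h.hasFDerivAt ((hasDerivAt_id ρ).prodMk (hasDerivAt_const ρ θ))
  have h2 : HasDerivAt (fun y => f ρ y)
      (fderiv ℝ (fun z : ℝ × ℝ => f z.1 z.2) (ρ, θ) (0, 1)) θ :=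
    HasFDerivAt.comp_hasDerivAt (l := fun z : ℝ × ℝ => f z.1 z.2) (f := fun y => (ρ, y)) θ
      h.hasFDerivAt ((hasDerivAt_const θ ρ).prodMk (hasDerivAt_id θ))
  rw [h1.deriv, h2.deriv]
  refine h.congr_fderiv ?_
  ext <;> simp

namespace ThermoLaw

variable (L : ThermoLaw)

/-- The chemical potential `e - θ s + p / ρ`. -/
noncomputable def chemPot (ρ θ : ℝ) : ℝ := L.e ρ θ - θ * L.s ρ θ + L.p ρ θ / ρ

variable {L} {ρ θ r Θ : ℝ}

theorem hasDerivAt_rho {f : ℝ → ℝ → ℝ}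
    (hf : ContDiffOn ℝ 1 (fun z : ℝ × ℝ => f z.1 z.2) (Set.Ioi 0 ×ˢ Set.Ioi 0))
    (hρ : 0 < ρ) (hθ : 0 < θ) :
    HasDerivAt (fun r => f r θ) (deriv (fun r => f r θ) ρ) ρ := by
  have h := HasFDerivAt.comp_hasDerivAt (l := fun z : ℝ × ℝ => f z.1 z.2) (f := fun r => (r, θ)) ρ
    (hasStrictFDerivAt_of_contDiffOn_quadrant hf hρ hθ).hasFDerivAt
    ((hasDerivAt_id ρ).prodMk (hasDerivAt_const ρ θ))
  exact h.congr_deriv (by simp)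

theorem hasDerivAt_theta {f : ℝ → ℝ → ℝ}
    (hf : ContDiffOn ℝ 1 (fun z : ℝ × ℝ => f z.1 z.2) (Set.Ioi 0 ×ˢ Set.Ioi 0))
    (hρ : 0 < ρ) (hθ : 0 < θ) :
    HasDerivAt (fun y => f ρ y) (deriv (fun y => f ρ y) θ) θ := by
  have h := HasFDerivAt.comp_hasDerivAt (l := fun z : ℝ × ℝ => f z.1 z.2) (f := fun y => (ρ, y)) θ
    (hasStrictFDerivAt_of_contDiffOn_quadrant hf hρ hθ).hasFDerivAt
    ((hasDerivAt_const θ ρ).prodMk (hasDerivAt_id θ))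
  exact h.congr_deriv (by simp)

variable (L)

/-- Gibbs' equation for the derivative in the density. -/
theorem gibbs_rho_eq (hρ : 0 < ρ) (hθ : 0 < θ) :
    θ * deriv (fun r => L.s r θ) ρ
      = deriv (fun r => L.e r θ) ρ - L.p ρ θ / ρ ^ 2 := by
  have h1 : deriv (fun r : ℝ => 1 / r) ρ = -(ρ ^ 2)⁻¹ := by simp [one_div]
  rw [L.gibbs_rho ρ θ hρ hθ, h1]
  ring

theorem deriv_s_theta_pos (hρ : 0 < ρ) (hθ : 0 < θ) : 0 < deriv (fun y => L.s ρ y) θ := by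
  have h := L.stable_e ρ θ hρ hθ
  rw [← L.gibbs_theta ρ θ hρ hθ] at h
  exact pos_of_mul_pos_right h hθ.le

/-- Gibbs' equation and stability give ∂s/∂θ = (∂e/∂θ)/θ > 0. Thus the entropy determines the
temperature at fixed density, and `temperature` is a genuine inverse. -/
theorem strictMonoOn_s (hρ : 0 < ρ) : StrictMonoOn (fun θ => ρ * L.s ρ θ) (Set.Ioi 0) := by
  refine strictMonoOn_of_deriv_pos (convex_Ioi 0) ?_ ?_
  · exact fun θ hθ => ((hasDerivAt_theta L.s_contDiff hρ hθ).const_mul ρ).continuousAt.continuousWithinAt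
  · intro θ hθ
    rw [interior_Ioi] at hθ
    rw [((hasDerivAt_theta L.s_contDiff hρ hθ).const_mul ρ).deriv]
    exact mul_pos hρ (L.deriv_s_theta_pos hρ hθ)

theorem temperature_eq (hρ : 0 < ρ) (hθ : 0 < θ) : L.temperature ρ (ρ * L.s ρ θ) = θ :=
  (L.strictMonoOn_s hρ).injOn.leftInvOn_invFunOn hθ

theorem intEnergy_eq (hρ : 0 < ρ) (hθ : 0 < θ) :
    L.intEnergy ρ (ρ * L.s ρ θ) = ρ * L.e ρ θ := by
  rw [intEnergy, L.temperature_eq hρ hθ]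

/-- The differential of the internal energy in the variables `(ρ, S)` is `(e - θ s + p / ρ, θ)`. -/
theorem hasFDerivAt_intEnergy (hρ : 0 < ρ) (hθ : 0 < θ) :
    HasFDerivAt (fun z : ℝ × ℝ => L.intEnergy z.1 z.2)
      (L.chemPot ρ θ • ContinuousLinearMap.fst ℝ ℝ ℝ + θ • ContinuousLinearMap.snd ℝ ℝ ℝ)
      (ρ, ρ * L.s ρ θ) := by
  set sr := deriv (fun r => L.s r θ) ρ with hsr
  set sθ := deriv (fun y => L.s ρ y) θ with hsθ
  have hsθ0 : sθ ≠ 0 := (L.deriv_s_theta_pos hρ hθ).ne'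
  have hs := hasStrictFDerivAt_of_contDiffOn_quadrant L.s_contDiff hρ hθ
  have he := hasStrictFDerivAt_of_contDiffOn_quadrant L.e_contDiff hρ hθ
  have hfst : HasStrictFDerivAt (fun z : ℝ × ℝ => z.1) (ContinuousLinearMap.fst ℝ ℝ ℝ) (ρ, θ) :=
    hasStrictFDerivAt_fst
  -- The Jacobian of (ρ, θ) ↦ (ρ, ρs) is triangular with diagonal entries 1 and ρ ∂s/∂θ > 0; `bwd`
  -- is its explicit inverse, as the inverse function theorem requires.
  let fwd : ℝ × ℝ →L[ℝ] ℝ × ℝ := (ContinuousLinearMap.fst ℝ ℝ ℝ).prod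
    ((L.s ρ θ + ρ * sr) • ContinuousLinearMap.fst ℝ ℝ ℝ
      + (ρ * sθ) • ContinuousLinearMap.snd ℝ ℝ ℝ)
  let bwd : ℝ × ℝ →L[ℝ] ℝ × ℝ := (ContinuousLinearMap.fst ℝ ℝ ℝ).prod
    ((ρ * sθ)⁻¹ • (ContinuousLinearMap.snd ℝ ℝ ℝ
      - (L.s ρ θ + ρ * sr) • ContinuousLinearMap.fst ℝ ℝ ℝ))
  have hne : ρ * sθ ≠ 0 := mul_ne_zero hρ.ne' hsθ0
  let A : (ℝ × ℝ) ≃L[ℝ] (ℝ × ℝ) := ContinuousLinearEquiv.equivOfInverse fwd bwd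
    (fun z => by
      ext
      · simp [fwd, bwd]
      · simp only [fwd, bwd, ContinuousLinearMap.prod_apply, add_apply,
          smul_apply, sub_apply,
          ContinuousLinearMap.coe_fst', ContinuousLinearMap.coe_snd', smul_eq_mul]
        field_simp
        ring)
    (fun z => by
      ext
      · simp [fwd, bwd]
      · simp only [fwd, bwd, ContinuousLinearMap.prod_apply, add_apply,
          smul_apply, sub_apply,
          ContinuousLinearMap.coe_fst', ContinuousLinearMap.coe_snd', smul_eq_mul]
        field_simp
        ring)
  have hG : HasStrictFDerivAt (fun z : ℝ × ℝ => (z.1, z.1 * L.s z.1 z.2))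
      (A : ℝ × ℝ →L[ℝ] ℝ × ℝ) (ρ, θ) := by
    refine (hfst.prodMk (hfst.mul hs)).congr_fderiv ?_
    ext <;> simp [A, fwd, hsr, hsθ] <;> ring
  have hg := hG.to_localInverse.hasFDerivAt
  have hga : hG.localInverse _ _ _ (ρ, ρ * L.s ρ θ) = (ρ, θ) := hG.localInverse_apply_image
  have hE : HasFDerivAt (fun z : ℝ × ℝ => z.1 * L.e z.1 z.2)
      (ρ • (deriv (fun r => L.e r θ) ρ • ContinuousLinearMap.fst ℝ ℝ ℝ
        + deriv (fun y => L.e ρ y) θ • ContinuousLinearMap.snd ℝ ℝ ℝ)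
        + L.e ρ θ • ContinuousLinearMap.fst ℝ ℝ ℝ)
      (hG.localInverse _ _ _ (ρ, ρ * L.s ρ θ)) := by
    rw [hga]
    exact (hfst.mul he).hasFDerivAt
  have hcomp := hE.comp (ρ, ρ * L.s ρ θ) hg
  -- Since s is injective in θ, the local inverse recovers `temperature` as long as its values stay
  -- in the open quadrant, which holds near the given state.
  have heq : (fun z : ℝ × ℝ => L.intEnergy z.1 z.2) =ᶠ[𝓝 (ρ, ρ * L.s ρ θ)]
      (fun z : ℝ × ℝ => z.1 * L.e z.1 z.2) ∘ hG.localInverse _ _ _ := by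
    have hcont := hG.localInverse_continuousAt
    have hpos : ∀ᶠ z in 𝓝 (ρ, ρ * L.s ρ θ),
        hG.localInverse _ _ _ z ∈ Set.Ioi (0 : ℝ) ×ˢ Set.Ioi (0 : ℝ) := by
      refine hcont.eventually_mem ?_
      rw [hga]
      exact prod_mem_nhds (Ioi_mem_nhds hρ) (Ioi_mem_nhds hθ)
    filter_upwards [hG.eventually_right_inverse, hpos] with z hz hz0
    have h1 := congrArg Prod.fst hz
    have h2 := congrArg Prod.snd hz
    simp only at h1 h2
    rw [← h1, ← h2]
    simp only [Function.comp_apply]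
    exact L.intEnergy_eq hz0.1 hz0.2
  refine (hcomp.congr_of_eventuallyEq heq).congr_fderiv ?_
  have g1 := L.gibbs_rho_eq hρ hθ
  have g2 := L.gibbs_theta ρ θ hρ hθ
  rw [← hsr] at g1
  rw [← hsθ] at g2
  have hr : ρ * deriv (fun r => L.e r θ) ρ = ρ * (θ * sr) + L.p ρ θ / ρ := by
    rw [g1]; field_simp; ring
  -- Gibbs' equation in both variables: the differential of ρe in (ρ, θ) factors through the
  -- Jacobian `A`, and the other factor is the differential in (ρ, S).
  have key : ∀ v : ℝ × ℝ, (ρ • (deriv (fun r => L.e r θ) ρ • ContinuousLinearMap.fst ℝ ℝ ℝ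
      + deriv (fun y => L.e ρ y) θ • ContinuousLinearMap.snd ℝ ℝ ℝ)
      + L.e ρ θ • ContinuousLinearMap.fst ℝ ℝ ℝ) v
      = (L.chemPot ρ θ • ContinuousLinearMap.fst ℝ ℝ ℝ + θ • ContinuousLinearMap.snd ℝ ℝ ℝ)
        (A v) := by
    intro v
    simp only [A, fwd, chemPot, ContinuousLinearEquiv.equivOfInverse_apply,
      ContinuousLinearMap.prod_apply, add_apply,
      smul_apply, ContinuousLinearMap.coe_fst', ContinuousLinearMap.coe_snd',
      smul_eq_mul, ← g2]
    linear_combination v.1 * hr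
  refine ContinuousLinearMap.ext fun v => ?_
  rw [ContinuousLinearMap.comp_apply]
  refine (key (A.symm v)).trans ?_
  rw [A.apply_symm_apply]

theorem dIntEnergyRho_eq (hρ : 0 < ρ) (hθ : 0 < θ) :
    L.dIntEnergyRho ρ (ρ * L.s ρ θ) = L.chemPot ρ θ := by
  have h := (L.hasFDerivAt_intEnergy hρ hθ).comp_hasDerivAt ρ
    ((hasDerivAt_id ρ).prodMk (hasDerivAt_const ρ (ρ * L.s ρ θ)))
  refine h.deriv.trans ?_
  simp

theorem dIntEnergyS_eq (hρ : 0 < ρ) (hθ : 0 < θ) :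
    L.dIntEnergyS ρ (ρ * L.s ρ θ) = θ := by
  have h := (L.hasFDerivAt_intEnergy hρ hθ).comp_hasDerivAt (ρ * L.s ρ θ)
    ((hasDerivAt_const (ρ * L.s ρ θ) ρ).prodMk (hasDerivAt_id (ρ * L.s ρ θ)))
  refine h.deriv.trans ?_
  simp

variable {d : ℕ}

/-- The terms free of the fluid state combine to μ̃r + Θr s̃ - r ẽ = p̃. Nothing is assumed about ρ,
so the vacuum is covered. -/
theorem relEnergy_eq (hr : 0 < r) (hΘ : 0 < Θ) (u U : Sp d) :
    L.relEnergy ρ u θ r U Θ = 1 / 2 * ρ * ‖u - U‖ ^ 2 + L.rhoE ρ θ - Θ * L.rhoS ρ θ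
      - L.chemPot r Θ * ρ + L.p r Θ := by
  rw [relEnergy, L.dIntEnergyS_eq hr hΘ, L.dIntEnergyRho_eq hr hΘ, L.intEnergy_eq hr hΘ, chemPot]
  field_simp
  ring

theorem rhoE_eq (hρ : 0 < ρ) : L.rhoE ρ θ = ρ * L.e ρ θ := by simp [rhoE, vacuumExt, hρ]

theorem rhoS_eq (hρ : 0 < ρ) : L.rhoS ρ θ = ρ * L.s ρ θ := by simp [rhoS, vacuumExt, hρ]

theorem hasDerivAt_helmholtz_rho (Θ : ℝ) (hρ : 0 < ρ) (hΘ : 0 < Θ) :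
    HasDerivAt (fun y => L.helmholtz Θ y Θ) (L.chemPot ρ Θ) ρ := by
  have h := (hasDerivAt_id ρ).mul ((hasDerivAt_rho L.e_contDiff hρ hΘ).sub
    ((hasDerivAt_rho L.s_contDiff hρ hΘ).const_mul Θ))
  refine h.congr_deriv ?_
  have g := L.gibbs_rho_eq hρ hΘ
  simp only [id, Pi.sub_apply, chemPot]
  rw [g]
  field_simp
  ring

/-- The relative energy in terms of the Helmholtz function. -/
theorem relEnergy_eq_helmholtz (hρ : 0 < ρ) (hr : 0 < r) (hΘ : 0 < Θ) (u U : Sp d) :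
    L.relEnergy ρ u θ r U Θ = 1 / 2 * ρ * ‖u - U‖ ^ 2 + L.helmholtz Θ ρ θ
      - deriv (fun y => L.helmholtz Θ y Θ) r * (ρ - r) - L.helmholtz Θ r Θ := by
  rw [L.relEnergy_eq hr hΘ, (L.hasDerivAt_helmholtz_rho Θ hr hΘ).deriv, L.rhoE_eq hρ,
    L.rhoS_eq hρ, chemPot, helmholtz, helmholtz]
  field_simp
  ring

/-- The kinetic part is differentiated as the product of |m|² and 1/ρ; at m = rU it contributes
-½|U|² in the density and U in the momentum. -/
theorem hasFDerivAt_totalEnergy (U : Sp d) (hr : 0 < r) (hΘ : 0 < Θ) :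
    ∃ D : ℝ × Sp d × ℝ →L[ℝ] ℝ,
      HasFDerivAt L.totalEnergy D (r, r • U, r * L.s r Θ) ∧
      ∀ v, D v = (L.chemPot r Θ - 1 / 2 * ‖U‖ ^ 2) * v.1 + ⟪U, v.2.1⟫ + Θ * v.2.2 := by
  have h1 : HasFDerivAt (fun z : ℝ × Sp d × ℝ => z.1) (ContinuousLinearMap.fst ℝ ℝ (Sp d × ℝ))
      (r, r • U, r * L.s r Θ) := hasFDerivAt_fst
  have hm : HasFDerivAt (fun z : ℝ × Sp d × ℝ => z.2.1)
      ((ContinuousLinearMap.fst ℝ (Sp d) ℝ).comp (ContinuousLinearMap.snd ℝ ℝ (Sp d × ℝ)))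
      (r, r • U, r * L.s r Θ) := hasFDerivAt_fst.comp _ hasFDerivAt_snd
  have hS : HasFDerivAt (fun z : ℝ × Sp d × ℝ => z.2.2)
      ((ContinuousLinearMap.snd ℝ (Sp d) ℝ).comp (ContinuousLinearMap.snd ℝ ℝ (Sp d × ℝ)))
      (r, r • U, r * L.s r Θ) := hasFDerivAt_snd.comp _ hasFDerivAt_snd
  have hkin := ((hm.norm_sq).mul ((hasDerivAt_inv hr.ne').comp_hasFDerivAt
    (r, r • U, r * L.s r Θ) h1)).const_mul (1 / 2)
  have hE : HasFDerivAt ((fun z : ℝ × ℝ => L.intEnergy z.1 z.2) ∘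
      fun z : ℝ × Sp d × ℝ => (z.1, z.2.2)) _ (r, r • U, r * L.s r Θ) :=
    HasFDerivAt.comp (g := fun z : ℝ × ℝ => L.intEnergy z.1 z.2) _
      (L.hasFDerivAt_intEnergy hr hΘ) (h1.prodMk hS)
  refine ⟨_, hkin.add hE, fun v => ?_⟩
  simp only [add_apply, smul_apply,
    ContinuousLinearMap.comp_apply, ContinuousLinearMap.prod_apply, smul_eq_mul,
    ContinuousLinearMap.coe_fst', ContinuousLinearMap.coe_snd', Function.comp_apply,
    innerSL_apply_apply, inner_smul_left, norm_smul, conj_trivial, Real.norm_eq_abs, mul_pow,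
    sq_abs, nsmul_eq_mul, Nat.cast_ofNat]
  field_simp
  ring

/-- The relative energy is the Bregman distance of the total energy. -/
theorem relEnergy_eq_bregman (hρ : 0 < ρ) (hθ : 0 < θ) (hr : 0 < r) (hΘ : 0 < Θ) (u U : Sp d) :
    L.relEnergy ρ u θ r U Θ
      = L.bregman (ρ, ρ • u, ρ * L.s ρ θ) (r, r • U, r * L.s r Θ) := by
  obtain ⟨D, hD, hDv⟩ := L.hasFDerivAt_totalEnergy U hr hΘ
  rw [bregman, hD.fderiv, hDv, L.relEnergy_eq hr hΘ, L.rhoE_eq hρ, L.rhoS_eq hρ]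
  simp only [totalEnergy, L.intEnergy_eq hr hΘ, L.intEnergy_eq hρ hθ, Prod.fst_sub, Prod.snd_sub,
    inner_sub_right, inner_smul_right, real_inner_self_eq_norm_sq, norm_smul, Real.norm_eq_abs,
    mul_pow, sq_abs, norm_sub_sq_real, real_inner_comm U u, chemPot]
  field_simp
  ring

/-- By Gibbs' equation ∂H_Θ/∂θ = ρ(θ - Θ) ∂s/∂θ, which has the sign of θ - Θ. -/
theorem helmholtz_theta_le (hρ : 0 < ρ) (hθ : 0 < θ) (hΘ : 0 < Θ) :
    L.helmholtz Θ ρ Θ ≤ L.helmholtz Θ ρ θ := by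
  have hd : ∀ y, 0 < y → HasDerivAt (fun y => L.helmholtz Θ ρ y)
      (ρ * ((y - Θ) * deriv (fun y => L.s ρ y) y)) y := by
    intro y hy
    have h := ((hasDerivAt_theta L.e_contDiff hρ hy).sub
      ((hasDerivAt_theta L.s_contDiff hρ hy).const_mul Θ)).const_mul ρ
    refine h.congr_deriv ?_
    rw [← L.gibbs_theta ρ y hρ hy]
    ring
  rcases le_total θ Θ with h | h
  · refine antitoneOn_of_deriv_nonpos (D := Set.Icc θ Θ) (convex_Icc _ _)
      (fun y hy => (hd y (hθ.trans_le hy.1)).continuousAt.continuousWithinAt)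
      (fun y hy => ?_) (fun y hy => ?_) ⟨le_rfl, h⟩ ⟨h, le_rfl⟩ h
    · rw [interior_Icc] at hy
      exact (hd y (hθ.trans hy.1)).differentiableAt.differentiableWithinAt
    · rw [interior_Icc] at hy
      have hy0 := hθ.trans hy.1
      rw [(hd y hy0).deriv]
      exact mul_nonpos_of_nonneg_of_nonpos hρ.le (mul_nonpos_of_nonpos_of_nonneg
        (sub_nonpos.2 hy.2.le) (L.deriv_s_theta_pos hρ hy0).le)
  · refine monotoneOn_of_deriv_nonneg (D := Set.Icc Θ θ) (convex_Icc _ _)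
      (fun y hy => (hd y (hΘ.trans_le hy.1)).continuousAt.continuousWithinAt)
      (fun y hy => ?_) (fun y hy => ?_) ⟨le_rfl, h⟩ ⟨h, le_rfl⟩ h
    · rw [interior_Icc] at hy
      exact (hd y (hΘ.trans hy.1)).differentiableAt.differentiableWithinAt
    · rw [interior_Icc] at hy
      have hy0 := hΘ.trans hy.1
      rw [(hd y hy0).deriv]
      exact mul_nonneg hρ.le (mul_nonneg (sub_nonneg.2 hy.1.le) (L.deriv_s_theta_pos hρ hy0).le)

/-- Gibbs' equation cancels the density derivatives of e and s against p/ρ². As μ is the density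
derivative of H_Θ at temperature Θ, this computes the second derivative, which is positive by
stability. -/
theorem hasDerivAt_chemPot_rho (hρ : 0 < ρ) (hΘ : 0 < Θ) :
    HasDerivAt (fun y => L.chemPot y Θ) (deriv (fun r => L.p r Θ) ρ / ρ) ρ := by
  have h := ((hasDerivAt_rho L.e_contDiff hρ hΘ).sub
    ((hasDerivAt_rho L.s_contDiff hρ hΘ).const_mul Θ)).add
    ((hasDerivAt_rho L.p_contDiff hρ hΘ).div (hasDerivAt_id ρ) hρ.ne')
  refine h.congr_deriv ?_
  rw [L.gibbs_rho_eq hρ hΘ]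
  simp only [id]
  field_simp
  ring

theorem convexOn_helmholtz_rho (hΘ : 0 < Θ) :
    ConvexOn ℝ (Set.Ioi 0) (fun y => L.helmholtz Θ y Θ) := by
  refine convexOn_of_hasDerivWithinAt2_nonneg (convex_Ioi 0)
    (f' := fun y => L.chemPot y Θ) (f'' := fun y => deriv (fun r => L.p r Θ) y / y)
    (fun y hy => (L.hasDerivAt_helmholtz_rho Θ hy hΘ).continuousAt.continuousWithinAt) ?_ ?_ ?_
  all_goals
    rw [interior_Ioi]
    intro y hy
  · exact (L.hasDerivAt_helmholtz_rho Θ hy hΘ).hasDerivWithinAt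
  · exact (L.hasDerivAt_chemPot_rho hy hΘ).hasDerivWithinAt
  · exact (div_pos (L.stable_p y Θ hy hΘ) hy).le

/-- Nonnegativity of the relative energy, a consequence of thermodynamic stability. -/
theorem relEnergy_nonneg (hρ : 0 < ρ) (hθ : 0 < θ) (hr : 0 < r) (hΘ : 0 < Θ) (u U : Sp d) :
    0 ≤ L.relEnergy ρ u θ r U Θ := by
  rw [L.relEnergy_eq_helmholtz hρ hr hΘ, (L.hasDerivAt_helmholtz_rho Θ hr hΘ).deriv]
  -- Two descents: at fixed ρ from θ to Θ, then on the isotherm θ = Θ down to the tangent line at r.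
  have h1 := L.helmholtz_theta_le hρ hθ hΘ
  have h2 : L.helmholtz Θ r Θ + L.chemPot r Θ * (ρ - r) ≤ L.helmholtz Θ ρ Θ := by
    have hc := L.convexOn_helmholtz_rho hΘ
    have hd := L.hasDerivAt_helmholtz_rho Θ hr hΘ
    rcases lt_trichotomy ρ r with h | h | h
    · have := hc.slope_le_of_hasDerivAt (x := ρ) (y := r) hρ hr h hd
      rw [slope_def_field, div_le_iff₀ (sub_pos.2 h)] at this
      linarith
    · simp [h]
    · have := hc.le_slope_of_hasDerivAt (x := r) (y := ρ) hr hρ h hd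
      rw [slope_def_field, le_div_iff₀ (sub_pos.2 h)] at this
      linarith
  have h3 : 0 ≤ 1 / 2 * ρ * ‖u - U‖ ^ 2 := by positivity
  linarith

/-- A function on a convex set with a supporting hyperplane at every point is convex. -/
theorem _root_.convexOn_of_forall_exists_le_add {E : Type*} [AddCommGroup E] [Module ℝ E]
    {s : Set E} {f : E → ℝ} (hs : Convex ℝ s)
    (h : ∀ y ∈ s, ∃ l : E →ₗ[ℝ] ℝ, ∀ x ∈ s, f y + l (x - y) ≤ f x) : ConvexOn ℝ s f := by
  refine ⟨hs, fun x hx y hy a b ha hb hab => ?_⟩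
  obtain ⟨l, hl⟩ := h _ (hs hx hy ha hb hab)
  have h1 := mul_le_mul_of_nonneg_left (hl x hx) ha
  have h2 := mul_le_mul_of_nonneg_left (hl y hy) hb
  simp only [map_sub, map_add, map_smul, smul_eq_mul] at h1 h2 ⊢
  obtain rfl : b = 1 - a := by linarith
  linarith

/-- Convexity of the total energy in the variables `(ρ, m, S)`. -/
theorem convexOn_totalEnergy (hL : Convex ℝ L.states) :
    ConvexOn ℝ {z : ℝ × Sp d × ℝ | (z.1, z.2.2) ∈ L.states} L.totalEnergy := by
  have hstate : ∀ z ∈ {z : ℝ × Sp d × ℝ | (z.1, z.2.2) ∈ L.states},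
      ∃ (ρ θ : ℝ) (u : Sp d), 0 < ρ ∧ 0 < θ ∧ z = (ρ, ρ • u, ρ * L.s ρ θ) := by
    rintro ⟨ρ, m, S⟩ ⟨hρ, θ, hθ, hS⟩
    simp only at hρ hS
    exact ⟨ρ, θ, ρ⁻¹ • m, hρ, hθ, by rw [smul_inv_smul₀ hρ.ne', hS]⟩
  refine convexOn_of_forall_exists_le_add ?_ fun y hy => ?_
  · exact hL.linear_preimage ((LinearMap.fst ℝ ℝ (Sp d × ℝ)).prod
      ((LinearMap.snd ℝ (Sp d) ℝ).comp (LinearMap.snd ℝ ℝ (Sp d × ℝ))))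
  · obtain ⟨r, Θ, U, hr, hΘ, rfl⟩ := hstate y hy
    refine ⟨(fderiv ℝ L.totalEnergy (r, r • U, r * L.s r Θ) : ℝ × Sp d × ℝ →L[ℝ] ℝ), ?_⟩
    intro x hx
    obtain ⟨ρ, θ, u, hρ, hθ, rfl⟩ := hstate x hx
    -- The gap between the total energy and its tangent plane is the Bregman distance, that is, the
    -- relative energy; no Hessian is needed.
    have h := L.relEnergy_nonneg hρ hθ hr hΘ u U
    rw [L.relEnergy_eq_bregman hρ hθ hr hΘ, bregman] at h
    simp only [ContinuousLinearMap.coe_coe]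
    linarith

end ThermoLaw

/-! ### Geometry of the boundary -/

section Boundary

variable {d : ℕ} {Ω : Set (Sp d)} {x : Sp d} {Φ Ψ : Sp d → ℝ}

theorem IsDefiningFunction.hasStrictFDerivAt (h : IsDefiningFunction Ω x Φ) (y : Sp d) :
    HasStrictFDerivAt Φ (innerSL ℝ (gradient Φ y)) y := by
  have h1 := (h.smooth.contDiffAt (x := y)).hasStrictFDerivAt (by simp)
  refine h1.congr_fderiv ?_
  ext v
  simp [gradient]

theorem IsDefiningFunction.continuous_gradient (h : IsDefiningFunction Ω x Φ) :
    Continuous (gradient Φ) :=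
  (InnerProductSpace.toDual ℝ (Sp d)).symm.continuous.comp
    (h.smooth.continuous_fderiv (by simp))

theorem IsDefiningFunction.tendsto_slope (h : IsDefiningFunction Ω x Φ) (v : Sp d) :
    Tendsto (fun t : ℝ => t⁻¹ * Φ (x + t • v)) (𝓝[>] 0) (𝓝 ⟪gradient Φ x, v⟫) := by
  have hline : HasDerivAt (fun t : ℝ => x + t • v) v 0 := by
    simpa using ((hasDerivAt_id (0 : ℝ)).smul_const v).const_add x
  have h0 : HasFDerivAt Φ (innerSL ℝ (gradient Φ x)) (x + (0 : ℝ) • v) := by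
    simpa using (h.hasStrictFDerivAt x).hasFDerivAt
  have h1 := (h0.comp_hasDerivAt (0 : ℝ) hline).tendsto_slope_zero_right
  simpa [h.zero] using h1

/-- Along such a v the point x + tv enters Ω for small t > 0 because Φ < 0 there. Hence Ψ < 0 as
well, and the slope of Ψ has a nonpositive limit. -/
theorem IsDefiningFunction.inner_gradient_nonpos (hΦ : IsDefiningFunction Ω x Φ)
    (hΨ : IsDefiningFunction Ω x Ψ) {v : Sp d} (hv : ⟪gradient Φ x, v⟫ < 0) :
    ⟪gradient Ψ x, v⟫ ≤ 0 := by
  have hline : Tendsto (fun t : ℝ => x + t • v) (𝓝[>] 0) (𝓝 x) := by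
    have : Continuous fun t : ℝ => x + t • v := by fun_prop
    simpa using (this.tendsto 0).mono_left nhdsWithin_le_nhds
  refine le_of_tendsto (hΨ.tendsto_slope v) ?_
  filter_upwards [(hΦ.tendsto_slope v).eventually_lt_const hv, hline.eventually hΦ.mem_iff,
    hline.eventually hΨ.mem_iff, self_mem_nhdsWithin] with t h1 h2 h3 ht
  have ht' : 0 < t⁻¹ := inv_pos.2 ht
  have h4 : Φ (x + t • v) < 0 := by
    by_contra hcon
    exact absurd h1 (not_lt.2 (mul_nonneg ht'.le (not_lt.1 hcon)))
  exact mul_nonpos_of_nonneg_of_nonpos ht'.le (h3.1 (h2.2 h4)).le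

/-- The normal direction does not depend on the defining function. -/
theorem IsDefiningFunction.normal_unique (hΦ : IsDefiningFunction Ω x Φ)
    (hΨ : IsDefiningFunction Ω x Ψ) :
    ‖gradient Φ x‖⁻¹ • gradient Φ x = ‖gradient Ψ x‖⁻¹ • gradient Ψ x := by
  have ha := norm_pos_iff.2 hΦ.gradient_ne_zero
  have hb := norm_pos_iff.2 hΨ.gradient_ne_zero
  set a := ‖gradient Φ x‖⁻¹ • gradient Φ x with hadef
  set b := ‖gradient Ψ x‖⁻¹ • gradient Ψ x with hbdef
  have ha1 : ‖a‖ = 1 := norm_smul_inv_norm hΦ.gradient_ne_zero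
  have hb1 : ‖b‖ = 1 := norm_smul_inv_norm hΨ.gradient_ne_zero
  by_contra hne
  have hlt : ⟪a, b⟫ < 1 := inner_lt_one_iff_real_of_norm_eq_one ha1 hb1 |>.2 hne
  have haeq : gradient Φ x = ‖gradient Φ x‖ • a := by rw [hadef, smul_inv_smul₀ ha.ne']
  have hbeq : gradient Ψ x = ‖gradient Ψ x‖ • b := by rw [hbdef, smul_inv_smul₀ hb.ne']
  -- If the unit normals a, b differ, the direction b - a points strictly inwards for Φ, since ⟪a,
  -- b⟫ < 1, but strictly outwards for Ψ.
  have h1 : ⟪gradient Φ x, b - a⟫ < 0 := by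
    rw [haeq, real_inner_smul_left, inner_sub_right, real_inner_self_eq_norm_sq, ha1]
    exact mul_neg_of_pos_of_neg ha (by linarith)
  have h2 := hΦ.inner_gradient_nonpos hΨ h1
  rw [hbeq, real_inner_smul_left, inner_sub_right, real_inner_self_eq_norm_sq, hb1,
    real_inner_comm] at h2
  have h3 := mul_pos hb (by linarith : (0 : ℝ) < 1 ^ 2 - ⟪a, b⟫)
  linarith

theorem outwardNormal_eq (h : IsDefiningFunction Ω x Φ) :
    outwardNormal Ω x = ‖gradient Φ x‖⁻¹ • gradient Φ x := by
  have hex : ∃ Φ : Sp d → ℝ, IsDefiningFunction Ω x Φ := ⟨Φ, h⟩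
  rw [outwardNormal, dif_pos hex]
  exact hex.choose_spec.normal_unique h

/-- A defining function at a boundary point is one at all neighbouring boundary points. -/
theorem IsDefiningFunction.eventually (hΩ : IsOpen Ω) (h : IsDefiningFunction Ω x Φ) :
    ∀ᶠ y in 𝓝[frontier Ω] x, IsDefiningFunction Ω y Φ := by
  have hg : ∀ᶠ y in 𝓝 x, gradient Φ y ≠ 0 :=
    h.continuous_gradient.continuousAt.eventually_ne h.gradient_ne_zero
  filter_upwards [nhdsWithin_le_nhds hg, nhdsWithin_le_nhds h.mem_iff.eventually_nhds,
    self_mem_nhdsWithin] with y h1 h2 hy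
  rw [hΩ.frontier_eq] at hy
  -- Φ(y) > 0 would keep Ω away from y, contradicting y ∈ closure Ω; Φ(y) < 0 would put y into Ω,
  -- which is open and so misses its frontier.
  refine ⟨h.smooth, le_antisymm ?_ ?_, h1, h2⟩
  · by_contra hcon
    have h3 : ∀ᶠ z in 𝓝 y, 0 < Φ z :=
      h.smooth.continuous.continuousAt.eventually_const_lt (not_le.1 hcon)
    obtain ⟨z, hz1, hz2⟩ := mem_closure_iff_nhds.1 hy.1 _ (h2.and h3)
    exact absurd (hz1.1.1 hz2) (not_lt.2 (le_of_lt hz1.2))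
  · by_contra hcon
    exact hy.2 (h2.self_of_nhds.2 (not_le.1 hcon))

/-- One defining function serves all boundary points near x, so the normal is locally the normalized
gradient of a single smooth function. This makes Γin and Γout Borel sets. -/
theorem continuousOn_outwardNormal (hΩ : IsSmoothBoundedDomain Ω) :
    ContinuousOn (outwardNormal Ω) (frontier Ω) := by
  intro x hx
  obtain ⟨Φ, hΦ⟩ := hΩ.smooth x hx
  have hc : ContinuousAt (fun y => ‖gradient Φ y‖⁻¹ • gradient Φ y) x :=
    (hΦ.continuous_gradient.continuousAt.norm.inv₀ (norm_ne_zero_iff.2 hΦ.gradient_ne_zero)).smul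
      hΦ.continuous_gradient.continuousAt
  refine hc.continuousWithinAt.congr_of_eventuallyEq ?_ (outwardNormal_eq hΦ)
  filter_upwards [hΦ.eventually hΩ.isOpen] with y hy using outwardNormal_eq hy

/-- A subset of `ℝᵈ` whose chords are nearly orthogonal to a fixed direction has finite
`(d-1)`-dimensional measure, if bounded. -/
theorem euclideanHausdorffMeasure_lt_top_of_inner_le (hd : 0 < d) {a : Sp d} (ha : a ≠ 0)
    {s : Set (Sp d)} (hs : Bornology.IsBounded s)
    (h : ∀ y ∈ s, ∀ z ∈ s, |⟪a, y - z⟫| ≤ ‖a‖ / 2 * ‖y - z‖) :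
    (Measure.euclideanHausdorffMeasure (d - 1) : Measure (Sp d)) s < ⊤ := by
  let K : Submodule ℝ (Sp d) := (ℝ ∙ a)ᗮ
  have hfin : Module.finrank ℝ K = d - 1 := by
    have : Fact (Module.finrank ℝ (Sp d) = d - 1 + 1) := ⟨by simp; omega⟩
    exact Submodule.finrank_orthogonal_span_singleton ha
  let P : Sp d →L[ℝ] K := K.orthogonalProjectionOnto
  -- The component of y - z along a is at most half of its length, so Pythagoras gives ‖y - z‖² ≤
  -- (4/3)‖P(y - z)‖², and the constant 2 suffices. The measure of `s` is then controlled by that of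
  -- its bounded shadow in the hyperplane orthogonal to a.
  have hP : AntilipschitzWith 2 (fun y : s => P y) := by
    refine AntilipschitzWith.of_le_mul_dist fun y z => ?_
    rw [Subtype.dist_eq, dist_eq_norm, dist_eq_norm, ← map_sub]
    have h1 := Submodule.norm_sq_eq_add_norm_sq_projection ((y : Sp d) - z) (ℝ ∙ a)
    have h2 : ‖(ℝ ∙ a).orthogonalProjectionOnto ((y : Sp d) - z)‖ ≤ 1 / 2 * ‖(y : Sp d) - z‖ := by
      rw [Submodule.coe_norm, Submodule.coe_orthogonalProjectionOnto_apply,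
        Submodule.starProjection_singleton, norm_smul]
      have h3 := h y y.2 z z.2
      have ha' := norm_pos_iff.2 ha
      simp only [Real.norm_eq_abs, abs_div, RCLike.ofReal_real_eq_id, id, abs_pow, abs_norm]
      rw [div_mul_eq_mul_div, div_le_iff₀ (by positivity)]
      nlinarith
    have h3 : ‖(y : Sp d) - z‖ ^ 2 ≤ (2 * ‖P ((y : Sp d) - z)‖) ^ 2 := by
      change _ = _ + ‖P _‖ ^ 2 at h1
      nlinarith [norm_nonneg ((ℝ ∙ a).orthogonalProjectionOnto ((y : Sp d) - z)),
        norm_nonneg ((y : Sp d) - z)]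
    simpa using abs_le_of_sq_le_sq' h3 (by positivity) |>.2
  have hd0 : (0 : ℝ) ≤ ((d - 1 : ℕ) : ℝ) := Nat.cast_nonneg _
  have hle := hP.le_hausdorffMeasure_image hd0 Set.univ
  have hs' : μH[((d - 1 : ℕ) : ℝ)] (Set.univ : Set s) = μH[((d - 1 : ℕ) : ℝ)] s := by
    rw [← isometry_subtype_coe.hausdorffMeasure_image (Or.inl hd0)]
    simp
  have himg : (fun y : s => P y) '' Set.univ = P '' s := by
    ext; simp
  have hbdd : Bornology.IsBounded (P '' s) := P.lipschitz.isBounded_image hs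
  have hlt : μH[((d - 1 : ℕ) : ℝ)] (P '' s) < ⊤ := by
    rw [← hfin]
    exact hbdd.measure_lt_top
  rw [Measure.euclideanHausdorffMeasure_def, Measure.smul_apply]
  refine ENNReal.mul_lt_top ENNReal.coe_lt_top ?_
  rw [← hs']
  rw [himg] at hle
  exact hle.trans_lt (ENNReal.mul_lt_top (by simp) hlt)

/-- Near x the boundary lies in the zero set of Φ. Strict differentiability with tolerance ‖∇Φ(x)‖/2
makes short chords of this set nearly orthogonal to ∇Φ(x), so each small piece has finite measure;
compactness of the frontier concludes. -/
theorem isFiniteMeasure_surfaceMeasure (hd : 0 < d) (hΩ : IsSmoothBoundedDomain Ω) :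
    IsFiniteMeasure (surfaceMeasure Ω) := by
  have hcpt : IsCompact (frontier Ω) :=
    Metric.isCompact_of_isClosed_isBounded isClosed_frontier
      (hΩ.isBounded.closure.subset frontier_subset_closure)
  refine ⟨?_⟩
  rw [surfaceMeasure, Measure.restrict_apply_univ]
  refine hcpt.measure_lt_top_of_nhdsWithin fun x hx => ?_
  obtain ⟨Φ, hΦ⟩ := hΩ.smooth x hx
  have ha := norm_pos_iff.2 hΦ.gradient_ne_zero
  have h1 := (hΦ.hasStrictFDerivAt x).isLittleO.def (half_pos ha)
  rw [nhds_prod_eq] at h1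
  obtain ⟨u, hu, hu'⟩ := (Filter.eventually_prod_self_iff (r := fun y z =>
    ‖Φ y - Φ z - (innerSL ℝ (gradient Φ x)) (y - z)‖ ≤ ‖gradient Φ x‖ / 2 * ‖y - z‖)).1 h1
  refine ⟨frontier Ω ∩ (u ∩ {y | IsDefiningFunction Ω y Φ}), ?_, ?_⟩
  · exact inter_mem self_mem_nhdsWithin (inter_mem (mem_nhdsWithin_of_mem_nhds hu)
      (hΦ.eventually hΩ.isOpen))
  · refine euclideanHausdorffMeasure_lt_top_of_inner_le hd hΦ.gradient_ne_zero
      (hcpt.isBounded.subset Set.inter_subset_left) ?_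
    intro y hy z hz
    have h2 := hu' y hy.2.1 z hz.2.1
    have hy0 : Φ y = 0 := IsDefiningFunction.zero hy.2.2
    have hz0 : Φ z = 0 := IsDefiningFunction.zero hz.2.2
    rwa [hy0, hz0, sub_zero, zero_sub, norm_neg, innerSL_apply_apply] at h2

end Boundary

namespace FluidProblem

variable {d : ℕ} (P : FluidProblem d)

theorem isCompact_closure : IsCompact (closure P.Ω) :=
  Metric.isCompact_of_isClosed_isBounded isClosed_closure P.domain.isBounded.closure

theorem isCompact_frontier : IsCompact (frontier P.Ω) :=
  P.isCompact_closure.of_isClosed_subset isClosed_frontier frontier_subset_closure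

theorem measurableSet_Ω : MeasurableSet P.Ω := P.domain.isOpen.measurableSet

theorem continuousOn_uBn : ContinuousOn P.uBn (frontier P.Ω) :=
  (P.uB_contDiff.continuousOn.mono frontier_subset_closure).inner
    (continuousOn_outwardNormal P.domain)

theorem measurableSet_Γin : MeasurableSet P.Γin := by
  obtain ⟨u, hu, hu'⟩ := _root_.continuousOn_iff'.1 P.continuousOn_uBn _ (isOpen_Iio (a := 0))
  have h : P.Γin = P.uBn ⁻¹' Set.Iio 0 ∩ frontier P.Ω := Set.ext fun x => and_comm
  rw [h, hu']
  exact hu.measurableSet.inter isClosed_frontier.measurableSet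

theorem measurableSet_Γout : MeasurableSet P.Γout := by
  obtain ⟨u, hu, hu'⟩ := _root_.continuousOn_iff'.1 P.continuousOn_uBn _ (isOpen_Ioi (a := 0))
  have h : P.Γout = P.uBn ⁻¹' Set.Ioi 0 ∩ frontier P.Ω := Set.ext fun x => and_comm
  rw [h, hu']
  exact hu.measurableSet.inter isClosed_frontier.measurableSet

end FluidProblem

/-! ### Products of integrable and bounded functions -/

section Bilinear

variable {α : Type*} [MeasurableSpace α] {μ : Measure α}
  {E F G : Type*} [NormedAddCommGroup E] [NormedSpace ℝ E] [NormedAddCommGroup F]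
  [NormedSpace ℝ F] [NormedAddCommGroup G] [NormedSpace ℝ G]

theorem integrable_bilin (B : E →L[ℝ] F →L[ℝ] G) {f : α → E} {g : α → F} (hf : Integrable f μ)
    (hg : MemLp g ⊤ μ) : Integrable (fun z => B (f z) (g z)) μ := by
  rw [← memLp_one_iff_integrable] at hf ⊢
  refine MemLp.of_bilin (fun x y => B x y) ‖B‖₊ hf hg
    (B.aestronglyMeasurable_comp₂ hf.1 hg.1) (Eventually.of_forall fun z => ?_)
  exact B.le_opNorm₂ (f z) (g z)

/-- Dominated convergence with majorant ‖B‖ ‖f‖ C. It is needed for passing to the limit in the test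
functions of the momentum equation. -/
theorem tendsto_integral_bilin (B : E →L[ℝ] F →L[ℝ] G) {f : α → E} (hf : Integrable f μ)
    {g : ℕ → α → F} {g' : α → F} (hm : ∀ k, AEStronglyMeasurable (g k) μ) {C : ℝ}
    (hC : ∀ k, ∀ᵐ z ∂μ, ‖g k z‖ ≤ C)
    (hl : ∀ᵐ z ∂μ, Tendsto (fun k => g k z) atTop (𝓝 (g' z))) :
    Tendsto (fun k => ∫ z, B (f z) (g k z) ∂μ) atTop (𝓝 (∫ z, B (f z) (g' z) ∂μ)) := by
  refine tendsto_integral_of_dominated_convergence (fun z => ‖B‖ * ‖f z‖ * C)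
    (fun k => B.aestronglyMeasurable_comp₂ hf.1 (hm k))
    ((hf.norm.const_mul _).mul_const _) (fun k => ?_) ?_
  · filter_upwards [hC k] with z hz
    exact (B.le_opNorm₂ (f z) (g k z)).trans (by gcongr)
  · filter_upwards [hl] with z hz
    exact ((B (f z)).continuous.tendsto _).comp hz

omit [NormedSpace ℝ E] in
/-- Continuous functions on a compact set are essentially bounded on its subsets. -/
theorem _root_.ContinuousOn.memLp_top_of_isCompact {X : Type*} [TopologicalSpace X]
    [MeasurableSpace X] [OpensMeasurableSpace X] [T2Space X] [SecondCountableTopology X]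
    [TopologicalSpace.PseudoMetrizableSpace X]
    {K s : Set X} {f : X → E} (hf : ContinuousOn f K) (hK : IsCompact K) (hs : s ⊆ K)
    (ν : Measure X) : MemLp f ⊤ (ν.restrict s) := by
  obtain ⟨C, hC⟩ := hK.exists_bound_of_continuousOn hf
  have h : MemLp f ⊤ (ν.restrict K) :=
    memLp_top_of_bound (hf.aestronglyMeasurable_of_isCompact hK hK.measurableSet) C
      (ae_restrict_of_forall_mem hK.measurableSet hC)
  exact h.mono_measure (Measure.restrict_mono hs le_rfl)

end Bilinear

/-! ### Zeros of differentiable functions -/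

section Zeros

variable {E F : Type*} [NormedAddCommGroup E] [NormedSpace ℝ E] [FiniteDimensional ℝ E]
  [MeasurableSpace E] [BorelSpace E] [NormedAddCommGroup F] [NormedSpace ℝ F]

/-- A zero with nonzero derivative is isolated, and a discrete subset of the line is countable. -/
theorem countable_zeros_of_deriv_ne_zero {g : ℝ → F} {s : Set ℝ}
    (h : ∀ t ∈ s, g t = 0 ∧ ∃ g' : F, g' ≠ 0 ∧ HasDerivAt g g' t) : s.Countable := by
  have : DiscreteTopology s := by
    refine discreteTopology_subtype_iff.2 fun t ht => ?_
    obtain ⟨-, g', hg', hd⟩ := h t ht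
    have h1 : ∀ᶠ z in 𝓝[≠] t, g z ≠ 0 := hd.eventually_ne hg'
    refine Filter.inf_principal_eq_bot.2 ?_
    filter_upwards [h1] with z hz hzs using hz (h z hzs).1
  exact Set.countable_coe_iff.1 (TopologicalSpace.separableSpace_iff_countable.1 inferInstance)

/-- The differential of a `C¹` function vanishes almost everywhere on its zero set. -/
theorem ae_fderiv_eq_zero_of_eq_zero (μ : Measure E) [μ.IsAddHaarMeasure] {Q : Set E}
    (hQ : IsOpen Q) {f : E → F} (hf : DifferentiableOn ℝ f Q)
    (hf' : ContinuousOn (fderiv ℝ f) Q) :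
    ∀ᵐ z ∂μ, z ∈ Q → f z = 0 → fderiv ℝ f z = 0 := by
  have key : ∀ v : E, ∀ᵐ z ∂μ, z ∈ Q → f z = 0 → fderiv ℝ f z v = 0 := by
    intro v
    let A : Set E := {z | z ∈ Q → f z = 0 → fderiv ℝ f z v = 0}
    have hA : MeasurableSet A := by
      have h1 : IsOpen (Q ∩ f ⁻¹' {0}ᶜ) :=
        hf.continuousOn.isOpen_inter_preimage hQ isOpen_compl_singleton
      have h2 : IsOpen (Q ∩ (fun z => fderiv ℝ f z v) ⁻¹' {0}ᶜ) :=
        (hf'.clm_apply continuousOn_const).isOpen_inter_preimage hQ isOpen_compl_singleton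
      -- The exceptional set is a difference of two open sets, hence Borel.
      have h3 : A = ((Q ∩ (fun z => fderiv ℝ f z v) ⁻¹' {0}ᶜ) \ (Q ∩ f ⁻¹' {0}ᶜ))ᶜ := by
        ext z
        simp only [A, Set.mem_ofPred_eq, Set.mem_compl_iff, Set.mem_sdiff, Set.mem_inter_iff,
          Set.mem_preimage, Set.mem_singleton_iff]
        tauto
      rw [h3]
      exact (h2.measurableSet.diff h1.measurableSet).compl
    -- Fubini along the lines of direction v: on each of them the exceptional parameters are zeros
    -- with nonzero derivative, so they are countable and null.
    refine ae_mem_of_ae_add_linearMap_mem (LinearMap.toSpanSingleton ℝ E v) volume μ hA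
      fun y => ?_
    have hc : {t : ℝ | y + LinearMap.toSpanSingleton ℝ E v t ∉ A}.Countable := by
      refine countable_zeros_of_deriv_ne_zero (g := fun t => f (y + t • v)) fun t ht => ?_
      simp only [A, Set.mem_ofPred_eq, LinearMap.toSpanSingleton_apply, Classical.not_imp] at ht
      obtain ⟨h1, h2, h3⟩ := ht
      refine ⟨h2, _, h3, ?_⟩
      have hline : HasDerivAt (fun t : ℝ => y + t • v) v t := by
        simpa using ((hasDerivAt_id t).smul_const v).const_add y
      exact ((hf.differentiableAt (hQ.mem_nhds h1)).hasFDerivAt).comp_hasDerivAt t hline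
    exact hc.measure_zero volume
  let b := Module.finBasis ℝ E
  filter_upwards [ae_all_iff.2 fun i => key (b i)] with z hz hzQ h0
  refine ContinuousLinearMap.coe_injective (b.ext fun i => ?_)
  exact hz i hzQ h0

end Zeros

/-! ### Calculus for functions of class `C¹([0,T] × Ω̄)` -/

section C1

variable {d : ℕ} {F : Type} [NormedAddCommGroup F] [NormedSpace ℝ F]
  {Ω : Set (Sp d)} {T τ t : ℝ} {x : Sp d} {f : ℝ → Sp d → F}

/-- Dropping the final time costs a null set and, for open Ω, leaves an open cylinder, on which
`fderiv` is the true derivative of a function in `C1Closed`. -/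
theorem restrict_Ioc_prod_eq (Ω : Set (Sp d)) (τ : ℝ) :
    (volume : Measure (ℝ × Sp d)).restrict (Set.Ioc 0 τ ×ˢ Ω)
      = volume.restrict (Set.Ioo 0 τ ×ˢ Ω) := by
  refine Measure.restrict_congr_set ?_
  rw [Measure.volume_eq_prod]
  exact Measure.set_prod_ae_eq Ioo_ae_eq_Ioc.symm (ae_eq_refl _)

theorem ae_Ioc_prod (hΩ : IsOpen Ω) {p : ℝ × Sp d → Prop} (h : ∀ z ∈ Set.Ioo 0 T ×ˢ Ω, p z) :
    ∀ᵐ z ∂(volume : Measure (ℝ × Sp d)).restrict (Set.Ioc 0 T ×ˢ Ω), p z := by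
  rw [restrict_Ioc_prod_eq]
  exact ae_restrict_of_forall_mem (isOpen_Ioo.prod hΩ).measurableSet h

theorem Ioo_prod_mem_nhds (hΩ : IsOpen Ω) {z : ℝ × Sp d} (hz : z ∈ Set.Ioo 0 T ×ˢ Ω) :
    Set.Icc 0 T ×ˢ closure Ω ∈ 𝓝 z :=
  mem_of_superset ((isOpen_Ioo.prod hΩ).mem_nhds hz)
    (Set.prod_mono Set.Ioo_subset_Icc_self subset_closure)

theorem C1Closed.contDiffAt (hf : C1Closed Ω T f) (hΩ : IsOpen Ω) {z : ℝ × Sp d}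
    (hz : z ∈ Set.Ioo 0 T ×ˢ Ω) : ContDiffAt ℝ 1 (fun z : ℝ × Sp d => f z.1 z.2) z :=
  ContDiffOn.contDiffAt hf (Ioo_prod_mem_nhds hΩ hz)

theorem C1Closed.hasFDerivAt (hf : C1Closed Ω T f) (hΩ : IsOpen Ω) {z : ℝ × Sp d}
    (hz : z ∈ Set.Ioo 0 T ×ˢ Ω) :
    HasFDerivAt (fun z : ℝ × Sp d => f z.1 z.2) (fderiv ℝ (fun z : ℝ × Sp d => f z.1 z.2) z) z :=
  ((hf.contDiffAt hΩ hz).differentiableAt one_ne_zero).hasFDerivAt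

theorem C1Closed.continuousOn_fderiv (hf : C1Closed Ω T f) (hΩ : IsOpen Ω) :
    ContinuousOn (fderiv ℝ (fun z : ℝ × Sp d => f z.1 z.2)) (Set.Ioo 0 T ×ˢ Ω) := fun _ hz =>
  ((hf.contDiffAt hΩ hz).continuousAt_fderiv one_ne_zero).continuousWithinAt

theorem hasDerivAt_time {z : ℝ × Sp d} {f' : ℝ × Sp d →L[ℝ] F}
    (h : HasFDerivAt (fun z : ℝ × Sp d => f z.1 z.2) f' z) :
    HasDerivAt (fun s => f s z.2) (f' (1, 0)) z.1 :=
  HasFDerivAt.comp_hasDerivAt (l := fun z : ℝ × Sp d => f z.1 z.2) (f := fun s => (s, z.2)) z.1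
    h ((hasDerivAt_id z.1).prodMk (hasDerivAt_const z.1 z.2))

theorem hasFDerivAt_space {z : ℝ × Sp d} {f' : ℝ × Sp d →L[ℝ] F}
    (h : HasFDerivAt (fun z : ℝ × Sp d => f z.1 z.2) f' z) :
    HasFDerivAt (f z.1) (f'.comp (ContinuousLinearMap.inr ℝ ℝ (Sp d))) z.2 :=
  HasFDerivAt.comp (g := fun z : ℝ × Sp d => f z.1 z.2) (f := fun y => (z.1, y)) z.2 h
    ((hasFDerivAt_const z.1 z.2).prodMk (hasFDerivAt_id z.2))

theorem C1Closed.dt_eq (hf : C1Closed Ω T f) (hΩ : IsOpen Ω) {z : ℝ × Sp d}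
    (hz : z ∈ Set.Ioo 0 T ×ˢ Ω) :
    dt f z.1 z.2 = fderiv ℝ (fun z : ℝ × Sp d => f z.1 z.2) z (1, 0) :=
  (hasDerivAt_time (hf.hasFDerivAt hΩ hz)).deriv

theorem C1Closed.fderiv_eq (hf : C1Closed Ω T f) (hΩ : IsOpen Ω) {z : ℝ × Sp d}
    (hz : z ∈ Set.Ioo 0 T ×ˢ Ω) :
    fderiv ℝ (f z.1) z.2
      = (fderiv ℝ (fun z : ℝ × Sp d => f z.1 z.2) z).comp (ContinuousLinearMap.inr ℝ ℝ (Sp d)) :=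
  (hasFDerivAt_space (hf.hasFDerivAt hΩ hz)).fderiv

theorem C1Closed.hasDerivAt_dt (hf : C1Closed Ω T f) (hΩ : IsOpen Ω) {z : ℝ × Sp d}
    (hz : z ∈ Set.Ioo 0 T ×ˢ Ω) : HasDerivAt (fun s => f s z.2) (dt f z.1 z.2) z.1 := by
  rw [hf.dt_eq hΩ hz]
  exact hasDerivAt_time (hf.hasFDerivAt hΩ hz)

theorem C1Closed.hasFDerivAt_fderiv (hf : C1Closed Ω T f) (hΩ : IsOpen Ω) {z : ℝ × Sp d}
    (hz : z ∈ Set.Ioo 0 T ×ˢ Ω) : HasFDerivAt (f z.1) (fderiv ℝ (f z.1) z.2) z.2 := by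
  rw [hf.fderiv_eq hΩ hz]
  exact hasFDerivAt_space (hf.hasFDerivAt hΩ hz)

/-- The derivatives of a function of class `C¹([0,T] × Ω̄)` are bounded. -/
theorem C1Closed.exists_bound_fderiv (hf : C1Closed Ω T f) (hΩ : IsOpen Ω)
    (hb : IsCompact (closure Ω)) :
    ∃ C : ℝ, ∀ z ∈ Set.Ioo 0 T ×ˢ Ω, ‖fderiv ℝ (fun z : ℝ × Sp d => f z.1 z.2) z‖ ≤ C := by
  set K := Set.Icc 0 T ×ˢ closure Ω
  set Q := Set.Ioo 0 T ×ˢ Ω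
  have hQ : IsOpen Q := isOpen_Ioo.prod hΩ
  have hQK : Q ⊆ K := Set.prod_mono Set.Ioo_subset_Icc_self subset_closure
  have hK : IsCompact K := isCompact_Icc.prod hb
  -- Boundedness is a local question on the compact cylinder. Near each of its points, boundary
  -- included, there is a derivative within a relative neighbourhood that is continuous at the
  -- point; at interior points it must coincide with `fderiv`.
  have main : ∃ C : ℝ, ∀ z ∈ K ∩ Q, ‖fderiv ℝ (fun z : ℝ × Sp d => f z.1 z.2) z‖ ≤ C := by
    refine hK.induction_on (p := fun s => ∃ C : ℝ, ∀ z ∈ s ∩ Q,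
      ‖fderiv ℝ (fun z : ℝ × Sp d => f z.1 z.2) z‖ ≤ C) ⟨0, by simp⟩ ?_ ?_ ?_
    · rintro s s' hss ⟨C, hC⟩
      exact ⟨C, fun z hz => hC z ⟨hss hz.1, hz.2⟩⟩
    · rintro s s' ⟨C, hC⟩ ⟨C', hC'⟩
      refine ⟨max C C', fun z hz => ?_⟩
      rcases hz.1 with h | h
      · exact (hC z ⟨h, hz.2⟩).trans (le_max_left _ _)
      · exact (hC' z ⟨h, hz.2⟩).trans (le_max_right _ _)
    · intro z hz
      have h1 : ContDiffWithinAt ℝ (0 + 1) (fun z : ℝ × Sp d => f z.1 z.2) K z := by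
        simpa using hf z hz
      obtain ⟨u, hu, -, f', hf', hc⟩ := (contDiffWithinAt_succ_iff_hasFDerivWithinAt (by simp)).1 h1
      rw [Set.insert_eq_of_mem hz] at hu
      have hzu : z ∈ u := mem_of_mem_nhdsWithin hz hu
      have h2 : ∀ᶠ y in 𝓝[u] z, ‖f' y‖ < ‖f' z‖ + 1 :=
        hc.continuousWithinAt.norm.eventually_lt_const (lt_add_one _)
      obtain ⟨o, ho, hzo, hou⟩ := mem_nhdsWithin.1 hu
      have h3 : ∀ᶠ y in 𝓝[K] z, y ∈ u → ‖f' y‖ < ‖f' z‖ + 1 :=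
        nhdsWithin_le_nhds (eventually_nhdsWithin_iff.1 h2)
      refine ⟨_, inter_mem (inter_mem self_mem_nhdsWithin
        (mem_nhdsWithin_of_mem_nhds (ho.mem_nhds hzo))) h3, ‖f' z‖ + 1, ?_⟩
      rintro y ⟨⟨⟨hyK, hyo⟩, hy⟩, hyQ⟩
      have hyu : u ∈ 𝓝 y := mem_of_superset ((ho.inter hQ).mem_nhds ⟨hyo, hyQ⟩)
        fun w hw => hou ⟨hw.1, hQK hw.2⟩
      have hyu' : y ∈ u := mem_of_mem_nhds hyu
      rw [((hf' y hyu').hasFDerivAt hyu).fderiv]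
      exact (hy hyu').le
  obtain ⟨C, hC⟩ := main
  exact ⟨C, fun z hz => hC z ⟨hQK hz, hz⟩⟩

theorem C1Closed.memLp_fderiv_uncurry (hf : C1Closed Ω T f) (hΩ : IsOpen Ω)
    (hb : IsCompact (closure Ω)) :
    MemLp (fderiv ℝ (fun z : ℝ × Sp d => f z.1 z.2)) ⊤
      ((volume : Measure (ℝ × Sp d)).restrict (Set.Ioc 0 T ×ˢ Ω)) := by
  obtain ⟨C, hC⟩ := hf.exists_bound_fderiv hΩ hb
  rw [restrict_Ioc_prod_eq]
  have hQ := (isOpen_Ioo.prod hΩ : IsOpen (Set.Ioo 0 T ×ˢ Ω)).measurableSet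
  exact memLp_top_of_bound ((hf.continuousOn_fderiv hΩ).aestronglyMeasurable hQ) C
    (ae_restrict_of_forall_mem hQ hC)

theorem C1Closed.memLp_dt (hf : C1Closed Ω T f) (hΩ : IsOpen Ω) (hb : IsCompact (closure Ω)) :
    MemLp (fun z : ℝ × Sp d => dt f z.1 z.2) ⊤
      ((volume : Measure (ℝ × Sp d)).restrict (Set.Ioc 0 T ×ˢ Ω)) :=
  ((ContinuousLinearMap.apply ℝ F ((1, 0) : ℝ × Sp d)).comp_memLp'
    (hf.memLp_fderiv_uncurry hΩ hb)).ae_eq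
    (ae_Ioc_prod hΩ fun _ hz => (hf.dt_eq hΩ hz).symm)

theorem C1Closed.memLp_fderiv (hf : C1Closed Ω T f) (hΩ : IsOpen Ω)
    (hb : IsCompact (closure Ω)) :
    MemLp (fun z : ℝ × Sp d => fderiv ℝ (f z.1) z.2) ⊤
      ((volume : Measure (ℝ × Sp d)).restrict (Set.Ioc 0 T ×ˢ Ω)) :=
  (((ContinuousLinearMap.compL ℝ (Sp d) (ℝ × Sp d) F).flip
    (ContinuousLinearMap.inr ℝ ℝ (Sp d))).comp_memLp' (hf.memLp_fderiv_uncurry hΩ hb)).ae_eq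
    (ae_Ioc_prod hΩ fun _ hz => (hf.fderiv_eq hΩ hz).symm)

theorem C1Closed.memLp (hf : C1Closed Ω T f) (hb : IsCompact (closure Ω)) :
    MemLp (fun z : ℝ × Sp d => f z.1 z.2) ⊤
      ((volume : Measure (ℝ × Sp d)).restrict (Set.Ioc 0 T ×ˢ Ω)) :=
  (ContDiffOn.continuousOn hf).memLp_top_of_isCompact (isCompact_Icc.prod hb)
    (Set.prod_mono Set.Ioc_subset_Icc_self subset_closure) _

theorem C1Closed.continuousOn_slice (hf : C1Closed Ω T f) (ht : t ∈ Set.Icc 0 T) :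
    ContinuousOn (f t) (closure Ω) :=
  (ContDiffOn.continuousOn hf).comp (f := fun x => (t, x)) (by fun_prop)
    fun _ hx => ⟨ht, hx⟩

theorem C1Closed.memLp_slice (hf : C1Closed Ω T f) (hb : IsCompact (closure Ω))
    (ht : t ∈ Set.Icc 0 T) : MemLp (f t) ⊤ (volume.restrict Ω) :=
  (hf.continuousOn_slice ht).memLp_top_of_isCompact hb subset_closure _

theorem C1Closed.memLp_boundary {Γ : Set (Sp d)} (hf : C1Closed Ω T f)
    (hb : IsCompact (closure Ω)) (hΓ : Γ ⊆ closure Ω) (ν : Measure (ℝ × Sp d)) :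
    MemLp (fun z : ℝ × Sp d => f z.1 z.2) ⊤ (ν.restrict (Set.Ioc 0 T ×ˢ Γ)) :=
  (ContDiffOn.continuousOn hf).memLp_top_of_isCompact (isCompact_Icc.prod hb)
    (Set.prod_mono Set.Ioc_subset_Icc_self hΓ) _

omit [NormedSpace ℝ F] in
theorem volIntegrable_of_memLp_top (hb : IsCompact (closure Ω))
    (hf : MemLp (fun z : ℝ × Sp d => f z.1 z.2) ⊤
      ((volume : Measure (ℝ × Sp d)).restrict (Set.Ioc 0 T ×ˢ Ω))) : VolIntegrable Ω T f := by
  have : IsFiniteMeasure ((volume : Measure (ℝ × Sp d)).restrict (Set.Ioc 0 T ×ˢ Ω)) := by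
    refine ⟨?_⟩
    rw [Measure.restrict_apply_univ]
    exact (measure_mono (Set.prod_mono Set.Ioc_subset_Icc_self subset_closure)).trans_lt
      (isCompact_Icc.prod hb).measure_lt_top
  exact hf.integrable le_top

omit [NormedSpace ℝ F] in
theorem VolIntegrable.mono (hf : VolIntegrable Ω T f) (hτ : τ ≤ T) : VolIntegrable Ω τ f :=
  IntegrableOn.mono_set hf (Set.prod_mono (Set.Ioc_subset_Ioc_right hτ) le_rfl)

/-- The fundamental theorem of calculus, integrated over the domain. -/
theorem C1Closed.integral_sub_integral {f : ℝ → Sp d → ℝ} (hf : C1Closed Ω T f) (hΩ : IsOpen Ω)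
    (hb : IsCompact (closure Ω)) (hτ : τ ∈ Set.Icc 0 T) :
    (∫ x in Ω, f τ x) - ∫ x in Ω, f 0 x = volInt Ω τ (dt f) := by
  have hvol : volume Ω < ⊤ := (measure_mono subset_closure).trans_lt hb.measure_lt_top
  have : IsFiniteMeasure (volume.restrict Ω) := ⟨by rwa [Measure.restrict_apply_univ]⟩
  have h0 : (0 : ℝ) ∈ Set.Icc 0 T := ⟨le_rfl, hτ.1.trans hτ.2⟩
  rw [← integral_sub ((hf.memLp_slice hb hτ).integrable le_top)
    ((hf.memLp_slice hb h0).integrable le_top)]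
  have hint : Integrable (fun z : ℝ × Sp d => dt f z.1 z.2)
      ((volume.restrict (Set.Ioc 0 τ)).prod (volume.restrict Ω)) := by
    rw [Measure.prod_restrict, ← Measure.volume_eq_prod]
    exact (volIntegrable_of_memLp_top hb (hf.memLp_dt hΩ hb)).mono hτ.2
  rw [volInt, Measure.volume_eq_prod, ← Measure.prod_restrict, integral_prod_symm _ hint]
  refine integral_congr_ae ?_
  filter_upwards [hint.prod_left_ae, ae_restrict_mem hΩ.measurableSet] with x hx hxΩ
  rw [← intervalIntegral.integral_of_le hτ.1]
  symm
  refine intervalIntegral.integral_eq_sub_of_hasDerivAt_of_le (f := fun s => f s x) hτ.1 ?_ ?_ ?_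
  · refine (ContDiffOn.continuousOn hf).comp (f := fun s => (s, x)) (by fun_prop) ?_
    exact fun s hs => ⟨⟨hs.1, hs.2.trans hτ.2⟩, subset_closure hxΩ⟩
  · exact fun s hs => hf.hasDerivAt_dt hΩ (z := (s, x)) ⟨⟨hs.1, hs.2.trans_le hτ.2⟩, hxΩ⟩
  · rw [intervalIntegrable_iff_integrableOn_Ioc_of_le hτ.1]
    exact hx

end C1

/-! ### Contraction of matrices -/

section Contract

variable {d : ℕ}

/-- The inner product of `ℝᵈ` as a continuous bilinear map. -/
noncomputable def innerL (d : ℕ) : Sp d →L[ℝ] Sp d →L[ℝ] ℝ := innerSL ℝ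

@[simp] theorem innerL_apply (u v : Sp d) : innerL d u v = ⟪u, v⟫ := rfl

/-- The entry `A_ij` of a matrix, as a continuous linear map. -/
noncomputable def entryL (i j : Fin d) : (Sp d →L[ℝ] Sp d) →L[ℝ] ℝ :=
  (EuclideanSpace.proj i).comp
    (ContinuousLinearMap.apply ℝ (Sp d) (EuclideanSpace.single j (1 : ℝ)))

/-- The bilinear form `∑ ℓᵢ ⊗ ℓᵢ`. -/
noncomputable def sumSqL {V ι : Type*} [NormedAddCommGroup V] [NormedSpace ℝ V] [Fintype ι]
    (ℓ : ι → V →L[ℝ] ℝ) : V →L[ℝ] V →L[ℝ] ℝ := ∑ i, (ℓ i).smulRight (ℓ i)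

theorem sumSqL_apply {V ι : Type*} [NormedAddCommGroup V] [NormedSpace ℝ V] [Fintype ι]
    (ℓ : ι → V →L[ℝ] ℝ) (v w : V) : sumSqL ℓ v w = ∑ i, ℓ i v * ℓ i w := by
  simp [sumSqL, sum_apply]

/-- The contraction `A : B` as a continuous bilinear map. -/
noncomputable def contractL (d : ℕ) : (Sp d →L[ℝ] Sp d) →L[ℝ] (Sp d →L[ℝ] Sp d) →L[ℝ] ℝ :=
  sumSqL fun p : Fin d × Fin d => entryL p.2 p.1

theorem contractL_apply (A B : Sp d →L[ℝ] Sp d) : contractL d A B = contract A B := by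
  rw [contractL, sumSqL_apply, Fintype.sum_prod_type]
  rfl

/-- The trace as a continuous linear map. -/
noncomputable def trL (d : ℕ) : (Sp d →L[ℝ] Sp d) →L[ℝ] ℝ := ∑ i : Fin d, entryL i i

theorem trL_apply (A : Sp d →L[ℝ] Sp d) : trL d A = tr A := by
  simp [trL, tr, entryL, sum_apply]

theorem contract_id (A : Sp d →L[ℝ] Sp d) :
    contract (ContinuousLinearMap.id ℝ (Sp d)) A = tr A := by
  simp only [contract, tr, ContinuousLinearMap.id_apply]
  refine Finset.sum_congr rfl fun j _ => ?_
  simp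

/-- The matrix `u ⊗ u`. -/
noncomputable def tensor (u : Sp d) : Sp d →L[ℝ] Sp d := (innerL d u).smulRight u

theorem contract_tensor (u : Sp d) (A : Sp d →L[ℝ] Sp d) : contract (tensor u) A = ⟪u, A u⟫ := by
  have hu : u = ∑ j : Fin d, u j • EuclideanSpace.single j (1 : ℝ) := by
    ext i
    simp [Pi.single_apply]
  have hA : A u = ∑ j : Fin d, u j • A (EuclideanSpace.single j (1 : ℝ)) := by
    conv_lhs => rw [hu]
    simp
  rw [hA, inner_sum]
  refine Finset.sum_congr rfl fun j _ => ?_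
  rw [real_inner_smul_right, PiLp.inner_apply, Finset.mul_sum]
  refine Finset.sum_congr rfl fun i _ => ?_
  rw [tensor, ContinuousLinearMap.smulRight_apply, innerL_apply, real_inner_comm,
    EuclideanSpace.inner_single_left]
  simp
  ring

theorem norm_tensor_le (u : Sp d) : ‖tensor u‖ ≤ ‖u‖ ^ 2 := by
  rw [tensor, ContinuousLinearMap.norm_smulRight_apply, sq]
  gcongr
  exact (innerSL_apply_norm ℝ u).le

theorem continuous_tensor : Continuous (tensor : Sp d → Sp d →L[ℝ] Sp d) := by
  have h : (tensor : Sp d → Sp d →L[ℝ] Sp d)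
      = fun u => ContinuousLinearMap.smulRightL ℝ (Sp d) (Sp d) (innerL d u) u := rfl
  rw [h]
  fun_prop

end Contract

/-! ### Truncation -/

section Truncation

variable {F : Type} [NormedAddCommGroup F] [InnerProductSpace ℝ F]

/-- A `C¹` map that vanishes on the unit ball and is the identity away from the origin. -/
noncomputable def trunc (v : F) : F := Real.smoothTransition (‖v‖ ^ 2 - 1) • v

theorem contDiff_trunc : ContDiff ℝ 1 (trunc : F → F) :=
  (Real.smoothTransition.contDiff.comp ((contDiff_norm_sq ℝ).sub contDiff_const)).smul contDiff_id

theorem trunc_eq_zero {v : F} (hv : ‖v‖ ≤ 1) : trunc v = 0 := by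
  rw [trunc, Real.smoothTransition.zero_of_nonpos, zero_smul]
  nlinarith [norm_nonneg v]

theorem trunc_eq_self {v : F} (hv : 2 ≤ ‖v‖) : trunc v = v := by
  rw [trunc, Real.smoothTransition.one_of_one_le, one_smul]
  nlinarith

theorem norm_trunc_le (v : F) : ‖trunc v‖ ≤ ‖v‖ := by
  rw [trunc, norm_smul, Real.norm_of_nonneg (Real.smoothTransition.nonneg _)]
  exact mul_le_of_le_one_left (norm_nonneg v) (Real.smoothTransition.le_one _)

theorem fderiv_trunc_of_gt {v : F} (hv : 2 < ‖v‖) :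
    fderiv ℝ trunc v = ContinuousLinearMap.id ℝ F := by
  have h : (trunc : F → F) =ᶠ[𝓝 v] id := by
    filter_upwards [continuous_norm.continuousAt.eventually_const_lt hv] with w hw
    exact trunc_eq_self hw.le
  rw [h.fderiv_eq, fderiv_id]

/-- The derivative is continuous on the compact ball of radius 2 and the identity outside it. -/
theorem exists_bound_fderiv_trunc [FiniteDimensional ℝ F] :
    ∃ C : ℝ, ∀ v : F, ‖fderiv ℝ trunc v‖ ≤ C := by
  obtain ⟨C, hC⟩ := (isCompact_closedBall (0 : F) 2).exists_bound_of_continuousOn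
    (contDiff_trunc.continuous_fderiv one_ne_zero).continuousOn
  refine ⟨max C 1, fun v => ?_⟩
  rcases le_or_gt ‖v‖ 2 with h | h
  · exact (hC v (by simpa using h)).trans (le_max_left _ _)
  · rw [fderiv_trunc_of_gt h]
    exact ContinuousLinearMap.norm_id_le.trans (le_max_right _ _)

variable {d : ℕ} {Ω : Set (Sp d)} {T : ℝ} {φ : ℝ → Sp d → F}

open Classical in
/-- The truncation at level `1 / c` of a function on `Ω̄`, extended by zero. -/
noncomputable def truncField (Ω : Set (Sp d)) (φ : ℝ → Sp d → F) (c : ℝ) (t : ℝ) (x : Sp d) : F :=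
  if x ∈ closure Ω then c⁻¹ • trunc (c • φ t x) else 0

theorem truncField_eq (c t : ℝ) {x : Sp d} (hx : x ∈ closure Ω) :
    truncField Ω φ c t x = c⁻¹ • trunc (c • φ t x) := if_pos hx

theorem C1Closed.truncField (hφ : C1Closed Ω T φ) (c : ℝ) : C1Closed Ω T (truncField Ω φ c) := by
  have h : ContDiffOn ℝ 1 (fun z : ℝ × Sp d => c⁻¹ • trunc (c • φ z.1 z.2))
      (Set.Icc 0 T ×ˢ closure Ω) :=
    (contDiff_trunc.comp_contDiffOn (ContDiffOn.const_smul c hφ)).const_smul c⁻¹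
  exact h.congr fun z hz => truncField_eq _ _ hz.2

theorem norm_truncField_le {c : ℝ} (hc : 0 < c) (t : ℝ) {x : Sp d} (hx : x ∈ closure Ω) :
    ‖truncField Ω φ c t x‖ ≤ ‖φ t x‖ := by
  rw [truncField_eq _ _ hx, norm_smul, norm_inv, Real.norm_of_nonneg hc.le,
    inv_mul_le_iff₀ hc]
  refine (norm_trunc_le _).trans ?_
  rw [norm_smul, Real.norm_of_nonneg hc.le]

/-- Truncation kills all values of norm at most 1/c. The set where ‖cφ‖ ≥ 1 is compact in space-time
and avoids the boundary, where φ = 0; `K` is its projection to space. No collar or distance function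
is involved. -/
theorem exists_isCompact_truncField (hφ : C1Closed Ω T φ) (hb : IsCompact (closure Ω))
    (hΩ : IsOpen Ω) (h0 : ∀ t ∈ Set.Icc 0 T, ∀ x ∈ frontier Ω, φ t x = 0) (c : ℝ) :
    ∃ K : Set (Sp d), IsCompact K ∧ K ⊆ Ω ∧
      ∀ t ∈ Set.Icc 0 T, ∀ x ∉ K, truncField Ω φ c t x = 0 := by
  have hcont : ContinuousOn (fun z : ℝ × Sp d => ‖c • φ z.1 z.2‖) (Set.Icc 0 T ×ˢ closure Ω) :=
    ((ContDiffOn.continuousOn hφ).const_smul c).norm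
  have hQ : IsCompact (Set.Icc 0 T ×ˢ closure Ω) := isCompact_Icc.prod hb
  have hK : IsCompact ((Set.Icc 0 T ×ˢ closure Ω) ∩
      (fun z : ℝ × Sp d => ‖c • φ z.1 z.2‖) ⁻¹' Set.Ici 1) :=
    hQ.of_isClosed_subset (hcont.preimage_isClosed_of_isClosed hQ.isClosed isClosed_Ici)
      Set.inter_subset_left
  refine ⟨_, hK.image continuous_snd, ?_, fun t ht x hx => ?_⟩
  · rintro _ ⟨z, ⟨hz, hz1⟩, rfl⟩
    by_contra hcon
    have hfr : z.2 ∈ frontier Ω := by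
      rw [hΩ.frontier_eq]
      exact ⟨hz.2, hcon⟩
    have : (1 : ℝ) ≤ ‖c • φ z.1 z.2‖ := hz1
    rw [h0 z.1 hz.1 z.2 hfr, smul_zero, norm_zero] at this
    linarith
  · by_cases hxc : x ∈ closure Ω
    · have h1 : ‖c • φ t x‖ ≤ 1 := by
        by_contra hcon
        exact hx ⟨(t, x), ⟨⟨ht, hxc⟩, (not_le.1 hcon).le⟩, rfl⟩
      rw [truncField_eq _ _ hxc, trunc_eq_zero h1, smul_zero]
    · exact if_neg hxc

/-- The inner factor c and the outer factor 1/c cancel in the chain rule, which is why the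
derivatives stay bounded uniformly in c. -/
theorem hasFDerivAt_truncField (hφ : C1Closed Ω T φ) (hΩ : IsOpen Ω) {c : ℝ} (hc : c ≠ 0)
    {z : ℝ × Sp d} (hz : z ∈ Set.Ioo 0 T ×ˢ Ω) :
    HasFDerivAt (fun z : ℝ × Sp d => truncField Ω φ c z.1 z.2)
      ((fderiv ℝ trunc (c • φ z.1 z.2)).comp
        (fderiv ℝ (fun z : ℝ × Sp d => φ z.1 z.2) z)) z := by
  have h1 := (contDiff_trunc (F := F)).differentiable one_ne_zero (c • φ z.1 z.2)
  have h2 := ((h1.hasFDerivAt.comp z ((hφ.hasFDerivAt hΩ hz).const_smul c)).const_smul c⁻¹)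
  have heq : (fun z : ℝ × Sp d => truncField Ω φ c z.1 z.2) =ᶠ[𝓝 z]
      fun z => c⁻¹ • trunc (c • φ z.1 z.2) := by
    filter_upwards [Ioo_prod_mem_nhds hΩ hz] with y hy using truncField_eq _ _ hy.2
  refine (h2.congr_of_eventuallyEq heq).congr_fderiv ?_
  rw [ContinuousLinearMap.comp_smul, smul_smul, inv_mul_cancel₀ hc, one_smul]

/-- The sequence is eventually constant: it equals φ once (k + 1)‖φ‖ ≥ 2, and it vanishes where φ
does. -/
theorem tendsto_truncField (t : ℝ) {x : Sp d} (hx : x ∈ closure Ω) :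
    Tendsto (fun k : ℕ => truncField Ω φ (k + 1) t x) atTop (𝓝 (φ t x)) := by
  by_cases h : φ t x = 0
  · have : ∀ k : ℕ, truncField Ω φ (k + 1) t x = φ t x := fun k => by
      rw [truncField_eq _ _ hx, h, smul_zero, trunc_eq_zero (by simp), smul_zero]
    simp [this]
  · have hn := norm_pos_iff.2 h
    refine tendsto_const_nhds.congr' ?_
    filter_upwards [eventually_ge_atTop ⌈2 / ‖φ t x‖⌉₊] with k hk
    have hk' : 2 / ‖φ t x‖ ≤ k := (Nat.le_ceil _).trans (by exact_mod_cast hk)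
    have hk0 : (0 : ℝ) < k + 1 := by positivity
    rw [div_le_iff₀ hn] at hk'
    rw [truncField_eq _ _ hx, trunc_eq_self, inv_smul_smul₀ hk0.ne']
    rw [norm_smul, Real.norm_of_nonneg hk0.le]
    nlinarith

theorem tendsto_fderiv_trunc {v : F} (hv : v ≠ 0) :
    Tendsto (fun k : ℕ => fderiv ℝ trunc (((k : ℝ) + 1) • v)) atTop
      (𝓝 (ContinuousLinearMap.id ℝ F)) := by
  have hn := norm_pos_iff.2 hv
  refine tendsto_const_nhds.congr' ?_
  filter_upwards [eventually_ge_atTop ⌈2 / ‖v‖⌉₊] with k hk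
  have hk' : 2 / ‖v‖ ≤ k := (Nat.le_ceil _).trans (by exact_mod_cast hk)
  have hk0 : (0 : ℝ) < k + 1 := by positivity
  rw [div_le_iff₀ hn] at hk'
  rw [fderiv_trunc_of_gt]
  rw [norm_smul, Real.norm_of_nonneg hk0.le]
  nlinarith

/-- The differentials of the truncations converge almost everywhere. -/
theorem ae_tendsto_fderiv_truncField [FiniteDimensional ℝ F] (hφ : C1Closed Ω T φ)
    (hΩ : IsOpen Ω) :
    ∀ᵐ z ∂(volume : Measure (ℝ × Sp d)).restrict (Set.Ioc 0 T ×ˢ Ω),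
      Tendsto (fun k : ℕ => fderiv ℝ (fun z : ℝ × Sp d => truncField Ω φ (k + 1) z.1 z.2) z)
        atTop (𝓝 (fderiv ℝ (fun z : ℝ × Sp d => φ z.1 z.2) z)) := by
  have : (volume : Measure (ℝ × Sp d)).IsAddHaarMeasure := by
    rw [Measure.volume_eq_prod]
    infer_instance
  have h0 := ae_restrict_of_ae (s := Set.Ioc 0 T ×ˢ Ω)
    (ae_fderiv_eq_zero_of_eq_zero (volume : Measure (ℝ × Sp d))
    (isOpen_Ioo.prod hΩ) (fun z hz => (hφ.hasFDerivAt hΩ hz).differentiableAt.differentiableWithinAt)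
    (hφ.continuousOn_fderiv hΩ))
  filter_upwards [h0, ae_Ioc_prod (T := T) (p := fun z => z ∈ Set.Ioo 0 T ×ˢ Ω) hΩ
    fun z hz => hz] with z hz hzQ
  have hk (k : ℕ) := (hasFDerivAt_truncField hφ hΩ (c := (k : ℝ) + 1) (by positivity) hzQ).fderiv
  simp_rw [hk]
  -- Where φ = 0 its differential vanishes too, outside a null set, so the limit is 0 whatever the
  -- truncation does; where φ ≠ 0 the factor from the truncation is eventually the identity.
  by_cases hv : φ z.1 z.2 = 0
  · rw [hz hzQ hv]
    simp
  · have := ((ContinuousLinearMap.compL ℝ (ℝ × Sp d) F F).flip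
      (fderiv ℝ (fun z : ℝ × Sp d => φ z.1 z.2) z)).continuous.tendsto _ |>.comp
      (tendsto_fderiv_trunc hv)
    simpa [Function.comp_def] using this

theorem exists_bound_fderiv_truncField [FiniteDimensional ℝ F] (hφ : C1Closed Ω T φ)
    (hΩ : IsOpen Ω) (hb : IsCompact (closure Ω)) :
    ∃ C : ℝ, ∀ k : ℕ, ∀ z ∈ Set.Ioo 0 T ×ˢ Ω,
      ‖fderiv ℝ (fun z : ℝ × Sp d => truncField Ω φ (k + 1) z.1 z.2) z‖ ≤ C := by
  obtain ⟨C, hC⟩ := exists_bound_fderiv_trunc (F := F)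
  obtain ⟨C', hC'⟩ := hφ.exists_bound_fderiv hΩ hb
  refine ⟨C * C', fun k z hz => ?_⟩
  rw [(hasFDerivAt_truncField hφ hΩ (c := (k : ℝ) + 1) (by positivity) hz).fderiv]
  refine (ContinuousLinearMap.opNorm_comp_le _ _).trans ?_
  have := (norm_nonneg _).trans (hC 0)
  exact mul_le_mul (hC _) (hC' z hz) (norm_nonneg _) this

end Truncation

/-! ### Linearity of the space-time integrals -/

section Integrals

variable {d : ℕ} {Ω Γ : Set (Sp d)} {T τ : ℝ} {f g : ℝ → Sp d → ℝ}

theorem VolIntegrable.add (hf : VolIntegrable Ω T f) (hg : VolIntegrable Ω T g) :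
    VolIntegrable Ω T (fun t x => f t x + g t x) := Integrable.add hf hg

theorem VolIntegrable.sub (hf : VolIntegrable Ω T f) (hg : VolIntegrable Ω T g) :
    VolIntegrable Ω T (fun t x => f t x - g t x) := Integrable.sub hf hg

theorem SurfIntegrable.add (hf : SurfIntegrable Ω Γ T f) (hg : SurfIntegrable Ω Γ T g) :
    SurfIntegrable Ω Γ T (fun t x => f t x + g t x) := Integrable.add hf hg

theorem SurfIntegrable.sub (hf : SurfIntegrable Ω Γ T f) (hg : SurfIntegrable Ω Γ T g) :
    SurfIntegrable Ω Γ T (fun t x => f t x - g t x) := Integrable.sub hf hg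

theorem volInt_add (hf : VolIntegrable Ω T f) (hg : VolIntegrable Ω T g) (hτ : τ ≤ T) :
    volInt Ω τ (fun t x => f t x + g t x) = volInt Ω τ f + volInt Ω τ g :=
  integral_add (hf.mono hτ) (hg.mono hτ)

theorem volInt_sub (hf : VolIntegrable Ω T f) (hg : VolIntegrable Ω T g) (hτ : τ ≤ T) :
    volInt Ω τ (fun t x => f t x - g t x) = volInt Ω τ f - volInt Ω τ g :=
  integral_sub (hf.mono hτ) (hg.mono hτ)

theorem volInt_congr (hΩ : IsOpen Ω) (h : ∀ z ∈ Set.Ioo 0 τ ×ˢ Ω, f z.1 z.2 = g z.1 z.2) :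
    volInt Ω τ f = volInt Ω τ g :=
  integral_congr_ae (ae_Ioc_prod hΩ h)

theorem SurfIntegrable.mono (hf : SurfIntegrable Ω Γ T f) (hτ : τ ≤ T) :
    SurfIntegrable Ω Γ τ f :=
  IntegrableOn.mono_set hf (Set.prod_mono (Set.Ioc_subset_Ioc_right hτ) le_rfl)

theorem surfInt_add (hf : SurfIntegrable Ω Γ T f) (hg : SurfIntegrable Ω Γ T g) (hτ : τ ≤ T) :
    surfInt Ω Γ τ (fun t x => f t x + g t x) = surfInt Ω Γ τ f + surfInt Ω Γ τ g :=
  integral_add (hf.mono hτ) (hg.mono hτ)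

theorem surfInt_sub (hf : SurfIntegrable Ω Γ T f) (hg : SurfIntegrable Ω Γ T g) (hτ : τ ≤ T) :
    surfInt Ω Γ τ (fun t x => f t x - g t x) = surfInt Ω Γ τ f - surfInt Ω Γ τ g :=
  integral_sub (hf.mono hτ) (hg.mono hτ)

theorem surfInt_congr (hΓ : MeasurableSet Γ)
    (h : ∀ z ∈ Set.Ioc 0 τ ×ˢ Γ, f z.1 z.2 = g z.1 z.2) : surfInt Ω Γ τ f = surfInt Ω Γ τ g :=
  setIntegral_congr_fun (measurableSet_Ioc.prod hΓ) h

theorem volIntegrable_congr {F : Type} [NormedAddCommGroup F] {f g : ℝ → Sp d → F}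
    (hΩ : IsOpen Ω) (hf : VolIntegrable Ω T f)
    (h : ∀ z ∈ Set.Ioo 0 T ×ˢ Ω, f z.1 z.2 = g z.1 z.2) : VolIntegrable Ω T g :=
  Integrable.congr hf (ae_Ioc_prod hΩ h)

theorem surfIntegrable_congr (hf : SurfIntegrable Ω Γ T f) (hΓ : MeasurableSet Γ)
    (h : ∀ z ∈ Set.Ioc 0 T ×ˢ Γ, f z.1 z.2 = g z.1 z.2) : SurfIntegrable Ω Γ T g :=
  IntegrableOn.congr_fun hf h (measurableSet_Ioc.prod hΓ)

/-- Hölder on the bounded domain bounds the spatial L¹ norm uniformly in time, and the time interval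
is finite. -/
theorem MemLinftyLp.volIntegrable {F : Type} [NormedAddCommGroup F] {p : ℝ≥0∞}
    {f : ℝ → Sp d → F} (hf : MemLinftyLp Ω T p f) (hp : 1 ≤ p) (hb : IsCompact (closure Ω)) :
    VolIntegrable Ω T f := by
  have hvol : volume Ω < ⊤ := (measure_mono subset_closure).trans_lt hb.measure_lt_top
  have : IsFiniteMeasure (volume.restrict Ω) := ⟨by rwa [Measure.restrict_apply_univ]⟩
  obtain ⟨hm, C, hC⟩ := hf
  refine ⟨hm, ?_⟩
  rw [Measure.volume_eq_prod, ← Measure.prod_restrict] at hm ⊢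
  rw [hasFiniteIntegral_iff_enorm, lintegral_prod _ hm.enorm]
  have hle : ∀ᵐ t ∂(volume.restrict (Set.Ioc 0 T)), ∫⁻ x in Ω, ‖f t x‖ₑ
      ≤ C * (volume.restrict Ω) Set.univ ^ (1 / (1 : ℝ≥0∞).toReal - 1 / p.toReal) := by
    filter_upwards [hC, hm.prodMk_left] with t ht hmt
    rw [← eLpNorm_one_eq_lintegral_enorm]
    exact (eLpNorm_le_eLpNorm_mul_rpow_measure_univ hp hmt).trans (by gcongr)
  refine (lintegral_mono_ae hle).trans_lt ?_
  rw [lintegral_const, Measure.restrict_apply_univ]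
  refine ENNReal.mul_lt_top (ENNReal.mul_lt_top ENNReal.coe_lt_top ?_) (by simp)
  have hexp : 0 ≤ 1 / (1 : ℝ≥0∞).toReal - 1 / p.toReal := by
    rcases eq_or_ne p ⊤ with rfl | hpt
    · simp
    · have : 1 ≤ p.toReal := by simpa using ENNReal.toReal_mono hpt hp
      simpa using inv_le_one_of_one_le₀ this
  exact ENNReal.rpow_lt_top_of_nonneg hexp (by simpa using hvol.ne)

theorem VolIntegrable.ae_slice {F : Type} [NormedAddCommGroup F] {f : ℝ → Sp d → F}
    (hf : VolIntegrable Ω T f) :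
    ∀ᵐ t ∂(volume.restrict (Set.Icc 0 T)), IntegrableOn (f t) Ω := by
  have h : Integrable (fun z : ℝ × Sp d => f z.1 z.2)
      ((volume.restrict (Set.Ioc 0 T)).prod (volume.restrict Ω)) := by
    rw [Measure.prod_restrict, ← Measure.volume_eq_prod]
    exact hf
  rw [← restrict_Ioc_eq_restrict_Icc]
  exact h.prod_right_ae

end Integrals

/-! ### Space-time integrability of the fields of a weak solution. -/

namespace IsWeakSolution

variable {d : ℕ} {P : FluidProblem d} {w : Fields d} {τ : ℝ}

theorem volIntegrable_rho (hw : IsWeakSolution P w) : VolIntegrable P.Ω P.T w.ρ := by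
  obtain ⟨γ, hγ, h, -⟩ := hw.class_rho
  exact h.volIntegrable (by simpa using hγ.le) P.isCompact_closure

theorem volIntegrable_momentum (hw : IsWeakSolution P w) :
    VolIntegrable P.Ω P.T (fun t x => w.ρ t x • w.u t x) := by
  obtain ⟨γ, hγ, -, h⟩ := hw.class_rho
  refine h.volIntegrable ?_ P.isCompact_closure
  rw [ENNReal.one_le_ofReal, le_div_iff₀ (by linarith)]
  linarith

theorem volIntegrable_S (hw : IsWeakSolution P w) : VolIntegrable P.Ω P.T (w.S P) :=
  hw.class_S.volIntegrable le_rfl P.isCompact_closure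

/-- Since |u ⊗ u| ≤ |u|², the kinetic energy dominates; measurability comes from the regularity
classes of ρ and u. -/
theorem volIntegrable_tensor (hw : IsWeakSolution P w) :
    VolIntegrable P.Ω P.T (fun t x => w.ρ t x • tensor (w.u t x)) := by
  obtain ⟨γ, -, ⟨hρ, -⟩, -⟩ := hw.class_rho
  obtain ⟨q, -, ⟨⟨hu, -⟩, -⟩, -⟩ := hw.class_u
  refine Integrable.mono hw.kinetic_integrable
    (hρ.smul (continuous_tensor.comp_aestronglyMeasurable hu)) (Eventually.of_forall fun z => ?_)
  simp only [norm_smul, norm_mul, norm_pow, norm_norm]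
  gcongr
  exact norm_tensor_le _

end IsWeakSolution

/-! ### The momentum equation for test fields vanishing on the boundary. -/

namespace Fields

variable {d : ℕ} (P : FluidProblem d) (w : Fields d)

/-- The momentum flux `ρ u ⊗ u + p 𝕀 - 𝕊`. -/
noncomputable def flux (t : ℝ) (x : Sp d) : Sp d →L[ℝ] Sp d :=
  w.ρ t x • tensor (w.u t x) + w.pr P t x • ContinuousLinearMap.id ℝ (Sp d) - w.stress P t x

theorem contract_flux (t : ℝ) (x : Sp d) (A : Sp d →L[ℝ] Sp d) :
    contract (w.flux P t x) A = w.ρ t x * ⟪w.u t x, A (w.u t x)⟫ + w.pr P t x * tr A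
      - contract (w.stress P t x) A := by
  simp only [← contractL_apply, flux, map_sub, map_add, map_smul, sub_apply, add_apply, smul_apply,
    smul_eq_mul]
  simp only [contractL_apply, contract_tensor, contract_id]

end Fields

namespace IsWeakSolution

variable {d : ℕ} {P : FluidProblem d} {w : Fields d} {τ : ℝ}

theorem volIntegrable_flux (hw : IsWeakSolution P w) : VolIntegrable P.Ω P.T (w.flux P) :=
  (Integrable.add hw.volIntegrable_tensor (hw.pressure_integrable.smul_const _)).sub
    hw.stress_integrable

theorem volIntegrable_rho_smul (hw : IsWeakSolution P w) {V : Sp d → Sp d}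
    (hV : ContinuousOn V (closure P.Ω)) :
    VolIntegrable P.Ω P.T (fun t x => w.ρ t x • V x) := by
  have hm : MemLp (fun z : ℝ × Sp d => V z.2) ⊤
      ((volume : Measure (ℝ × Sp d)).restrict (Set.Ioc 0 P.T ×ˢ P.Ω)) :=
    (hV.comp (s := Set.Icc 0 P.T ×ˢ closure P.Ω) continuous_snd.continuousOn
      fun z hz => hz.2).memLp_top_of_isCompact
      (isCompact_Icc.prod P.isCompact_closure)
      (Set.prod_mono Set.Ioc_subset_Icc_self subset_closure) _
  exact integrable_bilin (ContinuousLinearMap.lsmul ℝ ℝ) hw.volIntegrable_rho hm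

theorem volIntegrable_inner_dt (hw : IsWeakSolution P w) {φ : ℝ → Sp d → Sp d}
    (hφ : C1Closed P.Ω P.T φ) :
    VolIntegrable P.Ω P.T (fun t x => ⟪w.ρ t x • w.u t x, dt φ t x⟫) :=
  integrable_bilin (innerL d) hw.volIntegrable_momentum
    (hφ.memLp_dt P.domain.isOpen P.isCompact_closure)

theorem volIntegrable_contract {M : ℝ → Sp d → Sp d →L[ℝ] Sp d} (hM : VolIntegrable P.Ω P.T M)
    {φ : ℝ → Sp d → Sp d} (hφ : C1Closed P.Ω P.T φ) :
    VolIntegrable P.Ω P.T (fun t x => contract (M t x) (fderiv ℝ (φ t) x)) := by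
  simp_rw [← contractL_apply]
  exact integrable_bilin (contractL d) hM (hφ.memLp_fderiv P.domain.isOpen P.isCompact_closure)

theorem volIntegrable_inner {m : ℝ → Sp d → Sp d} (hm : VolIntegrable P.Ω P.T m)
    {φ : ℝ → Sp d → Sp d} (hφ : C1Closed P.Ω P.T φ) :
    VolIntegrable P.Ω P.T (fun t x => ⟪m t x, φ t x⟫) :=
  integrable_bilin (innerL d) hm (hφ.memLp P.isCompact_closure)

/-- Convection, pressure and stress are gathered in the single matrix `flux`, so that each integral
pairs one integrable field linearly with the test field or a derivative of it, ready for dominated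
convergence. -/
theorem momentum_of_compact_support (hw : IsWeakSolution P w) {φ : ℝ → Sp d → Sp d}
    (hφ : C1Closed P.Ω P.T φ)
    (hK : ∃ K : Set (Sp d), IsCompact K ∧ K ⊆ P.Ω ∧ ∀ t ∈ Set.Icc 0 P.T, ∀ x ∉ K, φ t x = 0)
    (hτ : τ ∈ Set.Icc 0 P.T) :
    (∫ x in P.Ω, ⟪w.ρ τ x • w.u τ x, φ τ x⟫) - (∫ x in P.Ω, ⟪w.ρ 0 x • w.u 0 x, φ 0 x⟫)
      = volInt P.Ω τ (fun t x => ⟪w.ρ t x • w.u t x, dt φ t x⟫)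
        + volInt P.Ω τ (fun t x => contract (w.flux P t x) (fderiv ℝ (φ t) x))
        + volInt P.Ω τ (fun t x => ⟪w.ρ t x • P.g x, φ t x⟫) := by
  have hS := volIntegrable_contract hw.stress_integrable hφ
  have hM := volIntegrable_contract hw.volIntegrable_flux hφ
  have hD := hw.volIntegrable_inner_dt hφ
  have h1 : (fun t x => w.ρ t x * ⟪w.u t x, dt φ t x⟫
        + w.ρ t x * ⟪w.u t x, fderiv ℝ (φ t) x (w.u t x)⟫
        + w.pr P t x * tr (fderiv ℝ (φ t) x))
      = fun t x => (⟪w.ρ t x • w.u t x, dt φ t x⟫ + contract (w.flux P t x) (fderiv ℝ (φ t) x))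
        + contract (w.stress P t x) (fderiv ℝ (φ t) x) := by
    funext t x
    rw [w.contract_flux P, real_inner_smul_left]
    ring
  rw [hw.momentum φ hφ hK τ hτ, h1, volInt_add (hD.add hM) hS hτ.2,
    volInt_add hD hM hτ.2]
  simp_rw [real_inner_smul_left]
  ring

/-- The momentum equation for test functions that merely vanish on the boundary. -/
theorem momentum_of_eq_zero_on_frontier (hw : IsWeakSolution P w) {φ : ℝ → Sp d → Sp d}
    (hφ : C1Closed P.Ω P.T φ) (h0 : ∀ t ∈ Set.Icc 0 P.T, ∀ x ∈ frontier P.Ω, φ t x = 0)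
    (hτ : τ ∈ Set.Icc 0 P.T) :
    (∫ x in P.Ω, ⟪w.ρ τ x • w.u τ x, φ τ x⟫) - (∫ x in P.Ω, ⟪w.ρ 0 x • w.u 0 x, φ 0 x⟫)
      = volInt P.Ω τ (fun t x => ⟪w.ρ t x • w.u t x, dt φ t x⟫)
        + volInt P.Ω τ (fun t x => contract (w.flux P t x) (fderiv ℝ (φ t) x))
        + volInt P.Ω τ (fun t x => ⟪w.ρ t x • P.g x, φ t x⟫) := by
  have hΩ := P.domain.isOpen
  have hb := P.isCompact_closure
  -- The truncation level is 1/(k + 1); the shift avoids the factor 0 at k = 0.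
  let φk : ℕ → ℝ → Sp d → Sp d := fun k => truncField P.Ω φ (k + 1)
  have hφk : ∀ k, C1Closed P.Ω P.T (φk k) := fun k => hφ.truncField _
  have hle : (volume : Measure (ℝ × Sp d)).restrict (Set.Ioc 0 τ ×ˢ P.Ω)
      ≤ volume.restrict (Set.Ioc 0 P.T ×ˢ P.Ω) :=
    Measure.restrict_mono (Set.prod_mono (Set.Ioc_subset_Ioc_right hτ.2) le_rfl) le_rfl
  obtain ⟨C, hC⟩ := exists_bound_fderiv_truncField hφ hΩ hb
  have hQ : ∀ᵐ z ∂(volume : Measure (ℝ × Sp d)).restrict (Set.Ioc 0 P.T ×ˢ P.Ω),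
      z ∈ Set.Ioo 0 P.T ×ˢ P.Ω := ae_Ioc_prod hΩ fun z hz => hz
  have hlim := ae_tendsto_fderiv_truncField hφ hΩ
  have hslice : ∀ s ∈ Set.Icc 0 P.T, Tendsto
      (fun k => ∫ x in P.Ω, ⟪w.ρ s x • w.u s x, φk k s x⟫) atTop
      (𝓝 (∫ x in P.Ω, ⟪w.ρ s x • w.u s x, φ s x⟫)) := by
    intro s hs
    obtain ⟨C', hC'⟩ := hb.exists_bound_of_continuousOn (hφ.continuousOn_slice hs)
    refine tendsto_integral_bilin (innerL d) (hw.momentum_integrable s hs)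
      (fun k => ((hφk k).memLp_slice hb hs).1) (C := C') (fun k => ?_) ?_
    · exact ae_restrict_of_forall_mem P.measurableSet_Ω fun x hx =>
        (norm_truncField_le (by positivity) s (subset_closure hx)).trans (hC' x (subset_closure hx))
    · exact ae_restrict_of_forall_mem P.measurableSet_Ω fun x hx =>
        tendsto_truncField s (subset_closure hx)
  have hdt : Tendsto (fun k => volInt P.Ω τ (fun t x => ⟪w.ρ t x • w.u t x, dt (φk k) t x⟫)) atTop
      (𝓝 (volInt P.Ω τ (fun t x => ⟪w.ρ t x • w.u t x, dt φ t x⟫))) := by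
    refine tendsto_integral_bilin (innerL d) (hw.volIntegrable_momentum.mono hτ.2)
      (fun k => (((hφk k).memLp_dt hΩ hb).1.mono_measure hle))
      (C := C * ‖((1, 0) : ℝ × Sp d)‖) (fun k => ae_mono hle ?_) (ae_mono hle ?_)
    · filter_upwards [hQ] with z hz
      rw [(hφk k).dt_eq hΩ hz]
      exact (ContinuousLinearMap.le_opNorm _ _).trans (by gcongr; exact hC k z hz)
    · filter_upwards [hQ, hlim] with z hz hlz
      have h := ((ContinuousLinearMap.apply ℝ (Sp d) ((1, 0) : ℝ × Sp d)).continuous.tendsto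
        _).comp hlz
      rw [hφ.dt_eq hΩ hz]
      refine h.congr fun k => ?_
      rw [(hφk k).dt_eq hΩ hz]
      rfl
  have hDφ : Tendsto (fun k => volInt P.Ω τ
        (fun t x => contract (w.flux P t x) (fderiv ℝ (φk k t) x))) atTop
      (𝓝 (volInt P.Ω τ (fun t x => contract (w.flux P t x) (fderiv ℝ (φ t) x)))) := by
    simp_rw [← contractL_apply]
    refine tendsto_integral_bilin (contractL d) (hw.volIntegrable_flux.mono hτ.2)
      (fun k => (((hφk k).memLp_fderiv hΩ hb).1.mono_measure hle))
      (C := C * ‖ContinuousLinearMap.inr ℝ ℝ (Sp d)‖) (fun k => ae_mono hle ?_) (ae_mono hle ?_)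
    · filter_upwards [hQ] with z hz
      rw [(hφk k).fderiv_eq hΩ hz]
      exact (ContinuousLinearMap.opNorm_comp_le _ _).trans (by gcongr; exact hC k z hz)
    · filter_upwards [hQ, hlim] with z hz hlz
      have h := (((ContinuousLinearMap.compL ℝ (Sp d) (ℝ × Sp d) (Sp d)).flip
        (ContinuousLinearMap.inr ℝ ℝ (Sp d))).continuous.tendsto _).comp hlz
      rw [hφ.fderiv_eq hΩ hz]
      refine h.congr fun k => ?_
      rw [(hφk k).fderiv_eq hΩ hz]
      rfl
  have hg : Tendsto (fun k => volInt P.Ω τ (fun t x => ⟪w.ρ t x • P.g x, φk k t x⟫)) atTop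
      (𝓝 (volInt P.Ω τ (fun t x => ⟪w.ρ t x • P.g x, φ t x⟫))) := by
    obtain ⟨C', hC'⟩ := (isCompact_Icc.prod hb).exists_bound_of_continuousOn
      (ContDiffOn.continuousOn hφ)
    refine tendsto_integral_bilin (innerL d)
      ((hw.volIntegrable_rho_smul P.g_continuous).mono hτ.2)
      (fun k => (((hφk k).memLp hb).1.mono_measure hle)) (C := C')
      (fun k => ae_mono hle ?_) (ae_mono hle ?_)
    · filter_upwards [hQ] with z hz
      exact (norm_truncField_le (by positivity) z.1 (subset_closure hz.2)).trans
        (hC' z ⟨Set.Ioo_subset_Icc_self hz.1, subset_closure hz.2⟩)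
    · filter_upwards [hQ] with z hz using tendsto_truncField z.1 (subset_closure hz.2)
  -- The compactly supported `φk` satisfy the equation for every k, so the limits of its two sides
  -- coincide.
  refine tendsto_nhds_unique ((hslice τ hτ).sub (hslice 0 ⟨le_rfl, P.T_pos.le⟩)) ?_
  refine ((hdt.add hDφ).add hg).congr fun k => ?_
  exact (hw.momentum_of_compact_support (hφk k)
    (exists_isCompact_truncField hφ hb hΩ h0 _) hτ).symm

end IsWeakSolution

/-! ### The chemical potential and the test functions built from it. -/

namespace ThermoLaw

variable (L : ThermoLaw) {ρ θ : ℝ}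

theorem contDiffOn_chemPot :
    ContDiffOn ℝ 1 (fun z : ℝ × ℝ => L.chemPot z.1 z.2) (Set.Ioi 0 ×ˢ Set.Ioi 0) :=
  (L.e_contDiff.sub (contDiffOn_snd.mul L.s_contDiff)).add
    (L.p_contDiff.div contDiffOn_fst fun _ hz => (ne_of_gt hz.1))

/-- Gibbs' equation for the chemical potential: `Dμ = Dp / ρ - s Dθ`. -/
theorem hasFDerivAt_chemPot (hρ : 0 < ρ) (hθ : 0 < θ) :
    HasFDerivAt (fun z : ℝ × ℝ => L.chemPot z.1 z.2)
      (ρ⁻¹ • fderiv ℝ (fun z : ℝ × ℝ => L.p z.1 z.2) (ρ, θ)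
        - L.s ρ θ • ContinuousLinearMap.snd ℝ ℝ ℝ) (ρ, θ) := by
  have hp := (hasStrictFDerivAt_of_contDiffOn_quadrant L.p_contDiff hρ hθ).hasFDerivAt
  have he := (hasStrictFDerivAt_of_contDiffOn_quadrant L.e_contDiff hρ hθ).hasFDerivAt
  have hs := (hasStrictFDerivAt_of_contDiffOn_quadrant L.s_contDiff hρ hθ).hasFDerivAt
  have h1 : HasFDerivAt (fun z : ℝ × ℝ => z.1) (ContinuousLinearMap.fst ℝ ℝ ℝ) (ρ, θ) :=
    hasFDerivAt_fst
  have h2 : HasFDerivAt (fun z : ℝ × ℝ => z.2) (ContinuousLinearMap.snd ℝ ℝ ℝ) (ρ, θ) :=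
    hasFDerivAt_snd
  have hinv := (hasDerivAt_inv hρ.ne').comp_hasFDerivAt (ρ, θ) h1
  have h := (he.sub (h2.mul hs)).add (hp.mul hinv)
  rw [hp.fderiv]
  refine (h.congr_of_eventuallyEq (.of_forall fun z => ?_)).congr_fderiv ?_
  · simp [chemPot, div_eq_mul_inv]
  · have g1 := L.gibbs_rho_eq hρ hθ
    have g2 := L.gibbs_theta ρ θ hρ hθ
    ext
    · simp
      field_simp
      field_simp at g1
      linear_combination (-1 : ℝ) * g1
    · simp
      linear_combination (-1 : ℝ) * g2

end ThermoLaw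

theorem inner_gradient {d : ℕ} (f : Sp d → ℝ) (x v : Sp d) :
    ⟪v, gradient f x⟫ = fderiv ℝ f x v := by
  rw [real_inner_comm]
  simp [gradient]

/-- The function `e - θ s + p / ρ` evaluated at the comparison functions. -/
noncomputable def chemTilde {d : ℕ} (P : FluidProblem d) (r Θ : ℝ → Sp d → ℝ) (t : ℝ) (x : Sp d) :
    ℝ := P.law.chemPot (r t x) (Θ t x)

/-- The test function for the equation of continuity. -/
noncomputable def continuityTest {d : ℕ} (P : FluidProblem d) (r : ℝ → Sp d → ℝ)
    (U : ℝ → Sp d → Sp d) (Θ : ℝ → Sp d → ℝ) (t : ℝ) (x : Sp d) : ℝ :=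
  1 / 2 * (‖U t x‖ ^ 2 - ‖P.uB x‖ ^ 2) - chemTilde P r Θ t x

namespace FluidProblem

variable {d : ℕ} (P : FluidProblem d)

theorem uB_C1 : C1Closed P.Ω P.T (fun _ => P.uB) :=
  ((P.uB_contDiff.of_le (by norm_num)).comp contDiffOn_snd fun _ hz => hz.2)

theorem uB_sq_C1 : C1Closed P.Ω P.T (fun _ x => ‖P.uB x‖ ^ 2) :=
  ContDiffOn.norm_sq ℝ P.uB_C1

theorem rhoB_C1 : C1Closed P.Ω P.T (fun _ => P.rhoB) :=
  (P.rhoB_contDiff.comp contDiffOn_snd fun _ hz => hz.2)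

end FluidProblem

/-! ### Derivatives and boundary values of the test functions. -/

namespace IsTestTrio

variable {d : ℕ} {P : FluidProblem d} {r : ℝ → Sp d → ℝ} {U : ℝ → Sp d → Sp d}
  {Θ : ℝ → Sp d → ℝ} {t : ℝ} {x : Sp d} {z : ℝ × Sp d}

theorem r_pos (hT : IsTestTrio P r U Θ) (ht : t ∈ Set.Icc 0 P.T) (hx : x ∈ closure P.Ω) :
    0 < r t x := by
  obtain ⟨a, b, ha, h⟩ := hT.r_bounds
  exact ha.trans_le (h t ht x hx).1

theorem Θ_pos (hT : IsTestTrio P r U Θ) (ht : t ∈ Set.Icc 0 P.T) (hx : x ∈ closure P.Ω) :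
    0 < Θ t x := by
  obtain ⟨a, b, ha, h⟩ := hT.Θ_bounds
  exact ha.trans_le (h t ht x hx).1

theorem comp_C1 (hT : IsTestTrio P r U Θ) {f : ℝ → ℝ → ℝ}
    (hf : ContDiffOn ℝ 1 (fun z : ℝ × ℝ => f z.1 z.2) (Set.Ioi 0 ×ˢ Set.Ioi 0)) :
    C1Closed P.Ω P.T (fun t x => f (r t x) (Θ t x)) :=
  hf.comp (ContDiffOn.prodMk hT.r_C1 hT.Θ_C1) fun _ hz =>
    ⟨hT.r_pos hz.1 hz.2, hT.Θ_pos hz.1 hz.2⟩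

theorem p_C1 (hT : IsTestTrio P r U Θ) : C1Closed P.Ω P.T (pTilde P r Θ) :=
  hT.comp_C1 P.law.p_contDiff

theorem s_C1 (hT : IsTestTrio P r U Θ) : C1Closed P.Ω P.T (sTilde P r Θ) :=
  hT.comp_C1 P.law.s_contDiff

theorem chem_C1 (hT : IsTestTrio P r U Θ) : C1Closed P.Ω P.T (chemTilde P r Θ) :=
  hT.comp_C1 P.law.contDiffOn_chemPot

theorem r_inv_C1 (hT : IsTestTrio P r U Θ) : C1Closed P.Ω P.T (fun t x => (r t x)⁻¹) :=
  ContDiffOn.inv hT.r_C1 fun _ hz => (hT.r_pos hz.1 hz.2).ne'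

theorem velocityTest_C1 (hT : IsTestTrio P r U Θ) :
    C1Closed P.Ω P.T (fun t x => P.uB x - U t x) :=
  ContDiffOn.sub P.uB_C1 hT.U_C1

theorem continuityTest_C1 (hT : IsTestTrio P r U Θ) :
    C1Closed P.Ω P.T (continuityTest P r U Θ) :=
  (contDiffOn_const.mul ((ContDiffOn.norm_sq ℝ hT.U_C1).sub P.uB_sq_C1)).sub hT.chem_C1

/-- The kinetic parts cancel because U = u_b, so the boundary fluxes of mass are weighted by the
chemical potential alone. -/
theorem continuityTest_frontier (hT : IsTestTrio P r U Θ) (ht : t ∈ Set.Icc 0 P.T)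
    (hx : x ∈ frontier P.Ω) : continuityTest P r U Θ t x = -chemTilde P r Θ t x := by
  simp [continuityTest, hT.U_boundary t ht x hx]

theorem mem_domain (hz : z ∈ Set.Ioo 0 P.T ×ˢ P.Ω) :
    z.1 ∈ Set.Icc 0 P.T ∧ z.2 ∈ closure P.Ω :=
  ⟨Set.Ioo_subset_Icc_self hz.1, subset_closure hz.2⟩

/-- The Gibbs relation Dμ = Dp/ρ - s Dθ pulled back along (r, Θ). It removes the derivatives of ẽ
and s̃ and brings in those of p̃ and Θ. -/
theorem fderiv_chem (hT : IsTestTrio P r U Θ) (hz : z ∈ Set.Ioo 0 P.T ×ˢ P.Ω) :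
    fderiv ℝ (fun z : ℝ × Sp d => chemTilde P r Θ z.1 z.2) z
      = (r z.1 z.2)⁻¹ • fderiv ℝ (fun z : ℝ × Sp d => pTilde P r Θ z.1 z.2) z
        - sTilde P r Θ z.1 z.2 • fderiv ℝ (fun z : ℝ × Sp d => Θ z.1 z.2) z := by
  have hr := hT.r_pos (mem_domain hz).1 (mem_domain hz).2
  have hΘ := hT.Θ_pos (mem_domain hz).1 (mem_domain hz).2
  have hpair := (hT.r_C1.hasFDerivAt P.domain.isOpen hz).prodMk
    (hT.Θ_C1.hasFDerivAt P.domain.isOpen hz)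
  have hp : HasFDerivAt (fun z : ℝ × ℝ => P.law.p z.1 z.2)
      (fderiv ℝ (fun z : ℝ × ℝ => P.law.p z.1 z.2) (r z.1 z.2, Θ z.1 z.2))
      (r z.1 z.2, Θ z.1 z.2) :=
    (hasStrictFDerivAt_of_contDiffOn_quadrant P.law.p_contDiff hr hΘ).hasFDerivAt.differentiableAt.hasFDerivAt
  have h1 := HasFDerivAt.comp (g := fun z : ℝ × ℝ => P.law.p z.1 z.2)
    (f := fun z : ℝ × Sp d => (r z.1 z.2, Θ z.1 z.2)) z hp hpair
  have h2 := HasFDerivAt.comp (g := fun z : ℝ × ℝ => P.law.chemPot z.1 z.2)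
    (f := fun z : ℝ × Sp d => (r z.1 z.2, Θ z.1 z.2)) z (P.law.hasFDerivAt_chemPot hr hΘ) hpair
  have e1 : fderiv ℝ (fun z : ℝ × Sp d => pTilde P r Θ z.1 z.2) z = _ := h1.fderiv
  have e2 : fderiv ℝ (fun z : ℝ × Sp d => chemTilde P r Θ z.1 z.2) z = _ := h2.fderiv
  rw [e1, e2]
  ext v <;> simp [sTilde]

theorem dt_continuityTest (hT : IsTestTrio P r U Θ) (hz : z ∈ Set.Ioo 0 P.T ×ˢ P.Ω) :
    dt (continuityTest P r U Θ) z.1 z.2 = ⟪U z.1 z.2, dt U z.1 z.2⟫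
      + sTilde P r Θ z.1 z.2 * dt Θ z.1 z.2 - (r z.1 z.2)⁻¹ * dt (pTilde P r Θ) z.1 z.2 := by
  have hΩ := P.domain.isOpen
  have h1 := (hT.U_C1.hasDerivAt_dt hΩ hz).norm_sq
  have h2 := hT.chem_C1.hasDerivAt_dt hΩ hz
  have h3 : HasDerivAt (fun s => continuityTest P r U Θ s z.2) _ z.1 :=
    ((h1.sub_const (‖P.uB z.2‖ ^ 2)).const_mul (1 / 2)).sub h2
  have h4 : dt (continuityTest P r U Θ) z.1 z.2 = _ := h3.deriv
  rw [h4, hT.chem_C1.dt_eq hΩ hz, hT.fderiv_chem hz, hT.p_C1.dt_eq hΩ hz, hT.Θ_C1.dt_eq hΩ hz]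
  simp only [sub_apply, smul_apply, smul_eq_mul]
  ring

theorem fderiv_continuityTest (hT : IsTestTrio P r U Θ) (hz : z ∈ Set.Ioo 0 P.T ×ˢ P.Ω)
    (v : Sp d) :
    fderiv ℝ (continuityTest P r U Θ z.1) z.2 v
      = ⟪U z.1 z.2, fderiv ℝ (U z.1) z.2 v⟫ - ⟪P.uB z.2, fderiv ℝ P.uB z.2 v⟫
        + sTilde P r Θ z.1 z.2 * fderiv ℝ (Θ z.1) z.2 v
        - (r z.1 z.2)⁻¹ * fderiv ℝ (pTilde P r Θ z.1) z.2 v := by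
  have hΩ := P.domain.isOpen
  have h1 := (hT.U_C1.hasFDerivAt_fderiv hΩ hz).norm_sq
  have h1' := (P.uB_C1.hasFDerivAt_fderiv hΩ hz).norm_sq
  have h2 := hT.chem_C1.hasFDerivAt_fderiv hΩ hz
  have h3 : HasFDerivAt (continuityTest P r U Θ z.1) _ z.2 :=
    ((h1.sub h1').const_mul (1 / 2)).sub h2
  rw [h3.fderiv, hT.chem_C1.fderiv_eq hΩ hz, hT.fderiv_chem hz, hT.p_C1.fderiv_eq hΩ hz,
    hT.Θ_C1.fderiv_eq hΩ hz]
  simp only [sub_apply, smul_apply, smul_eq_mul, ContinuousLinearMap.comp_apply,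
    innerSL_apply_apply, nsmul_eq_mul, Nat.cast_ofNat]
  ring

theorem dt_velocityTest (hT : IsTestTrio P r U Θ) (hz : z ∈ Set.Ioo 0 P.T ×ˢ P.Ω) :
    dt (fun t x => P.uB x - U t x) z.1 z.2 = -dt U z.1 z.2 :=
  ((hT.U_C1.hasDerivAt_dt P.domain.isOpen hz).const_sub (P.uB z.2)).deriv

theorem fderiv_velocityTest (hT : IsTestTrio P r U Θ) (hz : z ∈ Set.Ioo 0 P.T ×ˢ P.Ω) :
    fderiv ℝ (fun x => P.uB x - U z.1 x) z.2 = fderiv ℝ P.uB z.2 - fderiv ℝ (U z.1) z.2 :=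
  ((P.uB_C1.hasFDerivAt_fderiv P.domain.isOpen hz).sub
    (hT.U_C1.hasFDerivAt_fderiv P.domain.isOpen hz)).fderiv

theorem fderiv_uB_sq (hz : z ∈ Set.Ioo 0 P.T ×ˢ P.Ω) (v : Sp d) :
    fderiv ℝ (fun y => ‖P.uB y‖ ^ 2) z.2 v = 2 * ⟪P.uB z.2, fderiv ℝ P.uB z.2 v⟫ := by
  rw [(P.uB_C1.hasFDerivAt_fderiv P.domain.isOpen hz).norm_sq.fderiv]
  simp

/-- The relative energy in terms of the quantities controlled by the weak formulation. -/
theorem relE_eq (hT : IsTestTrio P r U Θ) (w : Fields d) (ht : t ∈ Set.Icc 0 P.T)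
    (hx : x ∈ closure P.Ω) :
    relE P w r U Θ t x = w.energy P t x + ⟪w.ρ t x • w.u t x, P.uB x - U t x⟫
      + w.ρ t x * continuityTest P r U Θ t x - w.S P t x * Θ t x + pTilde P r Θ t x := by
  -- The rest is ½ρ|u - U|² = ½ρ|u - u_b|² + ρu·(u_b - U) + ½ρ(|U|² - |u_b|²).
  rw [relE, P.law.relEnergy_eq (hT.r_pos ht hx) (hT.Θ_pos ht hx)]
  simp only [Fields.energy, Fields.S, continuityTest, chemTilde, pTilde, norm_sub_sq_real,
    inner_sub_right, real_inner_smul_left]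
  ring

end IsTestTrio

/-! ### Essentially bounded coefficients. -/

section Bounded

variable {d : ℕ} {Ω : Set (Sp d)} {T : ℝ}

theorem memLp_top_bilin {α : Type*} [MeasurableSpace α] {μ : Measure α}
    {E F G : Type*} [NormedAddCommGroup E] [NormedSpace ℝ E] [NormedAddCommGroup F]
    [NormedSpace ℝ F] [NormedAddCommGroup G] [NormedSpace ℝ G] (B : E →L[ℝ] F →L[ℝ] G)
    {f : α → E} {g : α → F} (hf : MemLp f ⊤ μ) (hg : MemLp g ⊤ μ) :
    MemLp (fun z => B (f z) (g z)) ⊤ μ :=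
  MemLp.of_bilin (fun x y => B x y) ‖B‖₊ hf hg (B.aestronglyMeasurable_comp₂ hf.1 hg.1)
    (Eventually.of_forall fun z => B.le_opNorm₂ (f z) (g z))

theorem C1Closed.memLp_gradient {f : ℝ → Sp d → ℝ} (hf : C1Closed Ω T f) (hΩ : IsOpen Ω)
    (hb : IsCompact (closure Ω)) :
    MemLp (fun z : ℝ × Sp d => gradient (f z.1) z.2) ⊤
      ((volume : Measure (ℝ × Sp d)).restrict (Set.Ioc 0 T ×ˢ Ω)) := by
  have h := hf.memLp_fderiv hΩ hb
  refine h.of_le ((InnerProductSpace.toDual ℝ (Sp d)).symm.continuous.comp_aestronglyMeasurable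
    h.1) (Eventually.of_forall fun z => ?_)
  simp [gradient]

theorem FluidProblem.memLp_space (P : FluidProblem d) {F : Type} [NormedAddCommGroup F]
    {V : Sp d → F} (hV : ContinuousOn V (closure P.Ω)) :
    MemLp (fun z : ℝ × Sp d => V z.2) ⊤
      ((volume : Measure (ℝ × Sp d)).restrict (Set.Ioc 0 P.T ×ˢ P.Ω)) :=
  (hV.comp (s := Set.Icc 0 P.T ×ˢ closure P.Ω) continuous_snd.continuousOn
    fun _ hz => hz.2).memLp_top_of_isCompact (isCompact_Icc.prod P.isCompact_closure)
    (Set.prod_mono Set.Ioc_subset_Icc_self subset_closure) _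

end Bounded

/-! ### Integrability of the boundary data. -/

namespace FluidProblem

variable {d : ℕ} (P : FluidProblem d) {Γ : Set (Sp d)}

theorem Γin_subset : P.Γin ⊆ closure P.Ω := fun _ hx => frontier_subset_closure hx.1

theorem Γout_subset : P.Γout ⊆ closure P.Ω := fun _ hx => frontier_subset_closure hx.1

/-- A continuous function on the compact frontier is bounded, and the surface measure is finite. -/
theorem surfIntegrable_uBn (hd : 0 < d) : SurfIntegrable P.Ω P.Γin P.T (fun _ x => P.uBn x) := by
  have := isFiniteMeasure_surfaceMeasure hd P.domain
  have hfin : IsFiniteMeasure (((volume : Measure ℝ).prod (surfaceMeasure P.Ω)).restrict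
      (Set.Ioc 0 P.T ×ˢ P.Γin)) := by
    rw [← Measure.prod_restrict]
    infer_instance
  have h : MemLp (fun z : ℝ × Sp d => P.uBn z.2) ⊤
      (((volume : Measure ℝ).prod (surfaceMeasure P.Ω)).restrict (Set.Ioc 0 P.T ×ˢ P.Γin)) :=
    (P.continuousOn_uBn.comp (s := Set.Icc 0 P.T ×ˢ frontier P.Ω) continuous_snd.continuousOn
      fun _ hz => hz.2).memLp_top_of_isCompact (isCompact_Icc.prod P.isCompact_frontier)
      (Set.prod_mono Set.Ioc_subset_Icc_self fun _ hx => hx.1) _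
  exact h.integrable le_top

theorem surfIntegrable_mul {φ f : ℝ → Sp d → ℝ} (hφ : C1Closed P.Ω P.T φ)
    (hΓ : Γ ⊆ closure P.Ω) (hf : SurfIntegrable P.Ω Γ P.T f) :
    SurfIntegrable P.Ω Γ P.T (fun t x => φ t x * f t x) :=
  integrable_bilin (ContinuousLinearMap.mul ℝ ℝ).flip hf
    (hφ.memLp_boundary P.isCompact_closure hΓ _)

theorem surfIntegrable_Fib (hd : 0 < d) : SurfIntegrable P.Ω P.Γin P.T (fun _ x => P.Fib x) := by
  have := isFiniteMeasure_surfaceMeasure hd P.domain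
  have hfin : IsFiniteMeasure (((volume : Measure ℝ).prod (surfaceMeasure P.Ω)).restrict
      (Set.Ioc 0 P.T ×ˢ P.Γin)) := by
    rw [← Measure.prod_restrict]
    infer_instance
  have h : MemLp (fun z : ℝ × Sp d => P.Fib z.2) ⊤
      (((volume : Measure ℝ).prod (surfaceMeasure P.Ω)).restrict (Set.Ioc 0 P.T ×ˢ P.Γin)) :=
    (P.Fib_continuous.comp (s := Set.Icc 0 P.T ×ˢ closure P.Ω) continuous_snd.continuousOn
      fun _ hz => hz.2).memLp_top_of_isCompact (isCompact_Icc.prod P.isCompact_closure)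
      (Set.prod_mono Set.Ioc_subset_Icc_self P.Γin_subset) _
  exact h.integrable le_top

end FluidProblem

/-! ### Convergence of the integrals in the relative energy inequality. -/

section Terms

variable {d : ℕ} {P : FluidProblem d} {w : Fields d} {r : ℝ → Sp d → ℝ} {U : ℝ → Sp d → Sp d}
  {Θ : ℝ → Sp d → ℝ} {τ t : ℝ} {x : Sp d}

theorem volIntegrable_mul {φ f : ℝ → Sp d → ℝ} (hf : VolIntegrable P.Ω P.T f)
    (hφ : MemLp (fun z : ℝ × Sp d => φ z.1 z.2) ⊤
      ((volume : Measure (ℝ × Sp d)).restrict (Set.Ioc 0 P.T ×ˢ P.Ω))) :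
    VolIntegrable P.Ω P.T (fun t x => f t x * φ t x) :=
  integrable_bilin (ContinuousLinearMap.mul ℝ ℝ) hf hφ

theorem volIntegrable_inner_bounded {m V : ℝ → Sp d → Sp d} (hm : VolIntegrable P.Ω P.T m)
    (hV : MemLp (fun z : ℝ × Sp d => V z.1 z.2) ⊤
      ((volume : Measure (ℝ × Sp d)).restrict (Set.Ioc 0 P.T ×ˢ P.Ω))) :
    VolIntegrable P.Ω P.T (fun t x => ⟪m t x, V t x⟫) :=
  integrable_bilin (innerL d) hm hV

theorem memLp_fderiv_apply {V : ℝ → Sp d → Sp d} (hU : C1Closed P.Ω P.T U)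
    (hV : C1Closed P.Ω P.T V) :
    MemLp (fun z : ℝ × Sp d => fderiv ℝ (U z.1) z.2 (V z.1 z.2)) ⊤
      ((volume : Measure (ℝ × Sp d)).restrict (Set.Ioc 0 P.T ×ˢ P.Ω)) :=
  memLp_top_bilin (ContinuousLinearMap.id ℝ (Sp d →L[ℝ] Sp d))
    (hU.memLp_fderiv P.domain.isOpen P.isCompact_closure) (hV.memLp P.isCompact_closure)

theorem volIntegrable_dissipationTerm (hT : IsTestTrio P r U Θ) (hw : IsWeakSolution P w) :
    VolIntegrable P.Ω P.T (dissipationTerm P w Θ) := by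
  refine volIntegrable_congr P.domain.isOpen
    (volIntegrable_mul hw.production_integrable (hT.Θ_C1.memLp P.isCompact_closure))
    fun z _ => ?_
  simp only [Fields.production, dissipationTerm]
  ring

/-- The quadratic form is expanded: the part quadratic in u is covered by ρ u ⊗ u, the mixed parts
by the momentum, and the rest by the density. -/
theorem volIntegrable_convectiveTerm (hT : IsTestTrio P r U Θ) (hw : IsWeakSolution P w) :
    VolIntegrable P.Ω P.T (convectiveTerm w U) := by
  have hAU := memLp_fderiv_apply hT.U_C1 hT.U_C1
  have h1 := IsWeakSolution.volIntegrable_contract hw.volIntegrable_tensor hT.U_C1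
  have h2 := volIntegrable_inner_bounded hw.volIntegrable_momentum
    (V := fun t x => fderiv ℝ (U t) x (U t x)) hAU
  have h3 : VolIntegrable P.Ω P.T (fun t x => fderiv ℝ (U t) x (w.ρ t x • w.u t x)) :=
    integrable_bilin (ContinuousLinearMap.id ℝ (Sp d →L[ℝ] Sp d)).flip hw.volIntegrable_momentum
      (hT.U_C1.memLp_fderiv P.domain.isOpen P.isCompact_closure)
  have h4 := IsWeakSolution.volIntegrable_inner h3 hT.U_C1
  have h5 := volIntegrable_mul hw.volIntegrable_rho
    (φ := fun t x => ⟪U t x, fderiv ℝ (U t) x (U t x)⟫)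
    (memLp_top_bilin (innerL d) (hT.U_C1.memLp P.isCompact_closure) hAU)
  refine volIntegrable_congr P.domain.isOpen (((h1.sub h2).sub h4).add h5) fun z _ => ?_
  have hc : contract (w.ρ z.1 z.2 • tensor (w.u z.1 z.2)) (fderiv ℝ (U z.1) z.2)
      = w.ρ z.1 z.2 * ⟪w.u z.1 z.2, fderiv ℝ (U z.1) z.2 (w.u z.1 z.2)⟫ := by
    rw [← contract_tensor, ← contractL_apply, ← contractL_apply, map_smul]
    rfl
  simp only [convectiveTerm, hc, map_sub, map_smul, inner_sub_left, inner_sub_right,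
    real_inner_smul_left]
  rw [real_inner_comm (U z.1 z.2)]
  ring

theorem memLp_smul_gradient {φ f : ℝ → Sp d → ℝ}
    (hφ : C1Closed P.Ω P.T φ) (hf : C1Closed P.Ω P.T f) :
    MemLp (fun z : ℝ × Sp d => φ z.1 z.2 • gradient (f z.1) z.2) ⊤
      ((volume : Measure (ℝ × Sp d)).restrict (Set.Ioc 0 P.T ×ˢ P.Ω)) :=
  memLp_top_bilin (ContinuousLinearMap.lsmul ℝ ℝ) (hφ.memLp P.isCompact_closure)
    (hf.memLp_gradient P.domain.isOpen P.isCompact_closure)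

theorem volIntegrable_rho_inner_sub (hT : IsTestTrio P r U Θ) (hw : IsWeakSolution P w)
    {X : ℝ → Sp d → Sp d} (hX : MemLp (fun z : ℝ × Sp d => X z.1 z.2) ⊤
      ((volume : Measure (ℝ × Sp d)).restrict (Set.Ioc 0 P.T ×ˢ P.Ω))) :
    VolIntegrable P.Ω P.T (fun t x => w.ρ t x * ⟪U t x - w.u t x, X t x⟫) := by
  have h1 := volIntegrable_mul hw.volIntegrable_rho (φ := fun t x => ⟪U t x, X t x⟫)
    (memLp_top_bilin (innerL d) (hT.U_C1.memLp P.isCompact_closure) hX)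
  have h2 := volIntegrable_inner_bounded hw.volIntegrable_momentum hX
  refine volIntegrable_congr P.domain.isOpen (h1.sub h2) fun z _ => ?_
  simp only [inner_sub_left, real_inner_smul_left]
  ring

theorem volIntegrable_forceTerm (hT : IsTestTrio P r U Θ) (hw : IsWeakSolution P w) :
    VolIntegrable P.Ω P.T (forceTerm P w r U Θ) := by
  refine volIntegrable_rho_inner_sub hT hw
    (X := fun t x => dt U t x + fderiv ℝ (U t) x (U t x)
      + (1 / r t x) • gradient (pTilde P r Θ t) x - P.g x) ?_
  have h1 := memLp_smul_gradient hT.r_inv_C1 hT.p_C1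
  simp_rw [one_div]
  exact (((hT.U_C1.memLp_dt P.domain.isOpen P.isCompact_closure).add
    (memLp_fderiv_apply hT.U_C1 hT.U_C1)).add h1).sub (P.memLp_space P.g_continuous)

theorem volIntegrable_pressureDivTerm (hT : IsTestTrio P r U Θ) (hw : IsWeakSolution P w) :
    VolIntegrable P.Ω P.T (pressureDivTerm P w U) := by
  refine volIntegrable_mul hw.pressure_integrable ?_
  simp_rw [← trL_apply]
  exact (trL d).comp_memLp' (hT.U_C1.memLp_fderiv P.domain.isOpen P.isCompact_closure)

theorem volIntegrable_pressureGradTerm (hT : IsTestTrio P r U Θ) (hw : IsWeakSolution P w) :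
    VolIntegrable P.Ω P.T (pressureGradTerm P w r U Θ) := by
  refine volIntegrable_congr P.domain.isOpen
    (volIntegrable_rho_inner_sub hT hw
      (X := fun t x => (-(r t x)⁻¹) • gradient (pTilde P r Θ t) x)
      (memLp_smul_gradient (φ := fun t x => -(r t x)⁻¹) (ContDiffOn.neg hT.r_inv_C1) hT.p_C1)) fun z _ => ?_
  simp only [pressureGradTerm, real_inner_smul_right, inner_sub_left]
  ring

theorem volIntegrable_stressTerm (hT : IsTestTrio P r U Θ) (hw : IsWeakSolution P w) :
    VolIntegrable P.Ω P.T (stressTerm P w U) :=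
  IsWeakSolution.volIntegrable_contract hw.stress_integrable hT.U_C1

theorem volIntegrable_entropyTerm (hT : IsTestTrio P r U Θ) (hw : IsWeakSolution P w) :
    VolIntegrable P.Ω P.T (entropyTerm P w r Θ) := by
  have hdt := hT.Θ_C1.memLp_dt P.domain.isOpen P.isCompact_closure
  have hgr := hT.Θ_C1.memLp_gradient P.domain.isOpen P.isCompact_closure
  have h1 := volIntegrable_mul
    (hw.volIntegrable_S.sub
      (volIntegrable_mul hw.volIntegrable_rho (hT.s_C1.memLp P.isCompact_closure))) hdt
  have h2 := volIntegrable_inner_bounded hw.S_flux_integrable (V := fun t x => gradient (Θ t) x) hgr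
  have h3 := volIntegrable_inner_bounded hw.volIntegrable_momentum
    (V := fun t x => sTilde P r Θ t x • gradient (Θ t) x)
    (memLp_smul_gradient hT.s_C1 hT.Θ_C1)
  have h4 := volIntegrable_inner_bounded hw.heat_flux_integrable
    (V := fun t x => gradient (Θ t) x) hgr
  refine volIntegrable_congr P.domain.isOpen ((h1.add (h2.sub h3)).add h4) fun z _ => ?_
  simp only [entropyTerm, real_inner_smul_left, real_inner_smul_right]
  ring

theorem volIntegrable_pressureTerm (hT : IsTestTrio P r U Θ) (hw : IsWeakSolution P w) :
    VolIntegrable P.Ω P.T (pressureTerm P w r Θ) := by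
  have hdt := hT.p_C1.memLp_dt P.domain.isOpen P.isCompact_closure
  have h1 := volIntegrable_of_memLp_top P.isCompact_closure hdt
  have h2 := volIntegrable_mul hw.volIntegrable_rho
    (φ := fun t x => (r t x)⁻¹ * dt (pTilde P r Θ) t x)
    (memLp_top_bilin (ContinuousLinearMap.mul ℝ ℝ) (hT.r_inv_C1.memLp P.isCompact_closure) hdt)
  have h3 := volIntegrable_inner_bounded hw.volIntegrable_momentum
    (V := fun t x => (r t x)⁻¹ • gradient (pTilde P r Θ t) x)
    (memLp_smul_gradient hT.r_inv_C1 hT.p_C1)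
  refine volIntegrable_congr P.domain.isOpen ((h1.sub h2).sub h3) fun z _ => ?_
  simp only [pressureTerm, real_inner_smul_left, real_inner_smul_right]
  ring

/-! ### Boundary terms -/

/-- The partial derivatives of the internal energy at (r, r s̃) are Θ and μ̃, so the integrand
splits into the three outflow fluxes whose integrability is part of the solution class. -/
theorem outflowTerm_eq (hT : IsTestTrio P r U Θ) (ht : t ∈ Set.Icc 0 P.T) (hx : x ∈ closure P.Ω) :
    outflowTerm P w r Θ t x = w.EOut P t x * P.uBn x - Θ t x * (w.SOut t x * P.uBn x)
      - chemTilde P r Θ t x * (w.ρOut t x * P.uBn x) := by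
  have hr := hT.r_pos ht hx
  have hΘ := hT.Θ_pos ht hx
  rw [outflowTerm, sTilde, P.law.dIntEnergyS_eq hr hΘ, P.law.dIntEnergyRho_eq hr hΘ, chemTilde]
  ring

/-- The tilde terms of the two integrands add up to ẽ - Θs̃ + p̃/r = μ̃. What remains is Θ times the
entropy flux of the weak formulation, minus the prescribed energy flux. -/
theorem inflowTerm_add_eq (hT : IsTestTrio P r U Θ) (ht : t ∈ Set.Icc 0 P.T)
    (hx : x ∈ closure P.Ω) :
    inflowTerm P w r Θ t x + inflowPressureTerm P r Θ t x
      = Θ t x * w.inflowEntropy P t x - P.Fib x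
        + chemTilde P r Θ t x * (P.rhoB x * P.uBn x) := by
  have hr := (hT.r_pos ht hx).ne'
  have hΘ := (hT.Θ_pos ht hx).ne'
  have h1 : Θ t x * (eTilde P r Θ t x / Θ t x) = eTilde P r Θ t x := mul_div_cancel₀ _ hΘ
  simp only [inflowTerm, inflowPressureTerm, Fields.inflowEntropy, chemTilde, ThermoLaw.chemPot]
  change _ = _ + (eTilde P r Θ t x - Θ t x * sTilde P r Θ t x
    + pTilde P r Θ t x / r t x) * (P.rhoB x * P.uBn x)
  linear_combination (P.rhoB x * P.uBn x) * h1

theorem surfIntegrable_inflowPressureTerm (hd : 0 < d) (hT : IsTestTrio P r U Θ) :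
    SurfIntegrable P.Ω P.Γin P.T (inflowPressureTerm P r Θ) := by
  have h := P.surfIntegrable_mul hT.p_C1 P.Γin_subset (P.surfIntegrable_mul hT.r_inv_C1
    P.Γin_subset (P.surfIntegrable_mul P.rhoB_C1 P.Γin_subset (P.surfIntegrable_uBn hd)))
  refine surfIntegrable_congr h P.measurableSet_Γin fun z _ => ?_
  simp only [inflowPressureTerm]
  ring

theorem surfIntegrable_inflow_sum (hd : 0 < d) (hT : IsTestTrio P r U Θ)
    (hw : IsWeakSolution P w) :
    SurfIntegrable P.Ω P.Γin P.T
      (fun t x => inflowTerm P w r Θ t x + inflowPressureTerm P r Θ t x) := by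
  have h1 := P.surfIntegrable_mul hT.Θ_C1 P.Γin_subset hw.inflow_integrable
  have h2 := P.surfIntegrable_mul hT.chem_C1 P.Γin_subset
    (P.surfIntegrable_mul P.rhoB_C1 P.Γin_subset (P.surfIntegrable_uBn hd))
  exact surfIntegrable_congr ((h1.sub (P.surfIntegrable_Fib hd)).add h2) P.measurableSet_Γin
    fun z hz => (inflowTerm_add_eq hT (Set.Ioc_subset_Icc_self hz.1) (P.Γin_subset hz.2)).symm

theorem surfIntegrable_inflowTerm (hd : 0 < d) (hT : IsTestTrio P r U Θ)
    (hw : IsWeakSolution P w) : SurfIntegrable P.Ω P.Γin P.T (inflowTerm P w r Θ) :=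
  surfIntegrable_congr ((surfIntegrable_inflow_sum hd hT hw).sub
    (surfIntegrable_inflowPressureTerm hd hT)) P.measurableSet_Γin fun _ _ => by simp

theorem surfIntegrable_outflowTerm (hT : IsTestTrio P r U Θ) (hw : IsWeakSolution P w) :
    SurfIntegrable P.Ω P.Γout P.T (outflowTerm P w r Θ) :=
  surfIntegrable_congr ((hw.E_out.sub (P.surfIntegrable_mul hT.Θ_C1 P.Γout_subset hw.S_out)).sub
    (P.surfIntegrable_mul hT.chem_C1 P.Γout_subset hw.rho_out)) P.measurableSet_Γout
    fun _ hz => (outflowTerm_eq hT (Set.Ioc_subset_Icc_self hz.1) (P.Γout_subset hz.2)).symm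

/-! ### The relative energy at fixed times -/

theorem integrableOn_mul_slice {f : Sp d → ℝ} {φ : ℝ → Sp d → ℝ} (hf : IntegrableOn f P.Ω)
    (hφ : C1Closed P.Ω P.T φ) (ht : t ∈ Set.Icc 0 P.T) :
    IntegrableOn (fun x => f x * φ t x) P.Ω :=
  integrable_bilin (ContinuousLinearMap.mul ℝ ℝ) hf (hφ.memLp_slice P.isCompact_closure ht)

/-- The decomposition `relE_eq` integrated at one time. Mass and momentum are integrable at every
time, whereas the energy and the entropy are so only at t = 0 and, by Fubini, at almost every time;
hence the last two hypotheses. -/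
theorem integrableOn_relE (hT : IsTestTrio P r U Θ) (hw : IsWeakSolution P w)
    (ht : t ∈ Set.Icc 0 P.T) (hE : IntegrableOn (w.energy P t) P.Ω)
    (hS : IntegrableOn (w.S P t) P.Ω) :
    IntegrableOn (relE P w r U Θ t) P.Ω ∧
      ∫ x in P.Ω, relE P w r U Θ t x = (∫ x in P.Ω, w.energy P t x)
        + (∫ x in P.Ω, ⟪w.ρ t x • w.u t x, P.uB x - U t x⟫)
        + (∫ x in P.Ω, w.ρ t x * continuityTest P r U Θ t x)
        - (∫ x in P.Ω, w.S P t x * Θ t x) + ∫ x in P.Ω, pTilde P r Θ t x := by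
  have hb := P.isCompact_closure
  have h1 : IntegrableOn (fun x => ⟪w.ρ t x • w.u t x, P.uB x - U t x⟫) P.Ω :=
    integrable_bilin (innerL d) (hw.momentum_integrable t ht)
      (hT.velocityTest_C1.memLp_slice hb ht)
  have h2 := integrableOn_mul_slice (hw.rho_integrable t ht) hT.continuityTest_C1 ht
  have h3 := integrableOn_mul_slice hS hT.Θ_C1 ht
  have hvol : IsFiniteMeasure (volume.restrict P.Ω) :=
    ⟨by rw [Measure.restrict_apply_univ]
        exact (measure_mono subset_closure).trans_lt hb.measure_lt_top⟩
  have h4 : IntegrableOn (pTilde P r Θ t) P.Ω :=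
    (hT.p_C1.memLp_slice hb ht).integrable le_top
  have heq : Set.EqOn (relE P w r U Θ t) (fun x => w.energy P t x
      + ⟪w.ρ t x • w.u t x, P.uB x - U t x⟫ + w.ρ t x * continuityTest P r U Θ t x
      - w.S P t x * Θ t x + pTilde P r Θ t x) P.Ω :=
    fun x hx => hT.relE_eq w ht (subset_closure hx)
  have hE1 := Integrable.add hE h1
  have hE2 := Integrable.add hE1 h2
  have hE3 := Integrable.sub hE2 h3
  have hE4 := Integrable.add hE3 h4
  refine ⟨IntegrableOn.congr_fun hE4 heq.symm P.measurableSet_Ω, ?_⟩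
  rw [setIntegral_congr_fun P.measurableSet_Ω heq]
  refine (integral_add hE3 h4).trans ?_
  congr 1
  refine (integral_sub hE2 h3).trans ?_
  congr 1
  refine (integral_add hE1 h2).trans ?_
  congr 1
  exact integral_add hE h1

theorem relativeEnergyTermsIntegrable (hd : 0 < d) (hT : IsTestTrio P r U Θ)
    (hw : IsWeakSolution P w) : RelativeEnergyTermsIntegrable P w r U Θ where
  relE_zero := (integrableOn_relE hT hw ⟨le_rfl, P.T_pos.le⟩ hw.energy_integrable_zero
    hw.S_integrable_zero).1
  relE_ae := by
    filter_upwards [hw.energy_integrable.ae_slice, hw.volIntegrable_S.ae_slice,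
      ae_restrict_mem measurableSet_Icc] with t h1 h2 ht using (integrableOn_relE hT hw ht h1 h2).1
  outflow := surfIntegrable_outflowTerm hT hw
  dissipation := volIntegrable_dissipationTerm hT hw
  convective := volIntegrable_convectiveTerm hT hw
  force := volIntegrable_forceTerm hT hw
  pressureDiv := volIntegrable_pressureDivTerm hT hw
  pressureGrad := volIntegrable_pressureGradTerm hT hw
  stress := volIntegrable_stressTerm hT hw
  entropy := volIntegrable_entropyTerm hT hw
  inflow := surfIntegrable_inflowTerm hd hT hw
  inflowPressure := surfIntegrable_inflowPressureTerm hd hT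
  pressure := volIntegrable_pressureTerm hT hw

end Terms

/-! ### Summation of the balance laws. -/

section Inequality

variable {d : ℕ} {P : FluidProblem d} {w : Fields d} {r : ℝ → Sp d → ℝ} {U : ℝ → Sp d → Sp d}
  {Θ : ℝ → Sp d → ℝ} {τ t : ℝ} {x : Sp d}

theorem volIntegrable_fderiv_apply {φ : ℝ → Sp d → ℝ} {m : ℝ → Sp d → Sp d}
    (hφ : C1Closed P.Ω P.T φ) (hm : VolIntegrable P.Ω P.T m) :
    VolIntegrable P.Ω P.T (fun t x => fderiv ℝ (φ t) x (m t x)) :=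
  integrable_bilin (ContinuousLinearMap.id ℝ (Sp d →L[ℝ] ℝ)).flip hm
    (hφ.memLp_fderiv P.domain.isOpen P.isCompact_closure)

namespace IsWeakSolution

theorem volIntegrable_force_uB (hw : IsWeakSolution P w) :
    VolIntegrable P.Ω P.T (fun t x => w.ρ t x * ⟪P.g x, w.u t x - P.uB x⟫) := by
  have h1 := volIntegrable_inner_bounded hw.volIntegrable_momentum (V := fun _ x => P.g x)
    (P.memLp_space P.g_continuous)
  have h2 := IsWeakSolution.volIntegrable_inner
    (hw.volIntegrable_rho_smul P.g_continuous) P.uB_C1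
  refine volIntegrable_congr P.domain.isOpen (h1.sub h2) fun z _ => ?_
  simp only [real_inner_smul_left, inner_sub_right]
  rw [real_inner_comm (P.g z.2)]
  ring

theorem volIntegrable_rho_fderiv (hw : IsWeakSolution P w) {φ : ℝ → Sp d → ℝ}
    (hφ : C1Closed P.Ω P.T φ) :
    VolIntegrable P.Ω P.T (fun t x => w.ρ t x * fderiv ℝ (φ t) x (w.u t x)) := by
  refine volIntegrable_congr P.domain.isOpen
    (volIntegrable_fderiv_apply hφ hw.volIntegrable_momentum) fun z _ => ?_
  simp only [map_smul, smul_eq_mul]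

theorem volIntegrable_kinetic_uB (hw : IsWeakSolution P w) :
    VolIntegrable P.Ω P.T
      (fun t x => w.ρ t x * (1 / 2 * fderiv ℝ (fun y => ‖P.uB y‖ ^ 2) x (w.u t x))) := by
  have h := Integrable.const_mul (hw.volIntegrable_rho_fderiv P.uB_sq_C1) (1 / 2)
  refine Integrable.congr h (.of_forall fun z => ?_)
  simp only
  ring

/-- The energy balance without time weight. -/
theorem energy_balance_one (hw : IsWeakSolution P w) :
    ∀ᵐ τ ∂(volume.restrict (Set.Icc 0 P.T)),
      ((∫ x in P.Ω, w.energy P τ x) - ∫ x in P.Ω, w.energy P 0 x)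
        + surfInt P.Ω P.Γout τ (fun t x => w.EOut P t x * P.uBn x)
      ≤ volInt P.Ω τ (fun t x => w.ρ t x * ⟪P.g x, w.u t x - P.uB x⟫
          + w.ρ t x * (1 / 2 * fderiv ℝ (fun y => ‖P.uB y‖ ^ 2) x (w.u t x))
          - contract (w.flux P t x) (fderiv ℝ P.uB x))
        - surfInt P.Ω P.Γin τ (fun _ x => P.Fib x) := by
  filter_upwards [hw.energy_balance (fun _ => 1) contDiffOn_const (fun _ _ => zero_le_one),
    ae_restrict_mem measurableSet_Icc] with τ hτ hτT
  have hS := IsWeakSolution.volIntegrable_contract hw.stress_integrable P.uB_C1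
  have hM := IsWeakSolution.volIntegrable_contract hw.volIntegrable_flux P.uB_C1
  have hg := hw.volIntegrable_force_uB
  have hq := hw.volIntegrable_kinetic_uB
  -- The energy balance has -(ρu ⊗ u + p𝕀) : ∇u_b and 𝕊 : ∇u_b separately; together they are minus
  -- the contraction of `flux` with ∇u_b.
  have e1 : volInt P.Ω τ (fun t x => w.ρ t x * ⟪w.u t x, fderiv ℝ P.uB x (w.u t x)⟫
      + w.pr P t x * tr (fderiv ℝ P.uB x))
      = volInt P.Ω τ (fun t x => contract (w.flux P t x) (fderiv ℝ P.uB x))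
        + volInt P.Ω τ (fun t x => contract (w.stress P t x) (fderiv ℝ P.uB x)) := by
    rw [← volInt_add hM hS hτT.2]
    simp_rw [w.contract_flux P, sub_add_cancel]
  have e2 : 1 / 2 * volInt P.Ω τ (fun t x =>
      w.ρ t x * fderiv ℝ (fun y => ‖P.uB y‖ ^ 2) x (w.u t x))
      = volInt P.Ω τ
        (fun t x => w.ρ t x * (1 / 2 * fderiv ℝ (fun y => ‖P.uB y‖ ^ 2) x (w.u t x))) := by
    rw [volInt, volInt, ← integral_const_mul]
    congr 1
    funext z
    ring
  have e0 : volInt P.Ω τ (fun _ _ => (0 : ℝ)) = 0 := by simp [volInt]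
  simp only [deriv_const, zero_mul, one_mul, mul_one, e0] at hτ
  rw [e1, e2] at hτ
  rw [volInt_sub (hg.add hq) hM hτT.2, volInt_add hg hq hτT.2]
  linarith

end IsWeakSolution

/-- The pointwise identity behind the relative energy inequality. -/
theorem volume_terms_eq (hT : IsTestTrio P r U Θ) (w : Fields d) {z : ℝ × Sp d}
    (hz : z ∈ Set.Ioo 0 P.T ×ˢ P.Ω) :
    (w.ρ z.1 z.2 * ⟪P.g z.2, w.u z.1 z.2 - P.uB z.2⟫
      + w.ρ z.1 z.2 * (1 / 2 * fderiv ℝ (fun y => ‖P.uB y‖ ^ 2) z.2 (w.u z.1 z.2))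
      - contract (w.flux P z.1 z.2) (fderiv ℝ P.uB z.2))
    + (⟪w.ρ z.1 z.2 • w.u z.1 z.2, dt (fun t x => P.uB x - U t x) z.1 z.2⟫
      + contract (w.flux P z.1 z.2) (fderiv ℝ (fun x => P.uB x - U z.1 x) z.2)
      + ⟪w.ρ z.1 z.2 • P.g z.2, P.uB z.2 - U z.1 z.2⟫)
    + (w.ρ z.1 z.2 * dt (continuityTest P r U Θ) z.1 z.2
      + w.ρ z.1 z.2 * fderiv ℝ (continuityTest P r U Θ z.1) z.2 (w.u z.1 z.2))
    - (w.S P z.1 z.2 * dt Θ z.1 z.2 + w.S P z.1 z.2 * fderiv ℝ (Θ z.1) z.2 (w.u z.1 z.2)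
      + fderiv ℝ (Θ z.1) z.2 ((w.θ z.1 z.2)⁻¹ • w.q P z.1 z.2))
    + dt (pTilde P r Θ) z.1 z.2
    = forceTerm P w r U Θ z.1 z.2 - convectiveTerm w U z.1 z.2 - pressureDivTerm P w U z.1 z.2
      + pressureGradTerm P w r U Θ z.1 z.2 + stressTerm P w U z.1 z.2
      - entropyTerm P w r Θ z.1 z.2 + pressureTerm P w r Θ z.1 z.2 := by
  have hc : contract (w.flux P z.1 z.2) (fderiv ℝ P.uB z.2 - fderiv ℝ (U z.1) z.2)
      = contract (w.flux P z.1 z.2) (fderiv ℝ P.uB z.2)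
        - contract (w.flux P z.1 z.2) (fderiv ℝ (U z.1) z.2) := by
    simp only [← contractL_apply, map_sub]
  -- Once the derivatives of the test functions are inserted, every term with u_b cancels between
  -- the energy, momentum and continuity contributions. The ∇p̃ part of `forceTerm` cancels
  -- `pressureGradTerm`, and the s̃ parts of `entropyTerm` come from the continuity test function.
  rw [hT.dt_velocityTest hz, hT.fderiv_velocityTest hz, hc, IsTestTrio.fderiv_uB_sq hz,
    hT.dt_continuityTest hz, hT.fderiv_continuityTest hz, w.contract_flux P z.1 z.2 (fderiv ℝ (U z.1) z.2)]
  simp only [forceTerm, convectiveTerm, pressureDivTerm, pressureGradTerm, stressTerm, entropyTerm,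
    pressureTerm, inner_sub_left, inner_sub_right, inner_add_right, real_inner_smul_left,
    real_inner_smul_right, inner_gradient, map_sub, map_smul, smul_eq_mul, inner_neg_right]
  rw [real_inner_comm (w.u z.1 z.2) (P.g z.2), real_inner_comm (P.uB z.2) (P.g z.2),
    real_inner_comm (U z.1 z.2) (P.g z.2)]
  ring

theorem relativeEnergyInequality (hd : 0 < d) (hT : IsTestTrio P r U Θ)
    (hw : IsWeakSolution P w) :
    ∀ᵐ τ ∂(volume.restrict (Set.Icc 0 P.T)), RelativeEnergyInequality P w r U Θ τ := by
  have hΩ := P.domain.isOpen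
  have hb := P.isCompact_closure
  have hterms := relativeEnergyTermsIntegrable hd hT hw
  -- Only the energy and entropy relations and the integrability of the corresponding time slices
  -- restrict τ to a set of full measure; momentum and continuity hold at every time.
  filter_upwards [hw.energy_balance_one, hw.entropy_inequality Θ hT.Θ_C1
    (fun t ht x hx => (hT.Θ_pos ht hx).le), hw.energy_integrable.ae_slice,
    hw.volIntegrable_S.ae_slice, ae_restrict_mem measurableSet_Icc]
    with τ henergy hentropy hEτ hSτ hτ
  have hmom := hw.momentum_of_eq_zero_on_frontier hT.velocityTest_C1
    (fun t ht x hx => by rw [hT.U_boundary t ht x hx, sub_self]) hτ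
  have hcont := hw.continuity _ hT.continuityTest_C1 τ hτ
  have hp := hT.p_C1.integral_sub_integral hΩ hb hτ
  have hdiss : volInt P.Ω τ (fun t x => Θ t x * w.production P t x)
      = volInt P.Ω τ (dissipationTerm P w Θ) := by
    refine volInt_congr hΩ fun z _ => ?_
    simp only [Fields.production, dissipationTerm]
    ring
  have hΓ : ∀ {Γ : Set (Sp d)} {s : ℝ × Sp d}, Γ ⊆ closure P.Ω → s ∈ Set.Ioc 0 τ ×ˢ Γ →
      s.1 ∈ Set.Icc 0 P.T ∧ s.2 ∈ closure P.Ω := fun h hs =>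
    ⟨⟨hs.1.1.le, hs.1.2.trans hτ.2⟩, h hs.2⟩
  -- outflow boundary
  have ho2 := P.surfIntegrable_mul hT.Θ_C1 P.Γout_subset hw.S_out
  have ho3 := P.surfIntegrable_mul hT.chem_C1 P.Γout_subset hw.rho_out
  have hout : surfInt P.Ω P.Γout τ (outflowTerm P w r Θ)
      = surfInt P.Ω P.Γout τ (fun t x => w.EOut P t x * P.uBn x)
        - surfInt P.Ω P.Γout τ (fun t x => Θ t x * w.SOut t x * P.uBn x)
        + surfInt P.Ω P.Γout τ (fun t x => continuityTest P r U Θ t x * w.ρOut t x * P.uBn x) := by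
    have h1 : surfInt P.Ω P.Γout τ (fun t x => continuityTest P r U Θ t x * w.ρOut t x * P.uBn x)
        = -surfInt P.Ω P.Γout τ (fun t x => chemTilde P r Θ t x * (w.ρOut t x * P.uBn x)) := by
      rw [surfInt, surfInt, ← integral_neg]
      refine setIntegral_congr_fun (measurableSet_Ioc.prod P.measurableSet_Γout) fun z hz => ?_
      rw [hT.continuityTest_frontier (hΓ P.Γout_subset hz).1 hz.2.1]
      ring
    have h2 : surfInt P.Ω P.Γout τ (outflowTerm P w r Θ)
        = surfInt P.Ω P.Γout τ (fun t x => w.EOut P t x * P.uBn x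
          - Θ t x * (w.SOut t x * P.uBn x) - chemTilde P r Θ t x * (w.ρOut t x * P.uBn x)) :=
      surfInt_congr P.measurableSet_Γout fun z hz =>
        outflowTerm_eq hT (hΓ P.Γout_subset hz).1 (hΓ P.Γout_subset hz).2
    rw [h1, h2,
      surfInt_sub (hw.E_out.sub ho2) ho3 hτ.2, surfInt_sub hw.E_out ho2 hτ.2]
    simp_rw [← mul_assoc]
    ring
  -- inflow boundary
  have hi1 := P.surfIntegrable_mul hT.Θ_C1 P.Γin_subset hw.inflow_integrable
  have hi2 := P.surfIntegrable_Fib hd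
  have hi3 := P.surfIntegrable_mul hT.chem_C1 P.Γin_subset
    (P.surfIntegrable_mul P.rhoB_C1 P.Γin_subset (P.surfIntegrable_uBn hd))
  have hin : surfInt P.Ω P.Γin τ (inflowTerm P w r Θ)
        + surfInt P.Ω P.Γin τ (inflowPressureTerm P r Θ)
      = surfInt P.Ω P.Γin τ (fun t x => Θ t x * w.inflowEntropy P t x)
        - surfInt P.Ω P.Γin τ (fun _ x => P.Fib x)
        - surfInt P.Ω P.Γin τ (fun t x => continuityTest P r U Θ t x * P.rhoB x * P.uBn x) := by
    have h1 : surfInt P.Ω P.Γin τ (fun t x => continuityTest P r U Θ t x * P.rhoB x * P.uBn x)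
        = -surfInt P.Ω P.Γin τ (fun t x => chemTilde P r Θ t x * (P.rhoB x * P.uBn x)) := by
      rw [surfInt, surfInt, ← integral_neg]
      refine setIntegral_congr_fun (measurableSet_Ioc.prod P.measurableSet_Γin) fun z hz => ?_
      rw [hT.continuityTest_frontier (hΓ P.Γin_subset hz).1 hz.2.1]
      ring
    have h2 : surfInt P.Ω P.Γin τ
          (fun t x => inflowTerm P w r Θ t x + inflowPressureTerm P r Θ t x)
        = surfInt P.Ω P.Γin τ (fun t x => Θ t x * w.inflowEntropy P t x - P.Fib x
          + chemTilde P r Θ t x * (P.rhoB x * P.uBn x)) :=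
      surfInt_congr P.measurableSet_Γin fun z hz =>
        inflowTerm_add_eq hT (hΓ P.Γin_subset hz).1 (hΓ P.Γin_subset hz).2
    rw [h1, ← surfInt_add hterms.inflow hterms.inflowPressure hτ.2, h2,
      surfInt_add (hi1.sub hi2) hi3 hτ.2, surfInt_sub hi1 hi2 hτ.2]
    ring
  -- volume terms
  have v1 := (hw.volIntegrable_force_uB.add hw.volIntegrable_kinetic_uB).sub
    (IsWeakSolution.volIntegrable_contract hw.volIntegrable_flux P.uB_C1)
  have m1 := hw.volIntegrable_inner_dt hT.velocityTest_C1
  have m2 := IsWeakSolution.volIntegrable_contract hw.volIntegrable_flux hT.velocityTest_C1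
  have m3 := IsWeakSolution.volIntegrable_inner (hw.volIntegrable_rho_smul P.g_continuous)
    hT.velocityTest_C1
  have v3 := (volIntegrable_mul hw.volIntegrable_rho (hT.continuityTest_C1.memLp_dt hΩ hb)).add
    (hw.volIntegrable_rho_fderiv hT.continuityTest_C1)
  have s2 : VolIntegrable P.Ω P.T (fun t x => w.S P t x * fderiv ℝ (Θ t) x (w.u t x)) := by
    refine volIntegrable_congr hΩ (volIntegrable_fderiv_apply hT.Θ_C1 hw.S_flux_integrable)
      fun z _ => ?_
    simp only [map_smul, smul_eq_mul]
  have v4 := ((volIntegrable_mul hw.volIntegrable_S (hT.Θ_C1.memLp_dt hΩ hb)).add s2).add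
    (volIntegrable_fderiv_apply hT.Θ_C1 hw.heat_flux_integrable)
  have v5 : VolIntegrable P.Ω P.T (fun t x => dt (pTilde P r Θ) t x) :=
    volIntegrable_of_memLp_top hb (hT.p_C1.memLp_dt hΩ hb)
  have v12 := v1.add ((m1.add m2).add m3)
  have v123 := v12.add v3
  have v1234 := v123.sub v4
  have f1 := hterms.force.sub hterms.convective
  have f2 := f1.sub hterms.pressureDiv
  have f3 := f2.add hterms.pressureGrad
  have f4 := f3.add hterms.stress
  have f5 := f4.sub hterms.entropy
  have hvol : volInt P.Ω τ (fun t x => w.ρ t x * ⟪P.g x, w.u t x - P.uB x⟫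
          + w.ρ t x * (1 / 2 * fderiv ℝ (fun y => ‖P.uB y‖ ^ 2) x (w.u t x))
          - contract (w.flux P t x) (fderiv ℝ P.uB x))
        + (volInt P.Ω τ (fun t x => ⟪w.ρ t x • w.u t x, dt (fun t x => P.uB x - U t x) t x⟫)
          + volInt P.Ω τ
            (fun t x => contract (w.flux P t x) (fderiv ℝ (fun x => P.uB x - U t x) x))
          + volInt P.Ω τ (fun t x => ⟪w.ρ t x • P.g x, P.uB x - U t x⟫))
        + volInt P.Ω τ (fun t x => w.ρ t x * dt (continuityTest P r U Θ) t x
          + w.ρ t x * fderiv ℝ (continuityTest P r U Θ t) x (w.u t x))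
        - volInt P.Ω τ (fun t x => w.S P t x * dt Θ t x + w.S P t x * fderiv ℝ (Θ t) x (w.u t x)
          + fderiv ℝ (Θ t) x ((w.θ t x)⁻¹ • w.q P t x))
        + volInt P.Ω τ (dt (pTilde P r Θ))
      = volInt P.Ω τ (forceTerm P w r U Θ) - volInt P.Ω τ (convectiveTerm w U)
        - volInt P.Ω τ (pressureDivTerm P w U) + volInt P.Ω τ (pressureGradTerm P w r U Θ)
        + volInt P.Ω τ (stressTerm P w U) - volInt P.Ω τ (entropyTerm P w r Θ)
        + volInt P.Ω τ (pressureTerm P w r Θ) := by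
    rw [← volInt_add m1 m2 hτ.2, ← volInt_add (m1.add m2) m3 hτ.2,
      ← volInt_add v1 ((m1.add m2).add m3) hτ.2, ← volInt_add v12 v3 hτ.2,
      ← volInt_sub v123 v4 hτ.2, ← volInt_add v1234 v5 hτ.2,
      ← volInt_sub hterms.force hterms.convective hτ.2, ← volInt_sub f1 hterms.pressureDiv hτ.2,
      ← volInt_add f2 hterms.pressureGrad hτ.2, ← volInt_add f3 hterms.stress hτ.2,
      ← volInt_sub f4 hterms.entropy hτ.2, ← volInt_add f5 hterms.pressure hτ.2]
    exact volInt_congr hΩ fun z hz =>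
      volume_terms_eq hT w ⟨⟨hz.1.1, hz.1.2.trans_le hτ.2⟩, hz.2⟩
  rw [RelativeEnergyInequality, (integrableOn_relE hT hw hτ hEτ hSτ).2,
    (integrableOn_relE hT hw ⟨le_rfl, P.T_pos.le⟩ hw.energy_integrable_zero
      hw.S_integrable_zero).2, ← hdiss, hout]
  -- Energy plus momentum plus continuity minus entropy, plus the identity for p̃; reversing the
  -- entropy inequality puts the dissipation on the left.
  linarith

end Inequality

end NSF

theorem proposition3p1 (d : ℕ) (hd : d = 2 ∨ d = 3) (P : NSF.FluidProblem d) :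
    (∀ (r : ℝ → NSF.Sp d → ℝ) (U : ℝ → NSF.Sp d → NSF.Sp d) (Θ : ℝ → NSF.Sp d → ℝ),
      NSF.IsTestTrio P r U Θ → ∀ w : NSF.Fields d, NSF.IsWeakSolution P w →
        NSF.RelativeEnergyTermsIntegrable P w r U Θ ∧
        ∀ᵐ τ ∂(MeasureTheory.volume.restrict (Set.Icc 0 P.T)),
          NSF.RelativeEnergyInequality P w r U Θ τ) ∧
    (∀ (ρ θ r Θ : ℝ) (u U : NSF.Sp d), 0 < ρ → 0 < θ → 0 < r → 0 < Θ →
      P.law.relEnergy ρ u θ r U Θ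
          = P.law.bregman (ρ, ρ • u, ρ * P.law.s ρ θ) (r, r • U, r * P.law.s r Θ) ∧
      P.law.relEnergy ρ u θ r U Θ
          = 1 / 2 * ρ * ‖u - U‖ ^ 2 + P.law.helmholtz Θ ρ θ
            - deriv (fun y => P.law.helmholtz Θ y Θ) r * (ρ - r) - P.law.helmholtz Θ r Θ) ∧
    (Convex ℝ P.law.states →
      ConvexOn ℝ {z : ℝ × NSF.Sp d × ℝ | (z.1, z.2.2) ∈ P.law.states} P.law.totalEnergy) := by
  have hd0 : 0 < d := by omega
  refine ⟨fun r U Θ hT w hw => ⟨NSF.relativeEnergyTermsIntegrable hd0 hT hw,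
    NSF.relativeEnergyInequality hd0 hT hw⟩, fun ρ θ r Θ u U hρ hθ hr hΘ =>
    ⟨P.law.relEnergy_eq_bregman hρ hθ hr hΘ u U, P.law.relEnergy_eq_helmholtz hρ hr hΘ u U⟩,
    P.law.convexOn_totalEnergy⟩
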